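/- Let $n\ge 1$. All functions are Lebesgue measurable on $\mathbb R^n$. A *ball Banach function space* $X$ is a linear space of measurable functions, given by a norm $\|\cdot\|_X$ (defined for all measurable functions, possibly $\infty$, with $X=\{\|f\|_X<\infty\}$), such that: $\|f\|_X=0$ implies $f=0$ a.e.; $|g|\le|f|$ a.e. implies $\|g\|_X\le\|f\|_X$; $0\le f_m\uparrow f$ a.e. implies $\|f_m\|_X\uparrow\|f\|_X$; $\mathbf 1_B\in X$ for every ball $B$; and for every ball $B$ there is $C_B$ with $\int_B|f|\le C_B\|f\|_X$ for all $f\in X$. For $p>0$, $X^p$ is given by $\|f\|_{X^p}:=\||f|^p\|_X^{1/p}$; the associate space $X'$ is given by $\|f\|_{X'}:=\sup\{\|fg\|_{L^1}:\|g\|_X=1\}$. $X$ has *absolutely continuous norm* if $\|f\mathbf 1_{E_j}\|_X\to0$ whenever $f\in X$ and $\mathbf 1_{E_j}\to0$ a.e. Let $\mathcal M f(x):=\sup_{B\ni x}\frac1{|B|}\int_B|f|$ (supremum over balls $B$ containing $x$) and $\mathcal B_rf(x):=\frac1{|B(x,r)|}\int_{B(x,r)}|f|$. Let $\dot W^{1,X}$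 be the set of real-valued $f\in L^1_{\rm loc}(\mathbb R^n)$ whose distributional gradient $\nabla f$ is a locally integrable function with $|\nabla f|\in X$. For $\lambda>0$, $\gamma\in\mathbb R\setminus\{0\}$ and $q>0$ put $$E_{\lambda,\gamma/q}[f]:=\Big\{(x,y):x\ne y,\ \frac{|f(x)-f(y)|}{|x-y|^{1+\gamma/q}}>\lambda\Big\},\qquad \Phi_\lambda(f):=\lambda\left\|\left[\int_{\mathbb R^n}\mathbf 1_{E_{\lambda,\gamma/q}[f]}(\cdot,y)\,|\cdot-y|^{\gamma-n}\,dy\right]^{1/q}\right\|_X,$$ and $\kappa(q,n):=\int_{\mathbb S^{n-1}}|e\cdot\omega|^q\,d\omega$, where $e$ is any unit vector of $\mathbb R^n$. **Theorem.** Let $X$ be a ball Banach function space with absolutely continuous norm on which the operators $\mathcal B_r$, $r\in(0,\infty)$, are uniformly bounded. Assume that there is a sequence $\{\theta_m\}_{m\in\mathbb N}\subset(0,1)$ with $\theta_m\to1$ such that, for every $m$, $X^{1/\theta_m}$ is a ball Banach function space and $\mathcal M$ is bounded on $(X^{1/\theta_m})'$, and such that $\lim_{m\to\infty}\|\mathcal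 M\|_{(X^{1/\theta_m})'\to(X^{1/\theta_m})'}$ exists and is finite. Assume further that one of the following holds: (a) $\gamma\in\mathbb R\setminus\{0\}$, $q\in(0,1]$, and $\mathcal M$ is bounded on $X$; (b) $\gamma\in\mathbb R\setminus\{0\}$, $q\in(0,\infty)$, and there is an $r\in(n,\infty)$ such that $\mathcal M$ is bounded on $X^{1/r}$; (c) $\gamma\in(0,\infty)$ and $q\in(0,\infty)$ satisfies $n(1-\frac1q)<1$; (d) $\gamma\in(-\infty,-1)$ and $n=q=1$. Then: (i) There is a positive constant $C$ such that, for every $f\in\dot W^{1,X}$, $$\left[\frac{\kappa(q,n)}{|\gamma|}\right]^{1/q}\||\nabla f|\|_X\le\sup_{\lambda>0}\Phi_\lambda(f)\le C\,\||\nabla f|\|_X.$$ (ii) If $\gamma>0$, then for every $f\in\dot W^{1,X}$, $\displaystyle\lim_{\lambda\to\infty}\Phi_\lambda(f)=\left[\frac{\kappa(q,n)}{\gamma}\right]^{1/q}\||\nabla f|\|_X$. (iii) If $\gamma<0$ and either $n\ge2$ and $q\in(0,\frac{n-\gamma}{n})$, or $n=1$, $q\in(0,-\gamma)$ and $\gamma<-1$,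 then for every $f\in\dot W^{1,X}$, $\displaystyle\lim_{\lambda\to0^+}\Phi_\lambda(f)=\left[-\frac{\kappa(q,n)}{\gamma}\right]^{1/q}\||\nabla f|\|_X$. -/

import Mathlib

open MeasureTheory Set Filter Topology
open scoped ENNReal NNReal ContDiff

noncomputable section

namespace BVY

/-- Euclidean space `ℝⁿ`, with the Euclidean norm. -/
abbrev Rn (n : ℕ) : Type := EuclideanSpace ℝ (Fin n)

/-- A functional `f ↦ ‖f‖_X` defined on nonnegative extended-valued functions on `ℝⁿ`.  A function
space `X` of measurable functions with the lattice property is encoded by such a functional `N`: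
`X` consists of the (Lebesgue) measurable `f` with `N |f| < ∞`, and `‖f‖_X = N |f|`.  Only the
values of `N` at Lebesgue measurable functions (`AEMeasurable` with respect to Lebesgue measure)
matter. -/
abbrev FunctionNorm (n : ℕ) : Type := (Rn n → ℝ≥0∞) → ℝ≥0∞

/-- `X` is a ball Banach function space on `ℝⁿ`.  Completeness of `X` is a consequence of the
lattice property `mono` and the Fatou property `fatou`. -/
structure IsBallBanach {n : ℕ} (N : FunctionNorm n) : Prop where
  /-- absolute homogeneity of the norm -/
  smul : ∀ (c : ℝ≥0) (f : Rn n → ℝ≥0∞), AEMeasurable f volume →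
    N (fun x => (c : ℝ≥0∞) * f x) = (c : ℝ≥0∞) * N f
  /-- `‖f‖_X = 0` only if `f = 0` almost everywhere -/
  eq_zero : ∀ f : Rn n → ℝ≥0∞, AEMeasurable f volume → N f = 0 → f =ᵐ[volume] 0
  /-- lattice property -/
  mono : ∀ f g : Rn n → ℝ≥0∞, AEMeasurable f volume → AEMeasurable g volume →
    g ≤ᵐ[volume] f → N g ≤ N f
  /-- `0 ≤ f_m ↑ f` almost everywhere implies `‖f_m‖_X ↑ ‖f‖_X` -/
  fatou : ∀ (F : ℕ → Rn n → ℝ≥0∞) (f : Rn n → ℝ≥0∞), (∀ m, AEMeasurable (F m) volume) →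
    AEMeasurable f volume →
    (∀ᵐ x ∂(volume : Measure (Rn n)),
      Monotone (fun m => F m x) ∧ Tendsto (fun m => F m x) atTop (𝓝 (f x))) →
    Tendsto (fun m => N (F m)) atTop (𝓝 (N f))
  /-- indicator functions of balls belong to `X` -/
  ball_mem : ∀ (c : Rn n) (r : ℝ), 0 < r → N ((Metric.ball c r).indicator 1) < ⊤
  /-- triangle inequality -/
  add_le : ∀ f g : Rn n → ℝ≥0∞, AEMeasurable f volume → AEMeasurable g volume →
    N (fun x => f x + g x) ≤ N f + N g
  /-- `X` embeds into `L¹` on every ball -/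
  integral_ball_le : ∀ (c : Rn n) (r : ℝ), 0 < r → ∃ C : ℝ≥0, ∀ f : Rn n → ℝ≥0∞,
    AEMeasurable f volume → ∫⁻ x in Metric.ball c r, f x ≤ (C : ℝ≥0∞) * N f

/-- The norm of the `p`-convexification `X^p`: `‖f‖_{X^p} = ‖|f|^p‖_X^{1/p}`. -/
def convexification {n : ℕ} (N : FunctionNorm n) (p : ℝ) : FunctionNorm n :=
  fun f => N (fun x => f x ^ p) ^ (1 / p)

/-- The norm of the associate space (Köthe dual) `X'`:
`‖f‖_{X'} = sup {‖f g‖_{L¹} : g ∈ X, ‖g‖_X = 1}`. -/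
def associate {n : ℕ} (N : FunctionNorm n) : FunctionNorm n :=
  fun f => ⨆ (g : Rn n → ℝ≥0∞) (_ : AEMeasurable g volume) (_ : N g = 1), ∫⁻ x, f x * g x

/-- `X` has an absolutely continuous norm. -/
def HasAbsContNorm {n : ℕ} (N : FunctionNorm n) : Prop :=
  ∀ f : Rn n → ℝ≥0∞, AEMeasurable f volume → N f < ⊤ →
    ∀ S : ℕ → Set (Rn n), (∀ j, NullMeasurableSet (S j) volume) →
      (∀ᵐ x ∂(volume : Measure (Rn n)),
        Tendsto (fun j => (S j).indicator (1 : Rn n → ℝ≥0∞) x) atTop (𝓝 0)) →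
      Tendsto (fun j => N ((S j).indicator f)) atTop (𝓝 0)

/-- The (uncentered) Hardy–Littlewood maximal operator. -/
def maximal {n : ℕ} (f : Rn n → ℝ≥0∞) : Rn n → ℝ≥0∞ :=
  fun x => ⨆ (c : Rn n) (r : ℝ) (_ : 0 < r) (_ : x ∈ Metric.ball c r),
    ⨍⁻ y in Metric.ball c r, f y ∂volume

/-- The centered ball average operator `𝓑_r`. -/
def ballAverage {n : ℕ} (r : ℝ) (f : Rn n → ℝ≥0∞) : Rn n → ℝ≥0∞ :=
  fun x => ⨍⁻ y in Metric.ball x r, f y ∂volume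

/-- `‖T f‖_X ≤ C ‖f‖_X` for every `f ∈ X`. -/
def BoundedBy {n : ℕ} (T : (Rn n → ℝ≥0∞) → Rn n → ℝ≥0∞) (N : FunctionNorm n) (C : ℝ≥0∞) : Prop :=
  ∀ f : Rn n → ℝ≥0∞, AEMeasurable f volume → N f < ⊤ → N (T f) ≤ C * N f

/-- `T` is bounded on `X`. -/
def IsBoundedOn {n : ℕ} (T : (Rn n → ℝ≥0∞) → Rn n → ℝ≥0∞) (N : FunctionNorm n) : Prop :=
  ∃ C : ℝ≥0, BoundedBy T N C

/-- The operator norm `‖T‖_{X → X}`. -/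
def opNorm {n : ℕ} (T : (Rn n → ℝ≥0∞) → Rn n → ℝ≥0∞) (N : FunctionNorm n) : ℝ≥0∞ :=
  sInf {C : ℝ≥0∞ | BoundedBy T N C}

/-- `g` is the distributional gradient of `f`, both being locally integrable. -/
structure HasWeakGradient {n : ℕ} (f : Rn n → ℝ) (g : Rn n → Rn n) : Prop where
  locallyIntegrable : LocallyIntegrable f volume
  locallyIntegrable_grad : LocallyIntegrable g volume
  integral_eq : ∀ φ : Rn n → ℝ, ContDiff ℝ ∞ φ → HasCompactSupport φ → ∀ i : Fin n,
    ∫ x, f x * fderiv ℝ φ x (EuclideanSpace.single i 1) = -∫ x, φ x * g x i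

/-- `f` belongs to the homogeneous Sobolev space `Ẇ^{1,X}(ℝⁿ)` and `∇f = g`.  (A distribution whose
gradient lies in `X`, hence is locally integrable, is itself a locally integrable function.) -/
def MemHomSobolev {n : ℕ} (N : FunctionNorm n) (f : Rn n → ℝ) (g : Rn n → Rn n) : Prop :=
  HasWeakGradient f g ∧ N (fun x => ‖g x‖ₑ) < ⊤

/-- The set `E_{λ,b}[f] = {(x,y) : x ≠ y, |f(x) - f(y)| / |x - y|^{1+b} > λ}`. -/
def levelSet {n : ℕ} (f : Rn n → ℝ) (lam b : ℝ) : Set (Rn n × Rn n) :=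
  {z | z.1 ≠ z.2 ∧ lam < |f z.1 - f z.2| / ‖z.1 - z.2‖ ^ (1 + b)}

/-- `λ ‖ [∫ 1_{E_{λ,γ/q}[f]}(·,y) |· - y|^{γ-n} dy]^{1/q} ‖_X`. -/
def functional {n : ℕ} (N : FunctionNorm n) (γ q : ℝ) (f : Rn n → ℝ) (lam : ℝ) : ℝ≥0∞ :=
  ENNReal.ofReal lam * N (fun x =>
    (∫⁻ y, (levelSet f lam (γ / q)).indicator
      (fun z => ENNReal.ofReal (‖z.1 - z.2‖ ^ (γ - (n : ℝ)))) (x, y)) ^ (1 / q))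

/-- `κ(q,n) = ∫_{S^{n-1}} |e · ω|^q dω` for a unit vector `e`, with respect to surface measure. -/
def kappa {n : ℕ} (q : ℝ) (e : Rn n) : ℝ :=
  ∫ s : Metric.sphere (0 : Rn n) 1, |inner ℝ e (s : Rn n)| ^ q
    ∂((volume : Measure (Rn n)).toSphere)

end BVY

end

/-!
The proof reduces everything to three facts about the level sets `E = E_{λ,b}[f]`, `b = γ/q`.

*Pointwise limit.* At almost every `x` the rescaled increments `(f (x + r z) - f x) / r` converge to
`⟨∇f x, z⟩` in `L¹` on balls as `r → 0` (`HasWeakGradient.ae_tendsto_increment`). With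
`r = λ^{-1/b}` the section of `E` at `x` therefore converges to the region `|z|^{1+b} < |⟨∇f x, z⟩|`,
over which polar coordinates give `∫ |z|^{γ-n} dz = κ(q,n) |∇f x|^q / |γ|`. Convergence in `L¹` says
nothing about the tails of the sections, so it is applied to the pairs with `λ |x - y|^b < D x` for a
fixed function `D` (`exists_tendsto_truncSet`); both signs of `γ` are treated at once. Fatou's lemma
in `X` yields the lower bounds, and dominated convergence, available because the norm is absolutely
continuous, yields the upper bound for the truncated sets.

*Upper bound.* The two-point inequality `HasWeakGradient.enorm_sub_le_dyadicAverage` bounds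
`|f x - f y| / |x - y|` by the sum of dyadic averages `∑ⱼ 2⁻ʲ ⨍ |∇f|` over balls concentric at `x`
and at `y`, so `E` lies in `majorantSet |∇f|`. There are three ways to estimate that set.
If `0 < b` or `b < -n`, and `n (1 - 1/q) < 1`, a Vitali covering argument adapted to the size
function `r ↦ r^b` (`exists_tsum_covering_le`) gives a weighted `L¹` bound for all `A₁` weights
(`exists_lintegral_majorantSet_le`). The hypothesis on the maximal operators on `(X^{1/θ})'` passes to
the limit `θ → 1` and bounds the maximal operator on `X'` (`exists_associate_maximal_le`), which allows
extrapolation from `A₁` weights to `X` (`IsBallBanach.extrapolation`); this rests on the duality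
`X'' = X`, proved by separating a point from a closed convex set in `L²`.
If the maximal operator is bounded on `X^{1/r}` with `r > n`, the averages at both points are bounded
by `(M |∇f|^r)^{1/r}` at `x` alone, a Morrey-type estimate (`exists_ae_mem_truncSet`).
If the maximal operator is bounded on `X` and `q ≤ 1`, the majorant set is covered by a truncated set
and its reflection, both of height `C M |∇f|`; the reflected one is again handled by extrapolation
(`IsBallBanach.exists_dualSet_le`).

*Tail control.* For the exact limits one needs that, up to errors of small norm, only pairs with
`λ |x - y|^b < D x` for some `D` in `X` matter (`TailControl`). Absolute continuity of the norm splits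
the majorant into a bounded compactly supported part and a part of small norm, to which the upper bound
applies. For the former, pairs with `x` near the support are truncated, and for `x` far away the kernel
integrals either vanish (`γ > 0`, `λ` large) or are `O(λ |x|^a)` with `a < -n` (`γ < 0`, `λ → 0`). Uniform
boundedness of the ball averages puts such powers into `X` (`power_norm_lt_top`), so this part
vanishes in the limit (`tailControl_of_cover`).
-/

namespace BVY

/-! ### Ball Banach function norms -/

section Norm

variable {n : ℕ} {N : FunctionNorm n}

theorem IsBallBanach.congr_ae (hN : IsBallBanach N) {f g : Rn n → ℝ≥0∞}
    (hf : AEMeasurable f volume) (h : f =ᵐ[volume] g) : N f = N g :=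
  le_antisymm (hN.mono _ _ (hf.congr h) hf h.le) (hN.mono _ _ hf (hf.congr h) h.symm.le)

theorem IsBallBanach.const_mul (hN : IsBallBanach N) {c : ℝ≥0∞} (hc : c ≠ ⊤) {f : Rn n → ℝ≥0∞}
    (hf : AEMeasurable f volume) : N (fun x => c * f x) = c * N f := by
  lift c to ℝ≥0 using hc
  exact hN.smul c f hf

theorem IsBallBanach.zero (hN : IsBallBanach N) : N (fun _ => 0) = 0 := by
  simpa using hN.smul 0 (fun _ => 0) aemeasurable_const

theorem IsBallBanach.sum_le (hN : IsBallBanach N) {ι : Type*} (s : Finset ι)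
    {F : ι → Rn n → ℝ≥0∞} (hF : ∀ i, AEMeasurable (F i) volume) :
    N (fun x => ∑ i ∈ s, F i x) ≤ ∑ i ∈ s, N (F i) := by
  classical
  induction s using Finset.induction_on with
  | empty => simpa using hN.zero.le
  | insert a s ha ih =>
    simp only [Finset.sum_insert ha]
    exact (hN.add_le _ _ (hF a) (Finset.aemeasurable_fun_sum s fun i _ => hF i)).trans
      (by gcongr)

/-- Countable subadditivity, from the triangle inequality and the Fatou property. -/
theorem IsBallBanach.tsum_le (hN : IsBallBanach N) {F : ℕ → Rn n → ℝ≥0∞}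
    (hF : ∀ i, AEMeasurable (F i) volume) :
    N (fun x => ∑' i, F i x) ≤ ∑' i, N (F i) := by
  have h := hN.fatou (fun m x => ∑ i ∈ Finset.range m, F i x) (fun x => ∑' i, F i x)
    (fun m => Finset.aemeasurable_fun_sum _ fun i _ => hF i) (AEMeasurable.tsum hF)
    (ae_of_all _ fun x => ⟨fun a b hab => Finset.sum_le_sum_of_subset
      (Finset.range_mono hab), ENNReal.tendsto_nat_tsum _⟩)
  exact le_of_tendsto' h fun m => (hN.sum_le _ hF).trans (ENNReal.sum_le_tsum _)

theorem ae_of_forall_ball {p : Rn n → Prop}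
    (h : ∀ k : ℕ, ∀ᵐ x ∂(volume.restrict (Metric.ball (0 : Rn n) (k + 1))), p x) :
    ∀ᵐ x ∂(volume : Measure (Rn n)), p x := by
  have hU : (⋃ k : ℕ, Metric.ball (0 : Rn n) (k + 1)) = univ := by
    refine eq_univ_of_forall fun x => mem_iUnion.2 ?_
    obtain ⟨k, hk⟩ := exists_nat_gt ‖x‖
    exact ⟨k, by rw [mem_ball_zero_iff]; linarith⟩
  rw [← Measure.restrict_univ (μ := (volume : Measure (Rn n))), ← hU, ae_restrict_iUnion_iff]
  exact h

theorem IsBallBanach.ae_lt_top (hN : IsBallBanach N) {f : Rn n → ℝ≥0∞}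
    (hf : AEMeasurable f volume) (h : N f < ⊤) : ∀ᵐ x ∂(volume : Measure (Rn n)), f x < ⊤ := by
  refine ae_of_forall_ball fun k => ?_
  obtain ⟨C, hC⟩ := hN.integral_ball_le 0 (k + 1) (by positivity)
  exact ae_lt_top' hf.restrict
    (((hC f hf).trans_lt (ENNReal.mul_lt_top ENNReal.coe_lt_top h)).ne)

/-- Fatou's lemma in a ball Banach function space. -/
theorem IsBallBanach.liminf_le (hN : IsBallBanach N) {F : ℕ → Rn n → ℝ≥0∞}
    (hF : ∀ i, AEMeasurable (F i) volume) :
    N (fun x => liminf (fun k => F k x) atTop) ≤ liminf (fun k => N (F k)) atTop := by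
  have hm : ∀ m, AEMeasurable (fun x => ⨅ i : ℕ, F (i + m) x) volume := fun m =>
    AEMeasurable.iInf fun i => hF (i + m)
  have h := hN.fatou (fun m x => ⨅ i : ℕ, F (i + m) x)
    (fun x => liminf (fun k => F k x) atTop) hm
    (by
      simp only [liminf_eq_iSup_iInf_of_nat']
      exact AEMeasurable.iSup hm)
    (ae_of_all _ fun x => by
      have hmono : Monotone fun m => ⨅ i : ℕ, F (i + m) x := by
        intro a b hab
        refine le_iInf fun i => ?_
        exact (iInf_le _ (i + (b - a))).trans_eq (by congr 1; omega)
      refine ⟨hmono, ?_⟩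
      rw [liminf_eq_iSup_iInf_of_nat']
      exact tendsto_atTop_iSup hmono)
  rw [← h.liminf_eq]
  refine liminf_le_liminf (Eventually.of_forall fun k => ?_)
  refine hN.mono _ _ (hF k) (hm k) (ae_of_all _ fun x => ?_)
  exact (iInf_le _ 0).trans_eq (by simp)

/-- The reverse Fatou lemma: for a dominated sequence, in a space with absolutely continuous
norm. -/
theorem IsBallBanach.limsup_le (hN : IsBallBanach N) (hac : HasAbsContNorm N)
    {F : ℕ → Rn n → ℝ≥0∞} {D G : Rn n → ℝ≥0∞} (hF : ∀ i, AEMeasurable (F i) volume)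
    (hD : AEMeasurable D volume) (hG : AEMeasurable G volume) (hDN : N D < ⊤)
    (hFD : ∀ i, F i ≤ᵐ[volume] D)
    (hlim : ∀ᵐ x ∂(volume : Measure (Rn n)), limsup (fun k => F k x) atTop ≤ G x) :
    limsup (fun k => N (F k)) atTop ≤ N G := by
  have key : ∀ δ : ℝ≥0, 0 < δ → limsup (fun k => N (F k)) atTop ≤ N G + δ * N D := by
    intro δ hδ
    set S : ℕ → Set (Rn n) := fun k => {x | G x + δ * D x < F k x} with hS
    have hGD : AEMeasurable (fun x => G x + δ * D x) volume := hG.add (hD.const_mul _)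
    have hSm : ∀ k, NullMeasurableSet (S k) volume := fun k =>
      nullMeasurableSet_lt hGD (hF k)
    have h0 := hac D hD hDN S hSm (by
      filter_upwards [hlim, ae_all_iff.2 hFD, hN.ae_lt_top hD hDN] with x hx hxD hxt
      refine tendsto_nhds_of_eventually_eq ?_
      by_cases h0 : D x = 0
      · refine Eventually.of_forall fun k => indicator_of_notMem ?_ _
        simp only [hS, mem_ofPred_eq, not_lt]
        exact (hxD k).trans (by simp [h0])
      by_cases hGt : G x = ⊤
      · refine Eventually.of_forall fun k => indicator_of_notMem ?_ _
        simp [hS, hGt]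
      have : limsup (fun k => F k x) atTop < G x + δ * D x := by
        refine hx.trans_lt (ENNReal.lt_add_right hGt ?_)
        exact mul_ne_zero (by exact_mod_cast hδ.ne') h0
      filter_upwards [eventually_lt_of_limsup_lt this] with k hk
      exact indicator_of_notMem (by simp only [hS, mem_ofPred_eq, not_lt]; exact hk.le) _)
    have hle : ∀ k, N (F k) ≤ (N G + δ * N D) + N ((S k).indicator D) := by
      intro k
      have hi : AEMeasurable ((S k).indicator D) volume := hD.indicator₀ (hSm k)
      calc N (F k) ≤ N (fun x => (G x + δ * D x) + (S k).indicator D x) := by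
            refine hN.mono _ _ (hGD.add hi) (hF k) ?_
            filter_upwards [hFD k] with x hx
            by_cases hxS : x ∈ S k
            · rw [indicator_of_mem hxS]
              exact hx.trans le_add_self
            · rw [indicator_of_notMem hxS]
              simp only [hS, mem_ofPred_eq, not_lt] at hxS
              simpa using hxS
        _ ≤ N (fun x => G x + δ * D x) + N ((S k).indicator D) := hN.add_le _ _ hGD hi
        _ ≤ _ := by
            gcongr
            refine (hN.add_le _ _ hG (hD.const_mul _)).trans ?_
            rw [hN.smul δ D hD]
    calc limsup (fun k => N (F k)) atTop
        ≤ limsup (fun k => (N G + δ * N D) + N ((S k).indicator D)) atTop :=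
          limsup_le_limsup (Eventually.of_forall hle)
      _ = N G + δ * N D := by
          have := (tendsto_const_nhds (x := N G + δ * N D)).add h0
          rw [add_zero] at this
          exact this.limsup_eq
  have hlimit : Tendsto (fun δ : ℝ≥0 => N G + δ * N D) (𝓝[>] 0) (𝓝 (N G + (0 : ℝ≥0) * N D)) := by
    refine Tendsto.mono_left ?_ nhdsWithin_le_nhds
    refine tendsto_const_nhds.add ?_
    exact (ENNReal.Tendsto.mul_const (ENNReal.tendsto_coe.2 tendsto_id) (Or.inr hDN.ne))
  rw [ENNReal.coe_zero, zero_mul, add_zero] at hlimit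
  refine ge_of_tendsto hlimit ?_
  filter_upwards [self_mem_nhdsWithin] with δ hδ using key δ hδ

/-- Truncating `f` in height and in space leaves a remainder of small norm. -/
theorem exists_trunc_small (hac : HasAbsContNorm N) (hN : IsBallBanach N) {f : Rn n → ℝ≥0∞}
    (hf : Measurable f) (hfN : N f < ⊤) {ε : ℝ≥0∞} (hε : 0 < ε) :
    ∃ k : ℕ, N ({x | (k : ℝ≥0∞) < f x ∨ (k : ℝ) < ‖x‖}.indicator f) < ε := by
  have hm : ∀ k : ℕ, MeasurableSet {x : Rn n | (k : ℝ≥0∞) < f x ∨ (k : ℝ) < ‖x‖} := fun k =>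
    (measurableSet_lt measurable_const hf).union (measurableSet_lt measurable_const measurable_norm)
  have h := hac f hf.aemeasurable hfN (fun k : ℕ => {x | (k : ℝ≥0∞) < f x ∨ (k : ℝ) < ‖x‖})
    (fun k => (hm k).nullMeasurableSet) (by
      filter_upwards [hN.ae_lt_top hf.aemeasurable hfN] with x hx
      refine tendsto_nhds_of_eventually_eq ?_
      obtain ⟨k₁, hk₁⟩ := ENNReal.exists_nat_gt hx.ne
      obtain ⟨k₂, hk₂⟩ := exists_nat_gt ‖x‖
      filter_upwards [eventually_ge_atTop (max k₁ k₂)] with k hk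
      refine indicator_of_notMem ?_ _
      simp only [mem_ofPred_eq, not_or, not_lt]
      refine ⟨hk₁.le.trans ?_, hk₂.le.trans ?_⟩
      · exact_mod_cast (le_max_left _ _).trans hk
      · exact_mod_cast (le_max_right _ _).trans hk)
  exact (h.eventually (gt_mem_nhds hε)).exists

end Norm

/-! ### The associate space and duality -/

section Associate

variable {n : ℕ} {N : FunctionNorm n}

theorem le_associate {w g : Rn n → ℝ≥0∞} (hg : AEMeasurable g volume) (h1 : N g = 1) :
    ∫⁻ x, w x * g x ≤ associate N w :=
  le_iSup_of_le g (le_iSup_of_le hg (le_iSup_of_le h1 le_rfl))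

theorem associate_le {w : Rn n → ℝ≥0∞} {K : ℝ≥0∞}
    (h : ∀ g : Rn n → ℝ≥0∞, AEMeasurable g volume → N g = 1 → ∫⁻ x, w x * g x ≤ K) :
    associate N w ≤ K :=
  iSup_le fun g => iSup_le fun hg => iSup_le fun h1 => h g hg h1

/-- Hölder's inequality for a space and its associate space. -/
theorem IsBallBanach.lintegral_mul_le (hN : IsBallBanach N) (w : Rn n → ℝ≥0∞)
    {g : Rn n → ℝ≥0∞} (hg : AEMeasurable g volume) (hgN : N g < ⊤) :
    ∫⁻ x, w x * g x ≤ associate N w * N g := by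
  by_cases h0 : N g = 0
  · have : ∫⁻ x, w x * g x = 0 := by
      refine (lintegral_congr_ae ?_).trans lintegral_zero
      filter_upwards [hN.eq_zero g hg h0] with x hx
      simp [hx]
    simp [this]
  · have hc : (N g)⁻¹ ≠ ⊤ := ENNReal.inv_ne_top.2 h0
    have h1 : N (fun x => (N g)⁻¹ * g x) = 1 := by
      rw [hN.const_mul hc hg, ENNReal.inv_mul_cancel h0 hgN.ne]
    have h2 := le_associate (w := w) (hg.const_mul _) h1
    have h3 : ∫⁻ x, w x * ((N g)⁻¹ * g x) = (N g)⁻¹ * ∫⁻ x, w x * g x := by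
      rw [← lintegral_const_mul' _ _ hc]
      exact lintegral_congr fun x => by ring
    rw [h3] at h2
    calc ∫⁻ x, w x * g x = (N g)⁻¹ * (∫⁻ x, w x * g x) * N g := by
          rw [mul_comm (N g)⁻¹, mul_assoc, ENNReal.inv_mul_cancel h0 hgN.ne, mul_one]
      _ ≤ _ := by gcongr

theorem associate_mono {w w' : Rn n → ℝ≥0∞} (h : w ≤ w') : associate N w ≤ associate N w' :=
  associate_le fun _ hg h1 => (lintegral_mono fun x => by gcongr; exact h x).trans
    (le_associate hg h1)

theorem associate_const_mul_le {c : ℝ≥0∞} (hc : c ≠ ⊤) (w : Rn n → ℝ≥0∞) :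
    associate N (fun x => c * w x) ≤ c * associate N w := by
  refine associate_le fun g hg h1 => ?_
  calc ∫⁻ x, c * w x * g x = c * ∫⁻ x, w x * g x := by
        rw [← lintegral_const_mul' _ _ hc]
        exact lintegral_congr fun x => by ring
    _ ≤ _ := by gcongr; exact le_associate hg h1

theorem associate_tsum_le {F : ℕ → Rn n → ℝ≥0∞} (hF : ∀ i, Measurable (F i)) :
    associate N (fun x => ∑' i, F i x) ≤ ∑' i, associate N (F i) := by
  refine associate_le fun g hg h1 => ?_
  simp_rw [← ENNReal.tsum_mul_right]
  rw [lintegral_tsum (f := fun i x => F i x * g x) fun i => (hF i).aemeasurable.mul hg]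
  exact ENNReal.tsum_le_tsum fun i => le_associate hg h1

/-- Truncation of a function in height and in space. -/
noncomputable def trunc (f : Rn n → ℝ≥0∞) (k : ℕ) : Rn n → ℝ≥0∞ :=
  (Metric.ball 0 k).indicator fun x => min (f x) k

theorem measurable_trunc {f : Rn n → ℝ≥0∞} (hf : Measurable f) (k : ℕ) :
    Measurable (trunc f k) :=
  (hf.min measurable_const).indicator measurableSet_ball

theorem trunc_le (f : Rn n → ℝ≥0∞) (k : ℕ) (x : Rn n) : trunc f k x ≤ f x :=
  indicator_apply_le' (fun _ => min_le_left _ _) fun _ => zero_le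

theorem trunc_le_indicator (f : Rn n → ℝ≥0∞) (k : ℕ) (x : Rn n) :
    trunc f k x ≤ (Metric.ball 0 k).indicator (fun _ => (k : ℝ≥0∞)) x :=
  indicator_le_indicator (min_le_right _ _)

theorem trunc_mono (f : Rn n → ℝ≥0∞) (x : Rn n) : Monotone fun k => trunc f k x := by
  intro a b hab
  have hab' : (a : ℝ) ≤ b := by exact_mod_cast hab
  refine (indicator_le_indicator_of_subset (Metric.ball_subset_ball hab')
    (fun _ => zero_le) x).trans (indicator_le_indicator ?_)
  gcongr

theorem tendsto_trunc (f : Rn n → ℝ≥0∞) (x : Rn n) :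
    Tendsto (fun k => trunc f k x) atTop (𝓝 (f x)) := by
  obtain ⟨k₁, hk₁⟩ := exists_nat_gt ‖x‖
  have h : Tendsto (fun k : ℕ => min (f x) (k : ℝ≥0∞)) atTop (𝓝 (min (f x) ⊤)) :=
    tendsto_const_nhds.min ENNReal.tendsto_nat_nhds_top
  rw [min_eq_left le_top] at h
  refine h.congr' ?_
  filter_upwards [eventually_ge_atTop k₁] with k hk
  have : (k₁ : ℝ) ≤ k := by exact_mod_cast hk
  rw [trunc, indicator_of_mem]
  rw [mem_ball_zero_iff]; linarith

theorem memLp_trunc {f : Rn n → ℝ≥0∞} (hf : Measurable f) (k : ℕ) :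
    MemLp (fun x => (trunc f k x).toReal) 2 (volume : Measure (Rn n)) := by
  have h : MemLp ((Metric.ball (0 : Rn n) k).indicator fun _ => (k : ℝ)) 2 volume :=
    memLp_indicator_const 2 measurableSet_ball _ (Or.inr measure_ball_lt_top.ne)
  refine h.of_le (measurable_trunc hf k).ennreal_toReal.aestronglyMeasurable (ae_of_all _ fun x => ?_)
  rw [Real.norm_of_nonneg ENNReal.toReal_nonneg]
  have h2 := trunc_le_indicator f k x
  by_cases hx : x ∈ Metric.ball (0 : Rn n) k
  · rw [indicator_of_mem hx] at h2 ⊢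
    rw [Real.norm_of_nonneg (by positivity)]
    exact ENNReal.toReal_le_of_le_ofReal (by positivity) (by simpa using h2)
  · rw [indicator_of_notMem hx] at h2 ⊢
    simp [le_antisymm h2 zero_le]

theorem trunc_ne_top (f : Rn n → ℝ≥0∞) (k : ℕ) (x : Rn n) : trunc f k x ≠ ⊤ := by
  refine ((trunc_le_indicator f k x).trans_lt ?_).ne
  by_cases hx : x ∈ Metric.ball (0 : Rn n) k <;> simp [hx]

/-- The set of `L²` functions of norm at most `c` in `X`. -/
def sublevel (N : FunctionNorm n) (c : ℝ≥0∞) : Set (Lp ℝ 2 (volume : Measure (Rn n))) :=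
  {u | N (fun x => ‖u x‖ₑ) ≤ c}

theorem aemeasurable_enorm_Lp (u : Lp ℝ 2 (volume : Measure (Rn n))) :
    AEMeasurable (fun x => ‖u x‖ₑ) volume := (Lp.aestronglyMeasurable u).enorm

theorem convex_sublevel (hN : IsBallBanach N) (c : ℝ≥0∞) : Convex ℝ (sublevel N c) := by
  intro u hu v hv a b ha hb hab
  simp only [sublevel, mem_ofPred_eq] at hu hv ⊢
  have hmu := (aemeasurable_enorm_Lp u).const_mul (ENNReal.ofReal a)
  have hmv := (aemeasurable_enorm_Lp v).const_mul (ENNReal.ofReal b)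
  calc N (fun x => ‖(a • u + b • v : Lp ℝ 2 (volume : Measure (Rn n))) x‖ₑ)
      ≤ N (fun x => ENNReal.ofReal a * ‖u x‖ₑ + ENNReal.ofReal b * ‖v x‖ₑ) := by
        refine hN.mono _ _ (hmu.add hmv) (aemeasurable_enorm_Lp _) ?_
        filter_upwards [Lp.coeFn_add (a • u) (b • v), Lp.coeFn_smul a u, Lp.coeFn_smul b v]
          with x h1 h2 h3
        rw [h1, Pi.add_apply, h2, h3]
        refine (enorm_add_le _ _).trans ?_
        simp [Real.enorm_eq_ofReal ha, Real.enorm_eq_ofReal hb]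
    _ ≤ ENNReal.ofReal a * N (fun x => ‖u x‖ₑ) + ENNReal.ofReal b * N (fun x => ‖v x‖ₑ) := by
        refine (hN.add_le _ _ hmu hmv).trans ?_
        rw [hN.const_mul ENNReal.ofReal_ne_top (aemeasurable_enorm_Lp u),
          hN.const_mul ENNReal.ofReal_ne_top (aemeasurable_enorm_Lp v)]
    _ ≤ ENNReal.ofReal a * c + ENNReal.ofReal b * c := by gcongr
    _ = c := by rw [← add_mul, ← ENNReal.ofReal_add ha hb, hab]; simp

theorem isClosed_sublevel (hN : IsBallBanach N) (c : ℝ≥0∞) : IsClosed (sublevel N c) := by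
  refine IsSeqClosed.isClosed fun u v hu huv => ?_
  have h1 : TendstoInMeasure volume (fun k => (u k : Rn n → ℝ)) atTop v :=
    tendstoInMeasure_of_tendsto_Lp huv
  obtain ⟨ns, -, hns⟩ := h1.exists_seq_tendsto_ae
  simp only [sublevel, mem_ofPred_eq] at hu ⊢
  calc N (fun x => ‖v x‖ₑ) = N (fun x => liminf (fun k => ‖u (ns k) x‖ₑ) atTop) := by
        refine hN.congr_ae (aemeasurable_enorm_Lp v) ?_
        filter_upwards [hns] with x hx
        exact hx.enorm.liminf_eq.symm
    _ ≤ liminf (fun k => N fun x => ‖u (ns k) x‖ₑ) atTop :=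
        hN.liminf_le fun i => aemeasurable_enorm_Lp _
    _ ≤ c := by
        refine (liminf_le_liminf (v := fun _ => c) (Eventually.of_forall fun k => hu _)).trans ?_
        simp

/-- If the functional on `L²` given by `w` is less than `s` on `sublevel N c`, then `|w|` pairs with every
function of norm at most `c`, square-integrable or not, to at most `s`: adjust signs and truncate. -/
theorem lintegral_mul_le_of_sublevel (hN : IsBallBanach N) {c : ℝ≥0∞}
    {v : Lp ℝ 2 (volume : Measure (Rn n))} {w : Rn n → ℝ} (hwm : Measurable w)
    (hwv : w =ᵐ[volume] v) {s : ℝ} (hφ : ∀ u ∈ sublevel N c, ∫ x, v x * u x < s)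
    {g : Rn n → ℝ≥0∞} (hg : Measurable g) (hgc : N g ≤ c) :
    ∫⁻ x, ‖w x‖ₑ * g x ≤ ENNReal.ofReal s := by
  have hj : ∀ j : ℕ, ∫⁻ x, ‖w x‖ₑ * trunc g j x ≤ ENNReal.ofReal s := by
    intro j
    set sg : Rn n → ℝ := fun x => if 0 ≤ w x then 1 else -1 with hsg
    have hsm : Measurable sg :=
      Measurable.ite (measurableSet_le measurable_const hwm) measurable_const measurable_const
    have hsn : ∀ x, |sg x| = 1 := fun x => by by_cases h : 0 ≤ w x <;> simp [hsg, h]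
    have hsw : ∀ x, w x * sg x = |w x| := fun x => by
      by_cases h : 0 ≤ w x
      · simp [hsg, h, abs_of_nonneg]
      · simp [hsg, h, abs_of_neg (not_le.1 h)]
    have hmem : MemLp (fun x => sg x * (trunc g j x).toReal) 2
        (volume : Measure (Rn n)) := by
      refine (memLp_trunc hg j).of_le
        (hsm.mul (measurable_trunc hg j).ennreal_toReal).aestronglyMeasurable
        (ae_of_all _ fun x => ?_)
      rw [norm_mul, Real.norm_eq_abs (sg x), hsn, one_mul]
    have hle : hmem.toLp _ ∈ sublevel N c := by
      simp only [sublevel, mem_ofPred_eq]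
      refine (hN.mono _ _ hg.aemeasurable (aemeasurable_enorm_Lp _) ?_).trans hgc
      filter_upwards [hmem.coeFn_toLp] with x hx
      rw [hx, enorm_mul, Real.enorm_of_nonneg ENNReal.toReal_nonneg,
        ENNReal.ofReal_toReal (trunc_ne_top g j x)]
      rw [Real.enorm_eq_ofReal_abs, hsn, ENNReal.ofReal_one, one_mul]
      exact trunc_le g j x
    have h1 := hφ _ hle
    have h2 : ∀ᵐ x ∂(volume : Measure (Rn n)),
        v x * hmem.toLp _ x = |w x| * (trunc g j x).toReal := by
      filter_upwards [hmem.coeFn_toLp, hwv] with x hx hx2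
      rw [hx, ← hx2, ← mul_assoc, hsw]
    rw [integral_congr_ae h2] at h1
    have hint : Integrable (fun x => |w x| * (trunc g j x).toReal) volume := by
      refine (MemLp.integrable_mul (p := 2) (q := 2) (Lp.memLp v) (Lp.memLp (hmem.toLp _))).congr ?_
      filter_upwards [h2] with x hx
      exact hx
    have h3 : ∫⁻ x, ‖w x‖ₑ * trunc g j x =
        ENNReal.ofReal (∫ x, |w x| * (trunc g j x).toReal) := by
      rw [ofReal_integral_eq_lintegral_ofReal hint (ae_of_all _ fun x => by positivity)]
      refine lintegral_congr fun x => ?_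
      rw [ENNReal.ofReal_mul (abs_nonneg _), ENNReal.ofReal_toReal (trunc_ne_top g j x),
        Real.enorm_eq_ofReal_abs]
    rw [h3]
    exact ENNReal.ofReal_le_ofReal h1.le
  refine le_of_tendsto' (f := fun j => ∫⁻ x, ‖w x‖ₑ * trunc g j x) (x := atTop) ?_ hj
  refine lintegral_tendsto_of_tendsto_of_monotone
    (fun j => (hwm.enorm.mul (measurable_trunc hg j)).aemeasurable)
    (ae_of_all _ fun x a b hab => ?_) (ae_of_all _ fun x => ?_)
  · dsimp only
    gcongr
    exact trunc_mono g x hab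
  · exact ENNReal.Tendsto.const_mul (tendsto_trunc g x) (Or.inr enorm_ne_top)

/-- The Lorentz–Luxemburg inequality for truncated functions: separate the truncation from a
sublevel set of the norm in `L²`. -/
theorem IsBallBanach.trunc_le_of_forall_associate (hN : IsBallBanach N) {f : Rn n → ℝ≥0∞}
    (hf : Measurable f) (k : ℕ) {K : ℝ≥0∞}
    (h : ∀ w : Rn n → ℝ≥0∞, Measurable w → associate N w ≤ 1 → ∫⁻ x, w x * f x ≤ K) :
    N (trunc f k) ≤ K := by
  by_contra! hK
  obtain ⟨c, hKc, hcf⟩ := ENNReal.lt_iff_exists_nnreal_btwn.1 hK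
  set F := (memLp_trunc hf k).toLp with hF
  have hFf : (fun x => ‖F x‖ₑ) =ᵐ[volume] trunc f k := by
    filter_upwards [(memLp_trunc hf k).coeFn_toLp] with x hx
    rw [hF, hx, Real.enorm_of_nonneg ENNReal.toReal_nonneg, ENNReal.ofReal_toReal
      (trunc_ne_top f k x)]
  have hFS : F ∉ sublevel N c := by
    simp only [sublevel, mem_ofPred_eq, not_le]
    rwa [hN.congr_ae (aemeasurable_enorm_Lp F) hFf]
  obtain ⟨φ, s, hφ, hsF⟩ := geometric_hahn_banach_closed_point (convex_sublevel hN c)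
    (isClosed_sublevel hN c) hFS
  set v := (InnerProductSpace.toDual ℝ (Lp ℝ 2 (volume : Measure (Rn n)))).symm φ with hv
  have hφv : ∀ u, φ u = ∫ x, v x * u x := by
    intro u
    rw [← InnerProductSpace.toDual_symm_apply (𝕜 := ℝ) (y := φ) (x := u), L2.inner_def]
    refine integral_congr_ae (ae_of_all _ fun x => ?_)
    simp [hv, mul_comm]
  have hs : 0 < s := by
    have := hφ 0 (by
      simp only [sublevel, mem_ofPred_eq]
      rw [hN.congr_ae (aemeasurable_enorm_Lp 0) (g := fun _ => 0) ?_, hN.zero]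
      · exact zero_le
      · filter_upwards [Lp.coeFn_zero ℝ 2 (volume : Measure (Rn n))] with x hx
        simp)
    simpa using this
  obtain ⟨w, hwm, hwv⟩ : ∃ w : Rn n → ℝ, Measurable w ∧ w =ᵐ[volume] v :=
    ⟨_, (Lp.aestronglyMeasurable v).aemeasurable.measurable_mk,
      (Lp.aestronglyMeasurable v).aemeasurable.ae_eq_mk.symm⟩
  have hbound := fun (g : Rn n → ℝ≥0∞) (hg : Measurable g) (hgc : N g ≤ c) =>
    lintegral_mul_le_of_sublevel hN hwm hwv (fun u hu => hφv u ▸ hφ u hu) hg hgc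
  have hsne : ENNReal.ofReal s ≠ 0 := by simpa using hs
  have hcs : (c : ℝ≥0∞) / ENNReal.ofReal s ≠ ⊤ := ENNReal.div_ne_top ENNReal.coe_ne_top hsne
  have hassoc : associate N (fun x => (c : ℝ≥0∞) / ENNReal.ofReal s * ‖w x‖ₑ) ≤ 1 := by
    refine associate_le fun g hg h1 => ?_
    have hgm := hg.measurable_mk.const_mul (c : ℝ≥0∞)
    have h2 := hbound _ hgm (by
      rw [hN.const_mul ENNReal.coe_ne_top hg.measurable_mk.aemeasurable,
        ← hN.congr_ae hg hg.ae_eq_mk, h1, mul_one])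
    calc ∫⁻ x, (c : ℝ≥0∞) / ENNReal.ofReal s * ‖w x‖ₑ * g x
        = (ENNReal.ofReal s)⁻¹ * ∫⁻ x, ‖w x‖ₑ * (c * hg.mk g x) := by
          rw [← lintegral_const_mul' _ _ (ENNReal.inv_ne_top.2 hsne)]
          refine lintegral_congr_ae ?_
          filter_upwards [hg.ae_eq_mk] with x hx
          rw [hx, div_eq_mul_inv]
          ring
      _ ≤ (ENNReal.ofReal s)⁻¹ * ENNReal.ofReal s := by gcongr
      _ = 1 := ENNReal.inv_mul_cancel hsne ENNReal.ofReal_ne_top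
  have h1 := h _ (hwm.enorm.const_mul _) hassoc
  have h2 : ENNReal.ofReal s ≤ ∫⁻ x, ‖w x‖ₑ * f x := by
    rw [hφv] at hsF
    calc ENNReal.ofReal s ≤ ENNReal.ofReal (∫ x, v x * F x) := ENNReal.ofReal_le_ofReal hsF.le
      _ ≤ ENNReal.ofReal ‖∫ x, v x * F x‖ := ENNReal.ofReal_le_ofReal (Real.le_norm_self _)
      _ = ‖∫ x, v x * F x‖ₑ := ofReal_norm _
      _ ≤ ∫⁻ x, ‖v x * F x‖ₑ := enorm_integral_le_lintegral_enorm _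
      _ ≤ ∫⁻ x, ‖w x‖ₑ * f x := by
        refine lintegral_mono_ae ?_
        filter_upwards [hFf, hwv] with x hx hx2
        rw [enorm_mul, hx, hx2]
        gcongr
        exact trunc_le f k x
  refine absurd hKc (not_lt.2 ?_)
  calc (c : ℝ≥0∞) = c / ENNReal.ofReal s * ENNReal.ofReal s :=
        (ENNReal.div_mul_cancel hsne ENNReal.ofReal_ne_top).symm
    _ ≤ c / ENNReal.ofReal s * ∫⁻ x, ‖w x‖ₑ * f x := by gcongr
    _ = ∫⁻ x, c / ENNReal.ofReal s * ‖w x‖ₑ * f x := by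
        rw [← lintegral_const_mul' _ _ hcs]
        simp_rw [mul_assoc]
    _ ≤ K := h1

/-- The Lorentz–Luxemburg theorem: the norm of `X` is recovered from the associate norm. -/
theorem IsBallBanach.le_of_forall_associate (hN : IsBallBanach N) {f : Rn n → ℝ≥0∞}
    (hf : AEMeasurable f volume) {K : ℝ≥0∞}
    (h : ∀ w : Rn n → ℝ≥0∞, Measurable w → associate N w ≤ 1 → ∫⁻ x, w x * f x ≤ K) :
    N f ≤ K := by
  rw [hN.congr_ae hf hf.ae_eq_mk]
  have hm := hf.measurable_mk
  have h' : ∀ w : Rn n → ℝ≥0∞, Measurable w → associate N w ≤ 1 →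
      ∫⁻ x, w x * hf.mk f x ≤ K := by
    intro w hw h1
    refine (lintegral_congr_ae ?_).trans_le (h w hw h1)
    filter_upwards [hf.ae_eq_mk] with x hx
    rw [hx]
  refine le_of_tendsto' (hN.fatou (trunc (hf.mk f)) _ (fun k => (measurable_trunc hm k).aemeasurable)
    hm.aemeasurable (ae_of_all _ fun x => ⟨trunc_mono _ x, tendsto_trunc _ x⟩))
    fun k => hN.trunc_le_of_forall_associate hm k h'

end Associate

/-! ### The maximal operator on the associate space, and extrapolation -/

section Maximal

variable {n : ℕ} {N : FunctionNorm n}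

theorem laverage_le_maximal (f : Rn n → ℝ≥0∞) {c x : Rn n} {r : ℝ} (hr : 0 < r)
    (hx : x ∈ Metric.ball c r) : ⨍⁻ y in Metric.ball c r, f y ∂volume ≤ maximal f x :=
  le_iSup_of_le c (le_iSup_of_le r (le_iSup_of_le hr (le_iSup_of_le hx le_rfl)))

theorem maximal_le {f : Rn n → ℝ≥0∞} {x : Rn n} {K : ℝ≥0∞}
    (h : ∀ (c : Rn n) (r : ℝ), 0 < r → x ∈ Metric.ball c r →
      ⨍⁻ y in Metric.ball c r, f y ∂volume ≤ K) : maximal f x ≤ K :=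
  iSup_le fun c => iSup_le fun r => iSup_le fun hr => iSup_le fun hx => h c r hr hx

theorem measurable_maximal (f : Rn n → ℝ≥0∞) : Measurable (maximal f) := by
  refine measurable_of_Ioi fun a => IsOpen.measurableSet ?_
  have : maximal f ⁻¹' Ioi a = ⋃ (c : Rn n) (r : ℝ) (_ : 0 < r)
      (_ : a < ⨍⁻ y in Metric.ball c r, f y ∂volume), Metric.ball c r := by
    ext x
    simp only [maximal, mem_preimage, mem_Ioi, lt_iSup_iff, mem_iUnion, exists_prop]
    exact exists_congr fun c => exists_congr fun r => and_congr_right fun _ => and_comm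
  rw [this]
  exact isOpen_iUnion fun c => isOpen_iUnion fun r => isOpen_iUnion fun _ =>
    isOpen_iUnion fun _ => Metric.isOpen_ball

theorem maximal_const_mul_le {c : ℝ≥0∞} (hc : c ≠ ⊤) (f : Rn n → ℝ≥0∞) (x : Rn n) :
    maximal (fun y => c * f y) x ≤ c * maximal f x := by
  refine maximal_le fun z r hr hx => ?_
  rw [setLAverage_eq, lintegral_const_mul' _ _ hc, mul_div_assoc, ← setLAverage_eq]
  gcongr
  exact laverage_le_maximal f hr hx

theorem maximal_tsum_le {F : ℕ → Rn n → ℝ≥0∞} (hF : ∀ i, Measurable (F i)) (x : Rn n) :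
    maximal (fun y => ∑' i, F i y) x ≤ ∑' i, maximal (F i) x := by
  refine maximal_le fun z r hr hx => ?_
  rw [setLAverage_eq, lintegral_tsum fun i => (hF i).aemeasurable, div_eq_mul_inv,
    ← ENNReal.tsum_mul_right]
  refine ENNReal.tsum_le_tsum fun i => ?_
  rw [← div_eq_mul_inv, ← setLAverage_eq]
  exact laverage_le_maximal _ hr hx

/-- Restricting to large balls recovers the maximal function in the limit. -/
theorem maximal_le_iSup_indicator (f : Rn n → ℝ≥0∞) (x : Rn n) :
    maximal f x ≤ ⨆ k : ℕ, maximal ((Metric.ball (0 : Rn n) k).indicator f) x := by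
  refine maximal_le fun c r hr hx => ?_
  obtain ⟨k, hk⟩ := exists_nat_gt (‖c‖ + r)
  have hsub : Metric.ball c r ⊆ Metric.ball (0 : Rn n) k :=
    Metric.ball_subset_ball' (by rw [dist_zero_right]; linarith)
  refine le_iSup_of_le k (le_trans (le_of_eq ?_) (laverage_le_maximal _ hr hx))
  rw [setLAverage_eq, setLAverage_eq]
  congr 1
  refine setLIntegral_congr_fun measurableSet_ball fun y hy => ?_
  exact (indicator_of_mem (hsub hy) f).symm

theorem maximal_mono {f g : Rn n → ℝ≥0∞} (h : f ≤ g) : maximal f ≤ maximal g := fun x =>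
  maximal_le fun _ _ hr hx =>
    (by rw [setLAverage_eq, setLAverage_eq]; gcongr; exact h _ :
      _ ≤ _).trans (laverage_le_maximal g hr hx)

theorem boundedBy_of_opNorm_lt {T : (Rn n → ℝ≥0∞) → Rn n → ℝ≥0∞} {L : ℝ≥0∞}
    (h : opNorm T N < L) : BoundedBy T N L := by
  obtain ⟨C, hC, hCL⟩ := sInf_lt_iff.1 h
  exact fun f hf hfN => (hC f hf hfN).trans (by gcongr)

/-- The associate norm of the `1/θ`-convexification is controlled by an interpolation between the
associate norm and the `L¹` norm. -/
theorem associate_convexification_le {θ : ℝ} (hθ : θ ∈ Ioo (0 : ℝ) 1)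
    {h : Rn n → ℝ≥0∞} (hh : Measurable h) :
    associate (convexification N (1 / θ)) h
      ≤ associate N h ^ θ * (∫⁻ x, h x) ^ (1 - θ) := by
  refine associate_le fun G hG hG1 => ?_
  have hθ0 : θ ≠ 0 := hθ.1.ne'
  have h1 : N (fun x => G x ^ (1 / θ)) = 1 := by
    rw [convexification, one_div_one_div] at hG1
    have := congrArg (· ^ (1 / θ)) hG1
    simpa [← ENNReal.rpow_mul, hθ0] using this
  have hGm : AEMeasurable (fun x => G x ^ (1 / θ)) volume := hG.pow_const _
  calc ∫⁻ x, h x * G x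
      = ∫⁻ x, (h x * G x ^ (1 / θ)) ^ θ * (h x) ^ (1 - θ) := by
        refine lintegral_congr fun x => ?_
        rw [ENNReal.mul_rpow_of_nonneg _ _ hθ.1.le, ← ENNReal.rpow_mul, one_div_mul_cancel hθ0,
          ENNReal.rpow_one, mul_right_comm,
          ← ENNReal.rpow_add_of_nonneg _ _ hθ.1.le (by linarith [hθ.2])]
        simp
    _ ≤ (∫⁻ x, h x * G x ^ (1 / θ)) ^ θ * (∫⁻ x, h x) ^ (1 - θ) :=
        ENNReal.lintegral_mul_norm_pow_le (hh.aemeasurable.mul hGm) hh.aemeasurable hθ.1.le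
          (by linarith [hθ.2]) (by ring)
    _ ≤ associate N h ^ θ * (∫⁻ x, h x) ^ (1 - θ) := by
        gcongr
        · exact hθ.1.le
        · exact le_associate hGm h1

theorem tendsto_rpow_exponent (a : ℝ≥0∞) : Tendsto (fun t : ℝ => a ^ t) (𝓝 1) (𝓝 a) := by
  rcases eq_or_ne a 0 with rfl | h0
  · refine tendsto_nhds_of_eventually_eq ?_
    filter_upwards [lt_mem_nhds zero_lt_one] with t ht
    exact ENNReal.zero_rpow_of_pos ht
  rcases eq_or_ne a ⊤ with rfl | ht
  · refine tendsto_nhds_of_eventually_eq ?_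
    filter_upwards [lt_mem_nhds zero_lt_one] with t ht
    exact ENNReal.top_rpow_of_pos ht
  lift a to ℝ≥0 using ht
  have ha : a ≠ 0 := by exact_mod_cast h0
  have : Tendsto (fun t : ℝ => a ^ t) (𝓝 1) (𝓝 (a ^ (1 : ℝ))) :=
    (NNReal.continuousAt_rpow (Or.inl ha)).tendsto.comp
      (f := fun t : ℝ => (a, t)) (tendsto_const_nhds.prodMk_nhds tendsto_id)
  rw [NNReal.rpow_one] at this
  refine (ENNReal.tendsto_coe.2 this).congr fun t => ?_
  rw [ENNReal.coe_rpow_of_ne_zero ha]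

/-- If the maximal operator is bounded on the associate spaces of the convexifications
`X^{1/θ_m}`, `θ_m → 1`, with convergent norms, then it is bounded on `X'`. -/
theorem exists_associate_maximal_le (hN : IsBallBanach N) {θ : ℕ → ℝ}
    (hθ : ∀ m, θ m ∈ Ioo (0 : ℝ) 1) (hθlim : Tendsto θ atTop (𝓝 1))
    (hMlim : ∃ L : ℝ≥0, Tendsto
      (fun m => opNorm maximal (associate (convexification N (1 / θ m)))) atTop
        (𝓝 (L : ℝ≥0∞))) :
    ∃ L : ℝ≥0, 1 ≤ L ∧ ∀ h : Rn n → ℝ≥0∞, Measurable h →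
      associate N (maximal h) ≤ L * associate N h := by
  obtain ⟨L₀, hL₀⟩ := hMlim
  refine ⟨L₀ + 1, by simp, ?_⟩
  set L : ℝ≥0 := L₀ + 1
  have hL : (L₀ : ℝ≥0∞) < L := by exact_mod_cast lt_add_one L₀
  have hev : ∀ᶠ m in atTop,
      BoundedBy maximal (associate (convexification N (1 / θ m))) L := by
    filter_upwards [hL₀.eventually (gt_mem_nhds hL)] with m hm
    exact boundedBy_of_opNorm_lt hm
  -- integrable functions
  have hint : ∀ h : Rn n → ℝ≥0∞, Measurable h → associate N h < ⊤ → ∫⁻ x, h x < ⊤ →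
      associate N (maximal h) ≤ L * associate N h := by
    intro h hh hhN hh1
    refine associate_le fun g hg hg1 => ?_
    have hbd : ∀ᶠ m in atTop, ∫⁻ x, maximal h x * g x ^ θ m ≤
        L * (associate N h ^ θ m * (1 + ∫⁻ x, h x) ^ (1 - θ m)) := by
      filter_upwards [hev] with m hm
      have hθ0 : θ m ≠ 0 := (hθ m).1.ne'
      have h1 : convexification N (1 / θ m) (fun x => g x ^ θ m) = 1 := by
        simp only [convexification, one_div_one_div, ← ENNReal.rpow_mul, mul_one_div_cancel hθ0,
          ENNReal.rpow_one, hg1, ENNReal.one_rpow]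
      have h2 := associate_convexification_le (N := N) (hθ m) hh
      have h3 : associate (convexification N (1 / θ m)) h < ⊤ := by
        refine h2.trans_lt (ENNReal.mul_lt_top ?_ ?_)
        · exact ENNReal.rpow_lt_top_of_nonneg (hθ m).1.le hhN.ne
        · exact ENNReal.rpow_lt_top_of_nonneg (by linarith [(hθ m).2]) hh1.ne
      refine (le_associate (hg.pow_const _) h1).trans ((hm h hh.aemeasurable h3).trans ?_)
      gcongr
      refine h2.trans ?_
      gcongr
      · linarith [(hθ m).2]
      · exact le_add_self
    have hlim : Tendsto (fun m => (L : ℝ≥0∞) * (associate N h ^ θ m * (1 + ∫⁻ x, h x) ^ (1 - θ m)))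
        atTop (𝓝 (L * (associate N h * 1))) := by
      refine ENNReal.Tendsto.const_mul ?_ (Or.inr ENNReal.coe_ne_top)
      refine ENNReal.Tendsto.mul ((tendsto_rpow_exponent _).comp hθlim) (Or.inr (by simp)) ?_
        (Or.inr hhN.ne)
      set c : ℝ≥0∞ := 1 + ∫⁻ x, h x
      have hc0 : c ≠ 0 := by simp [c]
      have hct : c ≠ ⊤ := by simp [c, hh1.ne]
      have h4 : Tendsto (fun m => c ^ (2 - θ m) * c⁻¹) atTop (𝓝 (c * c⁻¹)) := by
        refine ENNReal.Tendsto.mul_const ((tendsto_rpow_exponent _).comp ?_) (Or.inl hc0)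
        have := hθlim.const_sub 2
        norm_num at this
        exact this
      rw [ENNReal.mul_inv_cancel hc0 hct] at h4
      refine h4.congr fun m => ?_
      rw [← ENNReal.rpow_neg_one, ← ENNReal.rpow_add _ _ hc0 hct]
      congr 1
      ring
    rw [mul_one] at hlim
    have hliminf : ∫⁻ x, maximal h x * g x ≤
        liminf (fun m => ∫⁻ x, maximal h x * g x ^ θ m) atTop := by
      refine le_trans ?_ (lintegral_liminf_le' fun m =>
        (measurable_maximal h).aemeasurable.mul (hg.pow_const _))
      refine lintegral_mono_ae ?_
      filter_upwards [hN.ae_lt_top hg (by rw [hg1]; exact ENNReal.one_lt_top)] with x hx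
      rcases eq_or_ne (g x) 0 with h0 | h0
      · simp [h0]
      exact (ENNReal.Tendsto.mul tendsto_const_nhds (Or.inr hx.ne)
        ((tendsto_rpow_exponent (g x)).comp hθlim) (Or.inl h0)).liminf_eq.ge
    refine hliminf.trans ?_
    rw [← hlim.liminf_eq]
    exact liminf_le_liminf hbd
  intro h hh
  by_cases hhN : associate N h = ⊤
  · rw [hhN, ENNReal.mul_top (by simp [L])]
    exact le_top
  have hk : ∀ k : ℕ, associate N (maximal ((Metric.ball (0 : Rn n) k).indicator h)) ≤
      L * associate N h := by
    intro k
    have hkm : Measurable ((Metric.ball (0 : Rn n) k).indicator h) := hh.indicator measurableSet_ball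
    have hle : associate N ((Metric.ball (0 : Rn n) k).indicator h) ≤ associate N h :=
      associate_mono (indicator_le_self _ _)
    refine (hint _ hkm (hle.trans_lt (lt_top_iff_ne_top.2 hhN)) ?_).trans (by gcongr)
    have hball : N ((Metric.ball (0 : Rn n) k).indicator 1) < ⊤ := by
      rcases Nat.eq_zero_or_pos k with rfl | hk
      · have : (Metric.ball (0 : Rn n) ((0 : ℕ) : ℝ)).indicator (1 : Rn n → ℝ≥0∞) = fun _ => 0 := by
          simp
        rw [this, hN.zero]
        exact ENNReal.zero_lt_top
      · exact hN.ball_mem 0 k (by exact_mod_cast hk)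
    have h1 := hN.lintegral_mul_le h (g := (Metric.ball (0 : Rn n) k).indicator 1)
      (measurable_one.indicator measurableSet_ball).aemeasurable hball
    refine lt_of_eq_of_lt ?_ (h1.trans_lt (ENNReal.mul_lt_top (lt_top_iff_ne_top.2 hhN) hball))
    refine lintegral_congr fun x => ?_
    by_cases hx : x ∈ Metric.ball (0 : Rn n) k <;> simp [hx]
  refine associate_le fun g hg hg1 => ?_
  calc ∫⁻ x, maximal h x * g x
      ≤ ∫⁻ x, ⨆ k : ℕ, maximal ((Metric.ball (0 : Rn n) k).indicator h) x * g x := by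
        refine lintegral_mono fun x => ?_
        rw [← ENNReal.iSup_mul]
        gcongr
        exact maximal_le_iSup_indicator h x
    _ = ⨆ k : ℕ, ∫⁻ x, maximal ((Metric.ball (0 : Rn n) k).indicator h) x * g x := by
        refine lintegral_iSup' (fun k => (measurable_maximal _).aemeasurable.mul hg)
          (ae_of_all _ fun x a b hab => ?_)
        have hab' : (a : ℝ) ≤ b := by exact_mod_cast hab
        have := maximal_mono (indicator_le_indicator_of_subset
          (Metric.ball_subset_ball (x := (0 : Rn n)) hab') (fun x => zero_le (a := h x))) x
        dsimp only
        gcongr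
    _ ≤ L * associate N h := iSup_le fun k => (le_associate hg hg1).trans (hk k)

/-- Extrapolation (Rubio de Francia): an inequality that holds in weighted `L¹` for all weights of
class `A₁` with a fixed constant holds in `X`, when the maximal operator is bounded on `X'`. -/
theorem IsBallBanach.extrapolation (hN : IsBallBanach N) {L : ℝ≥0} (hL1 : 1 ≤ L)
    (hL : ∀ h : Rn n → ℝ≥0∞, Measurable h → associate N (maximal h) ≤ L * associate N h)
    {F G : Rn n → ℝ≥0∞} (hF : AEMeasurable F volume) (hG : AEMeasurable G volume)
    (hGN : N G < ⊤) {K : ℝ≥0∞}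
    (h : ∀ w : Rn n → ℝ≥0∞, Measurable w →
      (∀ x, maximal w x ≤ (2 * L : ℝ≥0) * w x) → ∫⁻ x, w x * F x ≤ K * ∫⁻ x, w x * G x) :
    N F ≤ 2 * K * N G := by
  refine hN.le_of_forall_associate hF fun u hu hu1 => ?_
  set a : ℝ≥0 := (2 * L)⁻¹ with ha
  have hL0 : (2 * L : ℝ≥0) ≠ 0 := by positivity
  set T : ℕ → Rn n → ℝ≥0∞ := fun k => maximal^[k] u with hT
  have hTm : ∀ k, Measurable (T k) := by
    intro k
    cases k with
    | zero => exact hu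
    | succ k =>
      simp only [hT, Function.iterate_succ_apply']
      exact measurable_maximal _
  have hTs : ∀ k, T (k + 1) = maximal (T k) := fun k => by
    simp only [hT, Function.iterate_succ_apply']
  have hTN : ∀ k, associate N (T k) ≤ (L : ℝ≥0∞) ^ k := by
    intro k
    induction k with
    | zero => simpa [hT] using hu1
    | succ k ih =>
      rw [hTs, pow_succ']
      exact (hL _ (hTm k)).trans (by gcongr)
  set w : Rn n → ℝ≥0∞ := fun x => ∑' k, (a : ℝ≥0∞) ^ k * T k x with hw
  have hterm : ∀ k, Measurable fun x => (a : ℝ≥0∞) ^ k * T k x := fun k => (hTm k).const_mul _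
  have hwm : Measurable w := Measurable.tsum hterm
  have huw : u ≤ w := fun x => by
    have := ENNReal.le_tsum (f := fun k => (a : ℝ≥0∞) ^ k * T k x) 0
    simpa [hT] using this
  have haL : (a : ℝ≥0∞) * (2 * L : ℝ≥0) = 1 := by
    rw [← ENNReal.coe_mul, ha, inv_mul_cancel₀ hL0, ENNReal.coe_one]
  have hat : ∀ k, (a : ℝ≥0∞) ^ k ≠ ⊤ := fun k => ENNReal.pow_ne_top ENNReal.coe_ne_top
  have hA : ∀ x, maximal w x ≤ (2 * L : ℝ≥0) * w x := by
    intro x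
    calc maximal w x ≤ ∑' k, maximal (fun y => (a : ℝ≥0∞) ^ k * T k y) x := maximal_tsum_le hterm x
      _ ≤ ∑' k, (2 * L : ℝ≥0) * ((a : ℝ≥0∞) ^ (k + 1) * T (k + 1) x) := by
          refine ENNReal.tsum_le_tsum fun k => (maximal_const_mul_le (hat k) _ x).trans ?_
          rw [hTs, pow_succ, ← mul_assoc, mul_comm ((2 * L : ℝ≥0) : ℝ≥0∞), mul_assoc (_ ^ k), haL,
            mul_one]
      _ = (2 * L : ℝ≥0) * ∑' k, (a : ℝ≥0∞) ^ (k + 1) * T (k + 1) x := ENNReal.tsum_mul_left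
      _ ≤ (2 * L : ℝ≥0) * w x := by
          gcongr
          exact ENNReal.tsum_comp_le_tsum_of_injective (add_left_injective 1)
            (fun k => (a : ℝ≥0∞) ^ k * T k x)
  have hwN : associate N w ≤ 2 := by
    calc associate N w ≤ ∑' k, associate N (fun x => (a : ℝ≥0∞) ^ k * T k x) :=
          associate_tsum_le hterm
      _ ≤ ∑' k : ℕ, (2 : ℝ≥0∞)⁻¹ ^ k := by
          refine ENNReal.tsum_le_tsum fun k => (associate_const_mul_le (hat k) _).trans ?_
          calc (a : ℝ≥0∞) ^ k * associate N (T k) ≤ (a : ℝ≥0∞) ^ k * (L : ℝ≥0∞) ^ k := by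
                gcongr; exact hTN k
            _ = (2 : ℝ≥0∞)⁻¹ ^ k := by
                rw [← mul_pow]
                congr 1
                refine ENNReal.eq_inv_of_mul_eq_one_left ?_
                rw [← haL]
                push_cast
                ring
      _ = 2 := by rw [ENNReal.tsum_geometric, ENNReal.one_sub_inv_two, inv_inv]
  calc ∫⁻ x, u x * F x ≤ ∫⁻ x, w x * F x := lintegral_mono fun x => by gcongr; exact huw x
    _ ≤ K * ∫⁻ x, w x * G x := h w hwm hA
    _ ≤ K * (associate N w * N G) := by gcongr; exact hN.lintegral_mul_le w hG hGN
    _ ≤ K * (2 * N G) := by gcongr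
    _ = 2 * K * N G := by ring

end Maximal

/-! ### Weak gradients along segments -/

section Segment

variable {n : ℕ}

theorem setLIntegral_add_right_le {F : Rn n → ℝ≥0∞} (s : Set (Rn n)) (hs : MeasurableSet s)
    {s' : Set (Rn n)} (hs' : MeasurableSet s') (v : Rn n) (h : ∀ x ∈ s, x + v ∈ s') :
    ∫⁻ x in s, F (x + v) ≤ ∫⁻ x in s', F x := by
  rw [← lintegral_indicator hs, ← lintegral_indicator hs',
    ← lintegral_add_right_eq_self (s'.indicator F) v]
  refine lintegral_mono fun x => ?_
  by_cases hx : x ∈ s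
  · rw [indicator_of_mem hx, indicator_of_mem (h x hx)]
  · rw [indicator_of_notMem hx]
    exact zero_le

theorem LocallyIntegrable.setLIntegral_ball_lt_top {E : Type*} [NormedAddCommGroup E]
    {g : Rn n → E} (hg : LocallyIntegrable g volume) (c : Rn n) (R : ℝ) :
    ∫⁻ x in Metric.ball c R, ‖g x‖ₑ < ⊤ :=
  ((hg.integrableOn_isCompact (isCompact_closedBall c R)).mono_set
    Metric.ball_subset_closedBall).2

theorem locallyIntegrable_of_ball {E : Type*} [NormedAddCommGroup E] {g : Rn n → E}
    (h : ∀ R : ℝ, IntegrableOn g (Metric.ball 0 R) volume) : LocallyIntegrable g volume := by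
  rw [locallyIntegrable_iff]
  intro K hK
  obtain ⟨R, hR⟩ := hK.isBounded.subset_ball 0
  exact (h R).mono_set hR

theorem measurable_segment {E : Type*} [MeasurableSpace E] {g : Rn n → E} (hg : Measurable g)
    (h : Rn n) : Measurable fun p : Rn n × ℝ => g (p.1 + p.2 • h) := by
  refine hg.comp ?_
  fun_prop

theorem integrable_segment {E : Type*} [NormedAddCommGroup E] [MeasurableSpace E] [BorelSpace E]
    [SecondCountableTopology E] {g : Rn n → E} (hg : LocallyIntegrable g volume)
    (hgm : Measurable g) (R : ℝ) (h : Rn n) :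
    Integrable (fun p : Rn n × ℝ => g (p.1 + p.2 • h))
      ((volume.restrict (Metric.ball 0 R)).prod (volume.restrict (Ioc (0 : ℝ) 1))) := by
  have hm := measurable_segment hgm h
  refine ⟨hm.aestronglyMeasurable, ?_⟩
  rw [hasFiniteIntegral_iff_enorm, lintegral_prod_symm' _ hm.enorm]
  have hle : ∀ t ∈ Ioc (0 : ℝ) 1, ∫⁻ x in Metric.ball (0 : Rn n) R, ‖g (x + t • h)‖ₑ ≤
      ∫⁻ x in Metric.ball (0 : Rn n) (R + ‖h‖), ‖g x‖ₑ := by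
    intro t ht
    refine setLIntegral_add_right_le (F := fun x => ‖g x‖ₑ) _ measurableSet_ball
      measurableSet_ball _ fun x hx => ?_
    rw [mem_ball_zero_iff] at hx ⊢
    have : ‖t • h‖ ≤ ‖h‖ := by
      rw [norm_smul, Real.norm_of_nonneg ht.1.le]
      exact mul_le_of_le_one_left (norm_nonneg _) ht.2
    linarith [norm_add_le x (t • h)]
  calc ∫⁻ t in Ioc (0 : ℝ) 1, ∫⁻ x in Metric.ball (0 : Rn n) R, ‖g (x + t • h)‖ₑ
      ≤ ∫⁻ t in Ioc (0 : ℝ) 1, ∫⁻ x in Metric.ball (0 : Rn n) (R + ‖h‖), ‖g x‖ₑ :=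
        setLIntegral_mono' measurableSet_Ioc hle
    _ < ⊤ := by
        simp only [lintegral_const, Measure.restrict_apply_univ, Real.volume_Ioc]
        exact ENNReal.mul_lt_top (LocallyIntegrable.setLIntegral_ball_lt_top hg _ _) (by simp)

/-- The defining identity of the weak gradient, in an arbitrary direction. -/
theorem HasWeakGradient.integral_fderiv {f : Rn n → ℝ} {g : Rn n → Rn n}
    (hfg : HasWeakGradient f g) {φ : Rn n → ℝ} (hφ : ContDiff ℝ ∞ φ) (hc : HasCompactSupport φ)
    (h : Rn n) : ∫ x, f x * fderiv ℝ φ x h = -∫ x, φ x * inner ℝ (g x) h := by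
  have hφ' : Continuous (fderiv ℝ φ) := hφ.continuous_fderiv (by simp)
  have e1 : ∀ x, f x * fderiv ℝ φ x h =
      ∑ i, h i * (f x * fderiv ℝ φ x (EuclideanSpace.single i 1)) := by
    intro x
    have hh : h = ∑ i, h i • (EuclideanSpace.single i 1 : Rn n) := by
      ext j
      simp [Finset.sum_apply, Pi.single_apply]
    conv_lhs => rw [hh, map_sum, Finset.mul_sum]
    refine Finset.sum_congr rfl fun i _ => ?_
    rw [map_smul, smul_eq_mul]
    ring
  have e2 : ∀ x, φ x * inner ℝ (g x) h = ∑ i, h i * (φ x * g x i) := by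
    intro x
    rw [PiLp.inner_apply, Finset.mul_sum]
    refine Finset.sum_congr rfl fun i _ => ?_
    simp
    ring
  have i1 : ∀ i, Integrable (fun x => f x * fderiv ℝ φ x (EuclideanSpace.single i 1)) volume := by
    intro i
    have := hfg.locallyIntegrable.integrable_smul_left_of_hasCompactSupport
      (g := fun x => fderiv ℝ φ x (EuclideanSpace.single i 1)) (by fun_prop)
      (hc.fderiv_apply (𝕜 := ℝ) (EuclideanSpace.single i 1))
    simpa [smul_eq_mul, mul_comm] using this
  have i2 : ∀ i, Integrable (fun x => φ x * g x i) volume := by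
    intro i
    have := hfg.locallyIntegrable_grad.integrable_smul_left_of_hasCompactSupport hφ.continuous hc
    have h2 := ContinuousLinearMap.integrable_comp (EuclideanSpace.proj (𝕜 := ℝ) i) this
    simpa using h2
  simp_rw [e1, e2]
  rw [integral_finsetSum _ fun i _ => (i1 i).const_mul _,
    integral_finsetSum _ fun i _ => (i2 i).const_mul _, ← Finset.sum_neg_distrib]
  refine Finset.sum_congr rfl fun i _ => ?_
  rw [integral_const_mul, integral_const_mul, hfg.integral_eq φ hφ hc i]
  ring

/-- A function with a weak gradient satisfies the fundamental theorem of calculus along almost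
every translate of a given segment. -/
theorem HasWeakGradient.sub_eq_integral {f : Rn n → ℝ} {g : Rn n → Rn n}
    (hfg : HasWeakGradient f g) (hgm : Measurable g) (hfm : Measurable f) (h : Rn n) :
    ∀ᵐ x ∂(volume : Measure (Rn n)),
      f (x + h) - f x = ∫ t in Ioc (0 : ℝ) 1, inner ℝ (g (x + t • h)) h := by
  have hg := hfg.locallyIntegrable_grad
  have hf := hfg.locallyIntegrable
  have hseg : ∀ R : ℝ, Integrable (fun p : Rn n × ℝ => inner ℝ (g (p.1 + p.2 • h)) h)
      ((volume.restrict (Metric.ball 0 R)).prod (volume.restrict (Ioc (0 : ℝ) 1))) := fun R =>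
    (integrable_segment hg hgm R h).inner_const h
  have hv : LocallyIntegrable
      (fun x => ∫ t in Ioc (0 : ℝ) 1, inner ℝ (g (x + t • h)) h) volume :=
    locallyIntegrable_of_ball fun R => (hseg R).integral_prod_left
  have hfh : LocallyIntegrable (fun x => f (x + h)) volume := by
    refine locallyIntegrable_of_ball fun R => ?_
    refine ⟨(hfm.comp (measurable_add_const h)).aestronglyMeasurable, ?_⟩
    rw [hasFiniteIntegral_iff_enorm]
    refine (setLIntegral_add_right_le (F := fun x => ‖f x‖ₑ) (s' := Metric.ball 0 (R + ‖h‖)) _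
      measurableSet_ball measurableSet_ball h fun x hx => ?_).trans_lt
      (LocallyIntegrable.setLIntegral_ball_lt_top hf _ _)
    rw [mem_ball_zero_iff] at hx ⊢
    linarith [norm_add_le x h]
  have hu := (hfh.sub hf).sub hv
  have key := ae_eq_zero_of_integral_contDiff_smul_eq_zero hu ?_
  · filter_upwards [key] with x hx
    simpa [sub_eq_zero] using hx
  intro φ hφ hc
  obtain ⟨R, hR⟩ := hc.isCompact.isBounded.subset_ball 0
  have hφR : ∀ x, x ∉ Metric.ball (0 : Rn n) R → φ x = 0 := fun x hx =>
    image_eq_zero_of_notMem_tsupport fun h' => hx (hR h')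
  obtain ⟨M, hM⟩ := hφ.continuous.bounded_above_of_compact_support hc
  have hφ' : Continuous (fderiv ℝ φ) := hφ.continuous_fderiv (by simp)
  -- the three pieces
  have i1 := hfh.integrable_smul_left_of_hasCompactSupport hφ.continuous hc
  have i2 := hf.integrable_smul_left_of_hasCompactSupport hφ.continuous hc
  have i3 := hv.integrable_smul_left_of_hasCompactSupport hφ.continuous hc
  have hsplit : ∫ x, φ x • (((fun x => f (x + h)) - f -
      fun x => ∫ t in Ioc (0 : ℝ) 1, inner ℝ (g (x + t • h)) h) : Rn n → ℝ) x =
      (∫ x, φ x • f (x + h)) - (∫ x, φ x • f x) -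
        ∫ x, φ x • ∫ t in Ioc (0 : ℝ) 1, inner ℝ (g (x + t • h)) h := by
    have i12 : Integrable (fun x => φ x • f (x + h) - φ x • f x) volume := i1.sub i2
    rw [← integral_sub i1 i2, ← integral_sub i12 i3]
    refine integral_congr_ae (ae_of_all _ fun x => ?_)
    simp only [Pi.sub_apply, smul_eq_mul]
    ring
  rw [hsplit]
  have e1 : ∫ x, φ x • f (x + h) = ∫ x, φ (x - h) • f x := by
    rw [← integral_add_right_eq_self (fun x => φ (x - h) • f x) h]
    simp
  have e3 : ∫ x, φ x • ∫ t in Ioc (0 : ℝ) 1, inner ℝ (g (x + t • h)) h =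
      ∫ t in Ioc (0 : ℝ) 1, ∫ x, φ x * inner ℝ (g (x + t • h)) h := by
    have hres : ∀ F : Rn n → ℝ, ∫ x, φ x * F x = ∫ x in Metric.ball 0 R, φ x * F x := by
      intro F
      rw [setIntegral_eq_integral_of_forall_compl_eq_zero]
      intro x hx
      rw [hφR x hx, zero_mul]
    simp_rw [smul_eq_mul, hres]
    rw [← integral_integral_swap]
    · refine integral_congr_ae (ae_of_all _ fun x => ?_)
      simp only
      rw [integral_const_mul]
    · exact (hseg R).bdd_mul (c := M) (hφ.continuous.measurable.comp measurable_fst).aestronglyMeasurable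
        (ae_of_all _ fun p => hM p.1)
  have e4 : ∀ t : ℝ, ∫ x, φ x * inner ℝ (g (x + t • h)) h =
      -∫ x, f x * fderiv ℝ φ (x - t • h) h := by
    intro t
    have hφt : ContDiff ℝ ∞ fun x => φ (x - t • h) := hφ.comp (contDiff_id.sub contDiff_const)
    have hct : HasCompactSupport fun x => φ (x - t • h) :=
      hc.comp_homeomorph (Homeomorph.subRight (t • h))
    have := hfg.integral_fderiv hφt hct h
    simp_rw [fderiv_comp_sub] at this
    rw [this, neg_neg, ← integral_add_right_eq_self (fun x => φ (x - t • h) * inner ℝ (g x) h) (t • h)]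
    simp
  have e5 : ∫ t in Ioc (0 : ℝ) 1, ∫ x, f x * fderiv ℝ φ (x - t • h) h =
      ∫ x, f x * (φ x - φ (x - h)) := by
    obtain ⟨M', hM'⟩ := hφ'.bounded_above_of_compact_support (hc.fderiv (𝕜 := ℝ))
    have hz : ∀ t ∈ Icc (0 : ℝ) 1, ∀ x ∉ Metric.ball (0 : Rn n) (R + ‖h‖),
        x - t • h ∉ tsupport φ := by
      intro t ht x hx h'
      have h1 := hR h'
      rw [mem_ball_zero_iff] at h1 hx
      have : ‖t • h‖ ≤ ‖h‖ := by
        rw [norm_smul, Real.norm_of_nonneg ht.1]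
        exact mul_le_of_le_one_left (norm_nonneg _) ht.2
      linarith [norm_sub_norm_le x (t • h)]
    have hz1 : ∀ t ∈ Ioc (0 : ℝ) 1, ∫ x, f x * fderiv ℝ φ (x - t • h) h =
        ∫ x in Metric.ball (0 : Rn n) (R + ‖h‖), f x * fderiv ℝ φ (x - t • h) h := by
      intro t ht
      rw [setIntegral_eq_integral_of_forall_compl_eq_zero]
      intro x hx
      have := hz t ⟨ht.1.le, ht.2⟩ x hx
      rw [image_eq_zero_of_notMem_tsupport (f := fderiv ℝ φ)
        fun h' => this (tsupport_fderiv_subset ℝ h')]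
      simp
    have hrhs : ∫ x, f x * (φ x - φ (x - h)) =
        ∫ x in Metric.ball (0 : Rn n) (R + ‖h‖), f x * (φ x - φ (x - h)) := by
      refine (setIntegral_eq_integral_of_forall_compl_eq_zero fun x hx => ?_).symm
      have h0 := hz 0 (by simp) x hx
      have h1 := hz 1 (by simp) x hx
      rw [zero_smul, sub_zero] at h0
      rw [one_smul] at h1
      rw [image_eq_zero_of_notMem_tsupport h0, image_eq_zero_of_notMem_tsupport h1]
      simp
    rw [setIntegral_congr_fun measurableSet_Ioc hz1, hrhs, ← integral_integral_swap]
    · refine integral_congr_ae (ae_of_all _ fun x => ?_)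
      simp only
      rw [integral_const_mul]
      congr 1
      have hd : ∀ t : ℝ, HasDerivAt (fun t : ℝ => φ (x - t • h)) (-(fderiv ℝ φ (x - t • h) h)) t := by
        intro t
        have h1 : HasDerivAt (fun t : ℝ => x - t • h) (-h) t := by
          simpa using ((hasDerivAt_id t).smul_const h).const_sub x
        have h2 := (hφ.differentiable (by simp) (x - t • h)).hasFDerivAt.comp_hasDerivAt t h1
        exact h2.congr_deriv (by simp)
      have h3 := intervalIntegral.integral_eq_sub_of_hasDerivAt (a := 0) (b := 1) (fun t _ => hd t)
        (by
          refine Continuous.intervalIntegrable ?_ _ _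
          have : Continuous fun t : ℝ => fderiv ℝ φ (x - t • h) := hφ'.comp (by fun_prop)
          fun_prop)
      rw [intervalIntegral.integral_neg, intervalIntegral.integral_of_le zero_le_one] at h3
      simp only [one_smul, zero_smul, sub_zero] at h3
      linarith
    · have hfi : Integrable (fun p : Rn n × ℝ => f p.1)
          ((volume.restrict (Metric.ball (0 : Rn n) (R + ‖h‖))).prod
            (volume.restrict (Ioc (0 : ℝ) 1))) :=
        Integrable.comp_fst ((hf.integrableOn_isCompact (isCompact_closedBall 0 (R + ‖h‖))).mono_set
          Metric.ball_subset_closedBall) _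
      refine hfi.mul_bdd (c := M' * ‖h‖) (Continuous.aestronglyMeasurable ?_)
        (ae_of_all _ fun p => ?_)
      · have : Continuous fun p : Rn n × ℝ => fderiv ℝ φ (p.1 - p.2 • h) := hφ'.comp (by fun_prop)
        fun_prop
      · exact ((fderiv ℝ φ _).le_opNorm h).trans (by gcongr; exact hM' _)
  rw [e1, e3]
  simp_rw [e4]
  rw [integral_neg, e5]
  have i4 : Integrable (fun x => φ (x - h) • f x) volume :=
    hf.integrable_smul_left_of_hasCompactSupport (hφ.continuous.comp (by fun_prop))
      (hc.comp_homeomorph (Homeomorph.subRight h))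
  have e6 : ∫ x, f x * (φ x - φ (x - h)) = (∫ x, φ x • f x) - ∫ x, φ (x - h) • f x := by
    rw [← integral_sub i2 i4]
    refine integral_congr_ae (ae_of_all _ fun x => ?_)
    simp only [smul_eq_mul]
    ring
  rw [e6]
  ring

end Segment

/-! ### Averages over balls -/

section Averages

variable {n : ℕ}

theorem volume_ball_eq (x : Rn n) {r : ℝ} (hr : 0 < r) :
    volume (Metric.ball x r) = ENNReal.ofReal (r ^ n) * volume (Metric.ball (0 : Rn n) 1) := by
  rw [Measure.addHaar_ball_of_pos _ _ hr, finrank_euclideanSpace_fin]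

theorem volume_unitBall_ne_zero : volume (Metric.ball (0 : Rn n) 1) ≠ 0 :=
  (Metric.measure_ball_pos _ _ one_pos).ne'

theorem volume_unitBall_ne_top : volume (Metric.ball (0 : Rn n) 1) ≠ ⊤ :=
  measure_ball_lt_top.ne

theorem ballAverage_eq (r : ℝ) (f : Rn n → ℝ≥0∞) (x : Rn n) :
    ballAverage r f x = (∫⁻ y in Metric.ball x r, f y) / volume (Metric.ball x r) :=
  setLAverage_eq _ _ _

theorem setLIntegral_ball_eq (f : Rn n → ℝ≥0∞) (x : Rn n) {r : ℝ} (hr : 0 < r) :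
    ∫⁻ y in Metric.ball x r, f y = volume (Metric.ball x r) * ballAverage r f x := by
  rw [ballAverage_eq, ENNReal.mul_div_cancel (Metric.measure_ball_pos _ _ hr).ne'
    measure_ball_lt_top.ne]

theorem ballAverage_le_of_subset {f : Rn n → ℝ≥0∞} {x y : Rn n} {r s c : ℝ} (hr : 0 < r)
    (hsub : Metric.ball x r ⊆ Metric.ball y s) (hs : 0 < s) (hc : s ≤ c * r) :
    ballAverage r f x ≤ ENNReal.ofReal (c ^ n) * ballAverage s f y := by
  have hc0 : 0 ≤ c := by
    by_contra! h
    nlinarith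
  have hvol : volume (Metric.ball y s) ≤ ENNReal.ofReal (c ^ n) * volume (Metric.ball x r) := by
    rw [volume_ball_eq y hs, volume_ball_eq x hr, ← mul_assoc,
      ← ENNReal.ofReal_mul (by positivity), ← mul_pow]
    gcongr
  rw [ballAverage_eq, ENNReal.div_le_iff (Metric.measure_ball_pos _ _ hr).ne'
    measure_ball_lt_top.ne]
  calc ∫⁻ y in Metric.ball x r, f y ≤ ∫⁻ z in Metric.ball y s, f z := lintegral_mono_set hsub
    _ = volume (Metric.ball y s) * ballAverage s f y := setLIntegral_ball_eq f y hs
    _ ≤ ENNReal.ofReal (c ^ n) * volume (Metric.ball x r) * ballAverage s f y := by gcongr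
    _ = _ := by ring

theorem ballAverage_mono {f g : Rn n → ℝ≥0∞} (h : f ≤ g) (r : ℝ) (x : Rn n) :
    ballAverage r f x ≤ ballAverage r g x := by
  rw [ballAverage_eq, ballAverage_eq]
  gcongr
  exact h _

theorem ballAverage_add {f g : Rn n → ℝ≥0∞} (hf : Measurable f) (r : ℝ) (x : Rn n) :
    ballAverage r (fun y => f y + g y) x = ballAverage r f x + ballAverage r g x := by
  simp only [ballAverage_eq]
  rw [lintegral_add_left hf, ENNReal.add_div]

theorem ballAverage_const {r : ℝ} (hr : 0 < r) (c : ℝ≥0∞) (x : Rn n) :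
    ballAverage r (fun _ => c) x = c := by
  rw [ballAverage_eq, setLIntegral_const, ENNReal.mul_div_cancel_right
    (Metric.measure_ball_pos _ _ hr).ne' measure_ball_lt_top.ne]

theorem ballAverage_le_maximal (f : Rn n → ℝ≥0∞) (x : Rn n) {r : ℝ} (hr : 0 < r) :
    ballAverage r f x ≤ maximal f x :=
  laverage_le_maximal f hr (Metric.mem_ball_self hr)

theorem measurable_setLIntegral_ball {f : Rn n → ℝ≥0∞} (hf : Measurable f) (r : ℝ) :
    Measurable fun x => ∫⁻ y in Metric.ball x r, f y := by
  have h : Measurable fun p : Rn n × Rn n => {p : Rn n × Rn n | dist p.2 p.1 < r}.indicator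
      (fun p => f p.2) p :=
    (hf.comp measurable_snd).indicator
      (measurableSet_lt (measurable_snd.dist measurable_fst) measurable_const)
  have heq : (fun x => ∫⁻ y in Metric.ball x r, f y) = fun x => ∫⁻ y,
      {p : Rn n × Rn n | dist p.2 p.1 < r}.indicator (fun p => f p.2) (x, y) := by
    ext x
    rw [← lintegral_indicator measurableSet_ball]
    exact lintegral_congr fun y => by simp [indicator, Metric.mem_ball]
  rw [heq]
  exact h.lintegral_prod_right'

theorem measurable_ballAverage {f : Rn n → ℝ≥0∞} (hf : Measurable f) (r : ℝ) :
    Measurable (ballAverage r f) := by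
  have : ballAverage r f = fun x => (∫⁻ y in Metric.ball x r, f y) / volume (Metric.ball (0 : Rn n) r) := by
    ext x
    rw [ballAverage_eq, Measure.addHaar_ball_center]
  rw [this]
  exact (measurable_setLIntegral_ball hf r).div_const _

theorem lintegral_comp_add_smul (F : Rn n → ℝ≥0∞) (x : Rn n) {t : ℝ} (ht : 0 < t) :
    ∫⁻ y, F y = ENNReal.ofReal (t ^ n) * ∫⁻ z, F (x + t • z) := by
  have h1 : ∫⁻ y, F y = ∫⁻ y, F (x + y) := (lintegral_add_left_eq_self F x).symm
  have h2 := Measure.map_addHaar_smul (volume : Measure (Rn n)) ht.ne'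
  have h3 : ∫⁻ z, F (x + t • z) = ∫⁻ y, F (x + y) ∂(Measure.map (fun z : Rn n => t • z) volume) :=
    ((Homeomorph.smulOfNeZero t ht.ne').measurableEmbedding.lintegral_map (fun y => F (x + y))).symm
  rw [h1, h3, h2, lintegral_smul_measure, finrank_euclideanSpace_fin, smul_eq_mul, ← mul_assoc,
    ← ENNReal.ofReal_mul (by positivity), abs_of_pos (by positivity),
    mul_inv_cancel₀ (by positivity)]
  simp

theorem setLIntegral_ball_comp_add_smul (F : Rn n → ℝ≥0∞) (x : Rn n) {t : ℝ} (ht : 0 < t) (R : ℝ) :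
    ∫⁻ y in Metric.ball x (t * R), F y =
      ENNReal.ofReal (t ^ n) * ∫⁻ z in Metric.ball 0 R, F (x + t • z) := by
  rw [← lintegral_indicator measurableSet_ball, ← lintegral_indicator measurableSet_ball,
    lintegral_comp_add_smul _ x ht]
  congr 1
  refine lintegral_congr fun z => ?_
  have : x + t • z ∈ Metric.ball x (t * R) ↔ z ∈ Metric.ball (0 : Rn n) R := by
    rw [mem_ball_iff_norm, add_sub_cancel_left, norm_smul, Real.norm_of_nonneg ht.le,
      mem_ball_zero_iff, mul_lt_mul_iff_right₀ ht]
  by_cases hz : z ∈ Metric.ball (0 : Rn n) R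
  · rw [indicator_of_mem hz, indicator_of_mem (this.2 hz)]
  · rw [indicator_of_notMem hz, indicator_of_notMem fun h => hz (this.1 h)]

/-- The weighted sum `∑ⱼ 2⁻ʲ ⨍_{B(x, 2⁻ʲ ρ)} g` of averages over concentric balls, which controls the
mean oscillation on `B(x, ρ)`, divided by `ρ`, of a function whose gradient is bounded by `g`. -/
noncomputable def dyadicAverage (g : Rn n → ℝ≥0∞) (x : Rn n) (ρ : ℝ) : ℝ≥0∞ :=
  ∑' j : ℕ, (2 : ℝ≥0∞)⁻¹ ^ j * ballAverage (ρ / 2 ^ j) g x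

theorem iUnion_Ioc_dyadic : (⋃ j : ℕ, Ioc ((1 / 2 : ℝ) ^ (j + 1)) ((1 / 2) ^ j)) = Ioc 0 1 := by
  ext t
  simp only [mem_iUnion, mem_Ioc]
  constructor
  · rintro ⟨j, h1, h2⟩
    exact ⟨lt_trans (by positivity) h1, h2.trans (pow_le_one₀ (by norm_num) (by norm_num))⟩
  · rintro ⟨h0, h1⟩
    obtain ⟨j, h2, h3⟩ := exists_nat_pow_near_of_lt_one h0 h1 (by norm_num : (0 : ℝ) < 1 / 2)
      (by norm_num)
    exact ⟨j, h2, h3⟩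

/-- Averages over all radii below `ρ` are controlled by those over the dyadic radii. -/
theorem setLIntegral_ballAverage_le (g : Rn n → ℝ≥0∞) (x : Rn n) {ρ : ℝ} (hρ : 0 < ρ) :
    ∫⁻ t in Ioc (0 : ℝ) 1, ballAverage (t * ρ) g x ≤
      ENNReal.ofReal (2 ^ n) * dyadicAverage g x ρ := by
  rw [← iUnion_Ioc_dyadic, dyadicAverage, ← ENNReal.tsum_mul_left]
  refine (lintegral_iUnion_le _ _).trans (ENNReal.tsum_le_tsum fun j => ?_)
  calc ∫⁻ t in Ioc ((1 / 2 : ℝ) ^ (j + 1)) ((1 / 2) ^ j), ballAverage (t * ρ) g x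
      ≤ ∫⁻ t in Ioc ((1 / 2 : ℝ) ^ (j + 1)) ((1 / 2) ^ j),
          ENNReal.ofReal (2 ^ n) * ballAverage (ρ / 2 ^ j) g x := by
        refine setLIntegral_mono' measurableSet_Ioc fun t ht => ?_
        have ht0 : 0 < t := lt_trans (by positivity) ht.1
        have h1 : ρ / 2 ^ j = (1 / 2) ^ j * ρ := by rw [one_div, inv_pow]; field_simp
        refine ballAverage_le_of_subset (by positivity) (Metric.ball_subset_ball ?_) (by positivity)
          ?_
        · rw [h1]
          gcongr
          exact ht.2
        · rw [h1, ← mul_assoc]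
          gcongr
          have := ht.1
          rw [pow_succ] at this
          linarith
    _ ≤ ENNReal.ofReal (2 ^ n) * ballAverage (ρ / 2 ^ j) g x * (2 : ℝ≥0∞)⁻¹ ^ j := by
        rw [setLIntegral_const, Real.volume_Ioc]
        gcongr
        rw [← ENNReal.ofReal_ofNat, ← ENNReal.ofReal_inv_of_pos two_pos,
          ← ENNReal.ofReal_pow (by norm_num)]
        refine ENNReal.ofReal_le_ofReal ?_
        rw [one_div]
        linarith [show (0 : ℝ) < 2⁻¹ ^ (j + 1) by positivity]
    _ = _ := by ring

theorem dyadicAverage_add {f g : Rn n → ℝ≥0∞} (hf : Measurable f) (x : Rn n) (ρ : ℝ) :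
    dyadicAverage (fun y => f y + g y) x ρ = dyadicAverage f x ρ + dyadicAverage g x ρ := by
  simp only [dyadicAverage, ballAverage_add hf, mul_add]
  exact ENNReal.tsum_add

theorem tsum_two_inv_pow : ∑' j : ℕ, (2 : ℝ≥0∞)⁻¹ ^ j = 2 := by
  rw [ENNReal.tsum_geometric, ENNReal.one_sub_inv_two, inv_inv]

theorem dyadicAverage_le_of_forall {g : Rn n → ℝ≥0∞} {x : Rn n} {ρ : ℝ} {K : ℝ≥0∞}
    (h : ∀ j : ℕ, ballAverage (ρ / 2 ^ j) g x ≤ K) : dyadicAverage g x ρ ≤ 2 * K := by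
  rw [← tsum_two_inv_pow, ← ENNReal.tsum_mul_right]
  exact ENNReal.tsum_le_tsum fun j => by gcongr; exact h j

end Averages

/-! ### Pointwise estimates for functions with a weak gradient -/

section Pointwise

variable {n : ℕ} {f : Rn n → ℝ} {g : Rn n → Rn n}

theorem measurableSet_increment_le (hgm : Measurable g) (hfm : Measurable f) {G : Rn n → Rn n}
    (hG : Measurable G) :
    MeasurableSet {p : Rn n × Rn n | ‖f (p.1 + p.2) - f p.1 - inner ℝ (G p.1) p.2‖ₑ ≤
      ‖p.2‖ₑ * ∫⁻ t in Ioc (0 : ℝ) 1, ‖g (p.1 + t • p.2) - G p.1‖ₑ} := by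
  have hG1 : Measurable fun p : Rn n × Rn n => G p.1 := hG.comp measurable_fst
  have hm1 : Measurable fun p : Rn n × Rn n => ‖f (p.1 + p.2) - f p.1 - inner ℝ (G p.1) p.2‖ₑ :=
    (((hfm.comp (measurable_fst.add measurable_snd)).sub (hfm.comp measurable_fst)).sub
      (hG1.inner measurable_snd)).enorm
  refine measurableSet_le hm1 (measurable_snd.enorm.mul ?_)
  have h1 : Measurable fun z : (Rn n × Rn n) × ℝ => g (z.1.1 + z.2 • z.1.2) := by
    refine hgm.comp ?_
    fun_prop
  have h2 : Measurable fun z : (Rn n × Rn n) × ℝ => ‖g (z.1.1 + z.2 • z.1.2) - G z.1.1‖ₑ :=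
    (h1.sub (hG1.comp measurable_fst)).enorm
  exact h2.lintegral_prod_right'

theorem enorm_inner_le (u v : Rn n) : ‖inner ℝ u v‖ₑ ≤ ‖v‖ₑ * ‖u‖ₑ := by
  rw [← ofReal_norm, ← ofReal_norm, ← ofReal_norm, ← ENNReal.ofReal_mul (norm_nonneg _), mul_comm]
  exact ENNReal.ofReal_le_ofReal (norm_inner_le_norm u v)

theorem enorm_integral_inner_sub_le {u : ℝ → Rn n} {a : ℝ} {v h : Rn n}
    (hu : Integrable (fun t : ℝ => inner ℝ (u t) h) (volume.restrict (Ioc (0 : ℝ) 1)))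
    (ha : a = ∫ t in Ioc (0 : ℝ) 1, inner ℝ (u t) h) :
    ‖a - inner ℝ v h‖ₑ ≤ ‖h‖ₑ * ∫⁻ t in Ioc (0 : ℝ) 1, ‖u t - v‖ₑ := by
  have h1 : a - inner ℝ v h = ∫ t in Ioc (0 : ℝ) 1, inner ℝ (u t - v) h := by
    have h2 : (fun t : ℝ => inner ℝ (u t - v) h) = fun t => inner ℝ (u t) h - inner ℝ v h :=
      funext fun t => inner_sub_left _ _ _
    rw [h2, integral_sub hu (integrable_const _), ha]
    simp
  rw [h1]
  refine (enorm_integral_le_lintegral_enorm _).trans ?_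
  rw [← lintegral_const_mul' _ _ enorm_ne_top]
  exact lintegral_mono fun t => enorm_inner_le _ _

theorem HasWeakGradient.ae_integrable_segment (hfg : HasWeakGradient f g) (hgm : Measurable g)
    (h : Rn n) : ∀ᵐ x ∂(volume : Measure (Rn n)), Integrable
      (fun t : ℝ => inner ℝ (g (x + t • h)) h) (volume.restrict (Ioc (0 : ℝ) 1)) := by
  refine ae_of_forall_ball fun k => ?_
  have h1 := (integrable_segment hfg.locallyIntegrable_grad hgm (k + 1) h).prod_right_ae
  filter_upwards [h1] with x hx
  exact hx.inner_const h

/-- Comparison of an increment with a linear map, averaged over the segment. -/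
theorem HasWeakGradient.enorm_sub_le (hfg : HasWeakGradient f g) (hgm : Measurable g)
    (hfm : Measurable f) {G : Rn n → Rn n} (hG : Measurable G) :
    ∀ᵐ x ∂(volume : Measure (Rn n)), ∀ᵐ h ∂(volume : Measure (Rn n)),
      ‖f (x + h) - f x - inner ℝ (G x) h‖ₑ ≤
        ‖h‖ₑ * ∫⁻ t in Ioc (0 : ℝ) 1, ‖g (x + t • h) - G x‖ₑ := by
  have h1 : ∀ h : Rn n, ∀ᵐ x ∂(volume : Measure (Rn n)),
      ‖f (x + h) - f x - inner ℝ (G x) h‖ₑ ≤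
        ‖h‖ₑ * ∫⁻ t in Ioc (0 : ℝ) 1, ‖g (x + t • h) - G x‖ₑ := by
    intro h
    filter_upwards [hfg.ae_integrable_segment hgm h, hfg.sub_eq_integral hgm hfm h] with x hx1 hx2
    exact enorm_integral_inner_sub_le hx1 hx2
  exact (Measure.ae_ae_comm (p := fun x h => ‖f (x + h) - f x - inner ℝ (G x) h‖ₑ ≤
    ‖h‖ₑ * ∫⁻ t in Ioc (0 : ℝ) 1, ‖g (x + t • h) - G x‖ₑ)
    (measurableSet_increment_le hgm hfm hG)).2 (ae_of_all _ h1)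

/-- The increments of `f` around `x`, compared with a linear map and integrated over a ball, are
controlled by averages of the deviation of the gradient over smaller concentric balls. -/
theorem HasWeakGradient.setLIntegral_ball_le (hfg : HasWeakGradient f g) (hgm : Measurable g)
    (hfm : Measurable f) {G : Rn n → Rn n} (hG : Measurable G) :
    ∀ᵐ x ∂(volume : Measure (Rn n)), ∀ ρ : ℝ, 0 < ρ →
      ∫⁻ z in Metric.ball 0 ρ, ‖f (x + z) - f x - inner ℝ (G x) z‖ₑ ≤
        ENNReal.ofReal ρ * (volume (Metric.ball (0 : Rn n) ρ) *
          ∫⁻ t in Ioc (0 : ℝ) 1, ballAverage (t * ρ) (fun y => ‖g y - G x‖ₑ) x) := by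
  filter_upwards [hfg.enorm_sub_le hgm hfm hG] with x hx ρ hρ
  have hm : Measurable fun z : Rn n × ℝ => ‖g (x + z.2 • z.1) - G x‖ₑ := by fun_prop
  calc ∫⁻ z in Metric.ball 0 ρ, ‖f (x + z) - f x - inner ℝ (G x) z‖ₑ
      ≤ ∫⁻ z in Metric.ball 0 ρ, ENNReal.ofReal ρ *
          ∫⁻ t in Ioc (0 : ℝ) 1, ‖g (x + t • z) - G x‖ₑ := by
        refine lintegral_mono_ae ?_
        filter_upwards [ae_restrict_of_ae hx, ae_restrict_mem measurableSet_ball] with z hz hzb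
        refine hz.trans ?_
        gcongr
        rw [← ofReal_norm]
        exact ENNReal.ofReal_le_ofReal (mem_ball_zero_iff.1 hzb).le
    _ = ENNReal.ofReal ρ * ∫⁻ t in Ioc (0 : ℝ) 1, ∫⁻ z in Metric.ball (0 : Rn n) ρ,
          ‖g (x + t • z) - G x‖ₑ := by
        rw [lintegral_const_mul' _ _ ENNReal.ofReal_ne_top, lintegral_lintegral_swap]
        exact hm.aemeasurable
    _ = _ := by
        rw [← lintegral_const_mul' _ _ measure_ball_lt_top.ne]
        congr 1
        refine setLIntegral_congr_fun measurableSet_Ioc fun t ht => ?_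
        have ht0 : 0 < t := ht.1
        have h1 := setLIntegral_ball_comp_add_smul (fun y => ‖g y - G x‖ₑ) x ht0 ρ
        have h2 : volume (Metric.ball x (t * ρ)) =
            ENNReal.ofReal (t ^ n) * volume (Metric.ball (0 : Rn n) ρ) := by
          rw [volume_ball_eq _ (by positivity), volume_ball_eq _ hρ, mul_pow,
            ENNReal.ofReal_mul (by positivity), mul_assoc]
        have htn : ENNReal.ofReal (t ^ n) ≠ 0 := by simpa using pow_pos ht0 n
        rw [ballAverage_eq, h1, h2, ENNReal.mul_div_mul_left _ _ htn ENNReal.ofReal_ne_top,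
          ENNReal.mul_div_cancel (Metric.measure_ball_pos _ _ hρ).ne' measure_ball_lt_top.ne]

/-- The mean oscillation of `f` around `f x` is controlled by the averages of `|∇f|`. -/
theorem HasWeakGradient.ballAverage_sub_le (hfg : HasWeakGradient f g) (hgm : Measurable g)
    (hfm : Measurable f) :
    ∀ᵐ x ∂(volume : Measure (Rn n)), ∀ ρ : ℝ, 0 < ρ →
      ballAverage ρ (fun y => ‖f y - f x‖ₑ) x ≤
        ENNReal.ofReal (ρ * 2 ^ n) * dyadicAverage (fun y => ‖g y‖ₑ) x ρ := by
  filter_upwards [hfg.setLIntegral_ball_le hgm hfm (measurable_const (a := (0 : Rn n)))]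
    with x hx ρ hρ
  have h := hx ρ hρ
  simp only [inner_zero_left, sub_zero] at h
  have h1 := setLIntegral_ball_comp_add_smul (fun y => ‖f y - f x‖ₑ) x one_pos ρ
  simp only [one_mul, one_pow, ENNReal.ofReal_one, one_smul] at h1
  rw [ballAverage_eq, ENNReal.div_le_iff (Metric.measure_ball_pos _ _ hρ).ne'
    measure_ball_lt_top.ne, h1, Measure.addHaar_ball_center]
  refine h.trans ?_
  rw [ENNReal.ofReal_mul hρ.le]
  calc _ ≤ ENNReal.ofReal ρ * (volume (Metric.ball (0 : Rn n) ρ) *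
        (ENNReal.ofReal (2 ^ n) * dyadicAverage (fun y => ‖g y‖ₑ) x ρ)) := by
        gcongr
        exact setLIntegral_ballAverage_le _ _ hρ
    _ = _ := by ring

/-- Two-point inequality: away from a null set, increments of `f` are controlled by averages of
`|∇f|` over balls around both endpoints. -/
theorem HasWeakGradient.enorm_sub_le_dyadicAverage (hfg : HasWeakGradient f g)
    (hgm : Measurable g) (hfm : Measurable f) :
    ∃ S : Set (Rn n), (∀ᵐ x ∂(volume : Measure (Rn n)), x ∈ S) ∧ ∀ x ∈ S, ∀ y ∈ S, x ≠ y →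
      ‖f x - f y‖ₑ ≤ ENNReal.ofReal (2 ^ (2 * n + 1)) * ENNReal.ofReal ‖x - y‖ *
        (dyadicAverage (fun y => ‖g y‖ₑ) x (2 * ‖x - y‖) +
          dyadicAverage (fun y => ‖g y‖ₑ) y (2 * ‖x - y‖)) := by
  refine ⟨{x | ∀ ρ : ℝ, 0 < ρ → ballAverage ρ (fun y => ‖f y - f x‖ₑ) x ≤
    ENNReal.ofReal (ρ * 2 ^ n) * dyadicAverage (fun y => ‖g y‖ₑ) x ρ},
    hfg.ballAverage_sub_le hgm hfm, fun x hx y hy hxy => ?_⟩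
  rw [mem_ofPred_eq] at hx hy
  set ρ := ‖x - y‖ with hρ
  have hρ0 : 0 < ρ := by rw [hρ, norm_pos_iff, sub_ne_zero]; exact hxy
  have hm : ∀ w : Rn n, Measurable fun z => ‖f z - f w‖ₑ := fun w => by fun_prop
  calc ‖f x - f y‖ₑ = ballAverage ρ (fun _ => ‖f x - f y‖ₑ) x := (ballAverage_const hρ0 _ _).symm
    _ ≤ ballAverage ρ (fun z => ‖f z - f x‖ₑ + ‖f z - f y‖ₑ) x := by
        refine ballAverage_mono (fun z => ?_) _ _
        have : f x - f y = -(f z - f x) + (f z - f y) := by ring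
        rw [this]
        exact (enorm_add_le _ _).trans (by rw [enorm_neg])
    _ = ballAverage ρ (fun z => ‖f z - f x‖ₑ) x + ballAverage ρ (fun z => ‖f z - f y‖ₑ) x :=
        ballAverage_add (hm x) _ _
    _ ≤ ENNReal.ofReal (2 ^ n) * ballAverage (2 * ρ) (fun z => ‖f z - f x‖ₑ) x +
        ENNReal.ofReal (2 ^ n) * ballAverage (2 * ρ) (fun z => ‖f z - f y‖ₑ) y := by
        gcongr
        · exact ballAverage_le_of_subset hρ0 (Metric.ball_subset_ball (by linarith)) (by positivity)
            le_rfl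
        · refine ballAverage_le_of_subset hρ0 (Metric.ball_subset_ball' ?_) (by positivity) le_rfl
          rw [dist_eq_norm]
          linarith
    _ ≤ ENNReal.ofReal (2 ^ n) * (ENNReal.ofReal (2 * ρ * 2 ^ n) *
          dyadicAverage (fun y => ‖g y‖ₑ) x (2 * ρ)) +
        ENNReal.ofReal (2 ^ n) * (ENNReal.ofReal (2 * ρ * 2 ^ n) *
          dyadicAverage (fun y => ‖g y‖ₑ) y (2 * ρ)) := by
        gcongr
        · exact hx _ (by positivity)
        · exact hy _ (by positivity)
    _ = _ := by
        rw [← mul_add, ← mul_add, ← mul_assoc, ← ENNReal.ofReal_mul (by positivity),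
          ← ENNReal.ofReal_mul (by positivity)]
        congr 2
        ring

/-- Lebesgue points, for open balls. -/
theorem ae_tendsto_ballAverage (hg : LocallyIntegrable g volume) :
    ∀ᵐ x ∂(volume : Measure (Rn n)),
      Tendsto (fun r => ballAverage r (fun y => ‖g y - g x‖ₑ) x) (𝓝[>] 0) (𝓝 0) := by
  have h := (IsUnifLocDoublingMeasure.vitaliFamily (volume : Measure (Rn n)) 1).ae_tendsto_lintegral_enorm_sub_div hg
  filter_upwards [h] with x hx
  have h1 := IsUnifLocDoublingMeasure.tendsto_closedBall_filterAt (μ := (volume : Measure (Rn n)))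
    (K := 1) (x := x) (l := 𝓝[>] (0 : ℝ)) (fun _ => x) (fun r => r) tendsto_id
    (by
      filter_upwards [self_mem_nhdsWithin] with r hr
      have : (0 : ℝ) < r := hr
      exact Metric.mem_closedBall_self (by simpa using this.le))
  refine tendsto_of_tendsto_of_tendsto_of_le_of_le' tendsto_const_nhds (hx.comp h1)
    (Eventually.of_forall fun _ => zero_le) ?_
  filter_upwards [self_mem_nhdsWithin] with r hr
  have hr0 : (0 : ℝ) < r := hr
  have hv : volume (Metric.closedBall x r) = volume (Metric.ball x r) := by
    rw [Measure.addHaar_closedBall _ _ hr0.le, Measure.addHaar_ball_of_pos _ _ hr0]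
  simp only [Function.comp]
  rw [ballAverage_eq, hv]
  gcongr
  exact Metric.ball_subset_closedBall

/-- Rescaled increments of `f` converge to the linear map given by the gradient, in `L¹` on balls. -/
theorem HasWeakGradient.ae_tendsto_increment (hfg : HasWeakGradient f g) (hgm : Measurable g)
    (hfm : Measurable f) :
    ∀ᵐ x ∂(volume : Measure (Rn n)), ∀ R : ℝ, 0 < R →
      Tendsto (fun r : ℝ => ∫⁻ z in Metric.ball 0 R,
        ‖(f (x + r • z) - f x) / r - inner ℝ (g x) z‖ₑ) (𝓝[>] 0) (𝓝 0) := by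
  filter_upwards [hfg.setLIntegral_ball_le hgm hfm hgm,
    ae_tendsto_ballAverage hfg.locallyIntegrable_grad] with x hx hL R hR
  rw [ENNReal.tendsto_nhds_zero]
  intro ε hε
  set V := ENNReal.ofReal R * volume (Metric.ball (0 : Rn n) R) with hV
  have hVt : V ≠ ⊤ := ENNReal.mul_ne_top ENNReal.ofReal_ne_top measure_ball_lt_top.ne
  have hV0 : V ≠ 0 := mul_ne_zero (by simpa using hR) (Metric.measure_ball_pos _ _ hR).ne'
  have hδ : 0 < ε / V := ENNReal.div_pos hε.ne' hVt
  obtain ⟨δ, hδ0, hδ'⟩ := mem_nhdsGT_iff_exists_Ioo_subset.1 ((ENNReal.tendsto_nhds_zero.1 hL) _ hδ)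
  have hev : ∀ᶠ r in 𝓝[>] (0 : ℝ), r ∈ Ioo 0 (δ / R) :=
    Ioo_mem_nhdsGT (div_pos hδ0 hR)
  filter_upwards [hev] with r hr
  have hr0 : 0 < r := hr.1
  have hrR : r * R < δ := (lt_div_iff₀ hR).1 hr.2
  have h1 := hx (r * R) (by positivity)
  have h2 := setLIntegral_ball_comp_add_smul
    (fun z => ‖f (x + z) - f x - inner ℝ (g x) z‖ₑ) 0 hr0 R
  rw [h2] at h1
  have h3 : ∫⁻ t in Ioc (0 : ℝ) 1, ballAverage (t * (r * R)) (fun y => ‖g y - g x‖ₑ) x ≤ ε / V := by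
    calc _ ≤ ∫⁻ t in Ioc (0 : ℝ) 1, ε / V := by
          refine setLIntegral_mono' measurableSet_Ioc fun t ht => ?_
          have ht0 : 0 < t := ht.1
          refine hδ' ⟨by positivity, lt_of_le_of_lt ?_ hrR⟩
          exact mul_le_of_le_one_left (by positivity) ht.2
      _ = ε / V := by simp
  have hrn : ENNReal.ofReal (r ^ n) ≠ 0 := by simpa using pow_pos hr0 n
  have hr0' : ENNReal.ofReal r ≠ 0 := by simpa using hr0
  have h4 : ∫⁻ z in Metric.ball (0 : Rn n) R, ‖f (x + (0 + r • z)) - f x - inner ℝ (g x) (0 + r • z)‖ₑ =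
      ENNReal.ofReal r * ∫⁻ z in Metric.ball (0 : Rn n) R,
        ‖(f (x + r • z) - f x) / r - inner ℝ (g x) z‖ₑ := by
    rw [← lintegral_const_mul' _ _ ENNReal.ofReal_ne_top]
    refine lintegral_congr fun z => ?_
    rw [zero_add, inner_smul_right, ← Real.enorm_of_nonneg hr0.le, ← enorm_mul, mul_sub,
      mul_div_cancel₀ _ hr0.ne']
  rw [h4] at h1
  have h5 : ENNReal.ofReal (r ^ n) * ENNReal.ofReal r * (∫⁻ z in Metric.ball (0 : Rn n) R,
        ‖(f (x + r • z) - f x) / r - inner ℝ (g x) z‖ₑ) ≤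
      ENNReal.ofReal (r ^ n) * ENNReal.ofReal r * ε := by
    rw [mul_assoc]
    refine h1.trans ?_
    calc _ ≤ ENNReal.ofReal (r * R) * (volume (Metric.ball (0 : Rn n) (r * R)) * (ε / V)) := by gcongr
      _ = ENNReal.ofReal (r ^ n) * ENNReal.ofReal r * (V * (ε / V)) := by
          have : volume (Metric.ball (0 : Rn n) (r * R)) =
              ENNReal.ofReal (r ^ n) * volume (Metric.ball (0 : Rn n) R) := by
            rw [volume_ball_eq _ (by positivity), volume_ball_eq _ hR, mul_pow,
              ENNReal.ofReal_mul (by positivity), mul_assoc]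
          rw [this, hV, ENNReal.ofReal_mul hr0.le]
          ring
      _ = _ := by rw [ENNReal.mul_div_cancel hV0 hVt]
  exact (ENNReal.mul_le_mul_iff_right (mul_ne_zero hrn hr0')
    (ENNReal.mul_ne_top ENNReal.ofReal_ne_top ENNReal.ofReal_ne_top)).1 h5

end Pointwise

/-! ### Integrals in polar coordinates -/

section Polar

variable {n : ℕ}

theorem nontrivial_Rn (hn : 1 ≤ n) : Nontrivial (Rn n) := by
  have : Nonempty (Fin n) := ⟨⟨0, hn⟩⟩
  infer_instance

theorem lintegral_polar (hn : 1 ≤ n) {F : Rn n → ℝ≥0∞} (hF : Measurable F) :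
    ∫⁻ x, F x = ∫⁻ u : Metric.sphere (0 : Rn n) 1, (∫⁻ r in Ioi (0 : ℝ),
      ENNReal.ofReal (r ^ (n - 1)) * F (r • (u : Rn n))) ∂((volume : Measure (Rn n)).toSphere) := by
  have := nontrivial_Rn hn
  have h1 : ∫⁻ x, F x = ∫⁻ x : ({(0 : Rn n)}ᶜ : Set (Rn n)), F x ∂((volume : Measure (Rn n)).comap Subtype.val) := by
    rw [lintegral_subtype_comap (measurableSet_singleton _).compl, restrict_compl_singleton]
  have hG : Measurable fun p : Metric.sphere (0 : Rn n) 1 × Ioi (0 : ℝ) =>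
      F ((p.2 : ℝ) • (p.1 : Rn n)) := by
    refine hF.comp ?_
    fun_prop
  have h2 := ((volume : Measure (Rn n)).measurePreserving_homeomorphUnitSphereProd).lintegral_comp hG
  have h3 : ∀ x : ({(0 : Rn n)}ᶜ : Set (Rn n)), F (((homeomorphUnitSphereProd (Rn n) x).2 : ℝ) •
      ((homeomorphUnitSphereProd (Rn n) x).1 : Rn n)) = F x := by
    intro x
    have hx : ‖(x : Rn n)‖ ≠ 0 := norm_ne_zero_iff.2 x.2
    simp [smul_smul, hx]
  simp only [h3] at h2
  rw [h1, h2, lintegral_prod _ hG.aemeasurable]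
  refine lintegral_congr fun u => ?_
  rw [Measure.volumeIoiPow, lintegral_withDensity_eq_lintegral_mul _ (by fun_prop)
    (g := fun y : Ioi (0 : ℝ) => F ((y : ℝ) • (u : Rn n))) (hG.comp measurable_prodMk_left),
    finrank_euclideanSpace_fin, ← lintegral_subtype_comap measurableSet_Ioi]
  rfl

/-- One-dimensional integral of a power over the region where another power is below a level, for
the strict and the non-strict inequality. -/
theorem lintegral_rpow_level {b s a : ℝ} (hsb : 0 < s / b) (ha : 0 ≤ a) :
    ∫⁻ r in {r : ℝ | 0 < r ∧ r ^ b < a}, ENNReal.ofReal (r ^ (s - 1)) =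
        ENNReal.ofReal (a ^ (s / b) / |s|) ∧
      ∫⁻ r in {r : ℝ | 0 < r ∧ r ^ b ≤ a}, ENNReal.ofReal (r ^ (s - 1)) =
        ENNReal.ofReal (a ^ (s / b) / |s|) := by
  have hb : b ≠ 0 := by rintro rfl; simp at hsb
  rcases ha.eq_or_lt with rfl | ha
  · have h1 : {r : ℝ | 0 < r ∧ r ^ b < 0} = ∅ := by
      ext r; simp only [mem_ofPred_eq, mem_empty_iff_false, iff_false, not_and, not_lt]
      exact fun hr => (Real.rpow_pos_of_pos hr b).le
    have h2 : {r : ℝ | 0 < r ∧ r ^ b ≤ 0} = ∅ := by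
      ext r; simp only [mem_ofPred_eq, mem_empty_iff_false, iff_false, not_and, not_le]
      exact fun hr => Real.rpow_pos_of_pos hr b
    rw [h1, h2, Real.zero_rpow hsb.ne']
    simp
  set R := a ^ (1 / b) with hR
  have hR0 : 0 < R := Real.rpow_pos_of_pos ha _
  have hRb : R ^ b = a := by rw [hR, ← Real.rpow_mul ha.le, one_div_mul_cancel hb, Real.rpow_one]
  have hRs : R ^ s = a ^ (s / b) := by
    rw [hR, ← Real.rpow_mul ha.le]
    congr 1
    ring
  rcases lt_or_gt_of_ne hb with hb0 | hb0
  · have hs : s < 0 := by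
      by_contra! h
      exact absurd hsb (not_lt.2 (div_nonpos_of_nonneg_of_nonpos h hb0.le))
    have h1 : {r : ℝ | 0 < r ∧ r ^ b < a} = Ioi R := by
      ext r
      simp only [mem_ofPred_eq, mem_Ioi]
      constructor
      · rintro ⟨hr, h⟩
        rw [← hRb] at h
        exact (Real.rpow_lt_rpow_iff_of_neg hr hR0 hb0).1 h
      · intro h
        have hr : 0 < r := hR0.trans h
        exact ⟨hr, by rw [← hRb]; exact (Real.rpow_lt_rpow_iff_of_neg hr hR0 hb0).2 h⟩
    have h2 : {r : ℝ | 0 < r ∧ r ^ b ≤ a} = Ici R := by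
      ext r
      simp only [mem_ofPred_eq, mem_Ici]
      constructor
      · rintro ⟨hr, h⟩
        rw [← hRb] at h
        exact (Real.rpow_le_rpow_iff_of_neg hr hR0 hb0).1 h
      · intro h
        have hr : 0 < r := hR0.trans_le h
        exact ⟨hr, by rw [← hRb]; exact (Real.rpow_le_rpow_iff_of_neg hr hR0 hb0).2 h⟩
    have h3 : ∫⁻ r in Ioi R, ENNReal.ofReal (r ^ (s - 1)) = ENNReal.ofReal (a ^ (s / b) / |s|) := by
      rw [← ofReal_integral_eq_lintegral_ofReal (integrableOn_Ioi_rpow_of_lt (by linarith) hR0)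
        ((ae_restrict_mem measurableSet_Ioi).mono fun r hr =>
          Real.rpow_nonneg (hR0.trans hr).le _), integral_Ioi_rpow_of_lt (by linarith) hR0,
        sub_add_cancel, hRs, abs_of_neg hs, div_neg, neg_div]
    rw [h1, h2, h3, setLIntegral_congr Ioi_ae_eq_Ici.symm, h3]
    exact ⟨rfl, rfl⟩
  · have hs : 0 < s := by
      by_contra! h
      exact absurd hsb (not_lt.2 (div_nonpos_of_nonpos_of_nonneg h hb0.le))
    have h1 : {r : ℝ | 0 < r ∧ r ^ b < a} = Ioo 0 R := by
      ext r
      simp only [mem_ofPred_eq, mem_Ioo]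
      refine and_congr_right fun hr => ?_
      rw [← hRb, Real.rpow_lt_rpow_iff hr.le hR0.le hb0]
    have h2 : {r : ℝ | 0 < r ∧ r ^ b ≤ a} = Ioc 0 R := by
      ext r
      simp only [mem_ofPred_eq, mem_Ioc]
      refine and_congr_right fun hr => ?_
      rw [← hRb, Real.rpow_le_rpow_iff hr.le hR0.le hb0]
    have h3 : ∫⁻ r in Ioc 0 R, ENNReal.ofReal (r ^ (s - 1)) = ENNReal.ofReal (a ^ (s / b) / |s|) := by
      have hi : IntegrableOn (fun r : ℝ => r ^ (s - 1)) (Ioc 0 R) :=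
        (intervalIntegrable_iff_integrableOn_Ioc_of_le hR0.le).1
          (intervalIntegral.intervalIntegrable_rpow' (by linarith))
      rw [← ofReal_integral_eq_lintegral_ofReal hi
        ((ae_restrict_mem measurableSet_Ioc).mono fun r hr => Real.rpow_nonneg hr.1.le _),
        ← intervalIntegral.integral_of_le hR0.le, integral_rpow (Or.inl (by linarith)),
        sub_add_cancel, hRs, Real.zero_rpow hs.ne', sub_zero, abs_of_pos hs]
    rw [h1, h2, h3, setLIntegral_congr Ioo_ae_eq_Ioc, h3]
    exact ⟨rfl, rfl⟩

theorem ofReal_pow_mul_rpow (hn : 1 ≤ n) {r : ℝ} (hr : 0 < r) (s : ℝ) :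
    ENNReal.ofReal (r ^ (n - 1)) * ENNReal.ofReal (r ^ (s - n)) = ENNReal.ofReal (r ^ (s - 1)) := by
  rw [← ENNReal.ofReal_mul (by positivity), ← Real.rpow_natCast, ← Real.rpow_add hr]
  congr 2
  push_cast [hn]
  ring

/-- The integral of `|z|^{s-n}` over a region described, on each ray, by a level of `|z|^b`. -/
theorem lintegral_rpow_region (hn : 1 ≤ n) {b s : ℝ} (hsb : 0 < s / b)
    {A : Set (Rn n)} (hA : MeasurableSet A) {a : Rn n → ℝ} (ha : ∀ u, 0 ≤ a u)
    (h : (∀ (u : Rn n) (r : ℝ), ‖u‖ = 1 → 0 < r → (r • u ∈ A ↔ r ^ b < a u)) ∨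
      ∀ (u : Rn n) (r : ℝ), ‖u‖ = 1 → 0 < r → (r • u ∈ A ↔ r ^ b ≤ a u)) :
    ∫⁻ z in A, ENNReal.ofReal (‖z‖ ^ (s - n)) =
      ∫⁻ u : Metric.sphere (0 : Rn n) 1, ENNReal.ofReal (a u ^ (s / b) / |s|)
        ∂((volume : Measure (Rn n)).toSphere) := by
  have hm : Measurable fun z : Rn n => ENNReal.ofReal (‖z‖ ^ (s - n)) := by fun_prop
  rw [← lintegral_indicator hA, lintegral_polar hn (hm.indicator hA)]
  refine lintegral_congr fun u => ?_
  have hu : ‖(u : Rn n)‖ = 1 := by simp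
  have key : ∀ B : Set ℝ, MeasurableSet B → (∀ r : ℝ, r ∈ B ↔ 0 < r ∧ r • (u : Rn n) ∈ A) →
      ∫⁻ r in Ioi (0 : ℝ), ENNReal.ofReal (r ^ (n - 1)) *
        A.indicator (fun z : Rn n => ENNReal.ofReal (‖z‖ ^ (s - n))) (r • (u : Rn n)) =
      ∫⁻ r in B, ENNReal.ofReal (r ^ (s - 1)) := by
    intro B hBm hB
    rw [← lintegral_indicator measurableSet_Ioi, ← lintegral_indicator hBm]
    refine lintegral_congr fun r => ?_
    by_cases hr : 0 < r
    · rw [indicator_of_mem (mem_Ioi.2 hr)]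
      by_cases hrA : r • (u : Rn n) ∈ A
      · rw [indicator_of_mem hrA, indicator_of_mem ((hB r).2 ⟨hr, hrA⟩), norm_smul, hu, mul_one,
          Real.norm_of_nonneg hr.le, ofReal_pow_mul_rpow hn hr]
      · rw [indicator_of_notMem hrA, indicator_of_notMem fun h => hrA ((hB r).1 h).2, mul_zero]
    · rw [indicator_of_notMem (by simpa using hr), indicator_of_notMem fun h => hr ((hB r).1 h).1]
  have hpow : Measurable fun r : ℝ => r ^ b := by fun_prop
  rcases h with h | h
  · rw [key {r : ℝ | 0 < r ∧ r ^ b < a u}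
      ((measurableSet_lt measurable_const measurable_id).inter
        (measurableSet_lt hpow measurable_const))
      (fun r => and_congr_right fun hr => (h u r hu hr).symm),
      (lintegral_rpow_level hsb (ha u)).1]
  · rw [key {r : ℝ | 0 < r ∧ r ^ b ≤ a u}
      ((measurableSet_lt measurable_const measurable_id).inter
        (measurableSet_le hpow measurable_const))
      (fun r => and_congr_right fun hr => (h u r hu hr).symm),
      (lintegral_rpow_level hsb (ha u)).2]

/-- The integral of `|z|^{s-n}` over the region `|z|^b < a` is a multiple of `a^{s/b}`. -/
theorem lintegral_radial (hn : 1 ≤ n) {b s a : ℝ} (hsb : 0 < s / b) (ha : 0 ≤ a) :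
    ∫⁻ z in {z : Rn n | ‖z‖ ^ b < a}, ENNReal.ofReal (‖z‖ ^ (s - n)) =
      ENNReal.ofReal (a ^ (s / b) / |s|) * (volume : Measure (Rn n)).toSphere univ := by
  have hA : MeasurableSet {z : Rn n | ‖z‖ ^ b < a} :=
    measurableSet_lt (by fun_prop) measurable_const
  rw [lintegral_rpow_region hn hsb hA (a := fun _ => a) (fun _ => ha) (Or.inl ?_), lintegral_const]
  intro u r hu hr
  rw [mem_ofPred_eq, norm_smul, hu, mul_one, Real.norm_of_nonneg hr.le]

theorem rpow_one_add_lt_iff {r c b : ℝ} (hr : 0 < r) :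
    (r ^ (1 + b) < r * c ↔ r ^ b < c) ∧ (r ^ (1 + b) ≤ r * c ↔ r ^ b ≤ c) := by
  rw [Real.rpow_add hr, Real.rpow_one]
  exact ⟨mul_lt_mul_iff_right₀ hr, mul_le_mul_iff_right₀ hr⟩

theorem kappa_nonneg (q : ℝ) (e : Rn n) : 0 ≤ kappa q e :=
  integral_nonneg fun _ => by positivity

theorem lintegral_kappa {q : ℝ} (hq : 0 < q) {e : Rn n} (he : ‖e‖ = 1) :
    ∫⁻ u : Metric.sphere (0 : Rn n) 1, ENNReal.ofReal (|inner ℝ e (u : Rn n)| ^ q)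
      ∂((volume : Measure (Rn n)).toSphere) = ENNReal.ofReal (kappa q e) := by
  rw [kappa, ofReal_integral_eq_lintegral_ofReal _ (ae_of_all _ fun _ => by positivity)]
  have hc : Continuous fun u : Metric.sphere (0 : Rn n) 1 => |inner ℝ e (u : Rn n)| ^ q := by
    refine Continuous.rpow_const ?_ fun _ => Or.inr hq.le
    fun_prop
  refine Integrable.of_bound hc.aestronglyMeasurable 1 (ae_of_all _ fun u => ?_)
  rw [Real.norm_of_nonneg (by positivity)]
  refine Real.rpow_le_one (abs_nonneg _) ?_ hq.le
  refine (abs_real_inner_le_norm _ _).trans ?_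
  have hu : ‖(u : Rn n)‖ = 1 := by simp
  rw [he, hu, one_mul]

/-- The region `{z : |z|^{1+b} < |⟨v, z⟩|}`, which is the rescaled limit of the level sets at a point
where the gradient is `v`. -/
def limitRegion (v : Rn n) (b : ℝ) : Set (Rn n) := {z | ‖z‖ ^ (1 + b) < |inner ℝ v z|}

/-- The closed version of `limitRegion`. -/
def limitRegionClosed (v : Rn n) (b : ℝ) : Set (Rn n) := {z | ‖z‖ ^ (1 + b) ≤ |inner ℝ v z|}

theorem measurableSet_limitRegion (v : Rn n) (b : ℝ) : MeasurableSet (limitRegion v b) :=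
  measurableSet_lt (by fun_prop) (by fun_prop)

theorem measurableSet_limitRegionClosed (v : Rn n) (b : ℝ) :
    MeasurableSet (limitRegionClosed v b) :=
  measurableSet_le (by fun_prop) (by fun_prop)

theorem lintegral_limitRegion_aux (hn : 1 ≤ n) {b s : ℝ} (hsb : 0 < s / b) {e : Rn n}
    (he : ‖e‖ = 1) {c : ℝ} (hc : 0 ≤ c) :
    ∫⁻ z in limitRegion (c • e) b, ENNReal.ofReal (‖z‖ ^ (s - n)) =
        ENNReal.ofReal (kappa (s / b) e / |s|) * ENNReal.ofReal (c ^ (s / b)) ∧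
      ∫⁻ z in limitRegionClosed (c • e) b, ENNReal.ofReal (‖z‖ ^ (s - n)) =
        ENNReal.ofReal (kappa (s / b) e / |s|) * ENNReal.ofReal (c ^ (s / b)) := by
  have hval : ∫⁻ u : Metric.sphere (0 : Rn n) 1,
      ENNReal.ofReal ((c * |inner ℝ e (u : Rn n)|) ^ (s / b) / |s|)
        ∂((volume : Measure (Rn n)).toSphere) =
      ENNReal.ofReal (kappa (s / b) e / |s|) * ENNReal.ofReal (c ^ (s / b)) := by
    have h1 : ∀ u : Metric.sphere (0 : Rn n) 1,
        ENNReal.ofReal ((c * |inner ℝ e (u : Rn n)|) ^ (s / b) / |s|) =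
        ENNReal.ofReal (c ^ (s / b) / |s|) * ENNReal.ofReal (|inner ℝ e (u : Rn n)| ^ (s / b)) := by
      intro u
      rw [← ENNReal.ofReal_mul (by positivity), Real.mul_rpow hc (abs_nonneg _)]
      congr 1
      ring
    simp_rw [h1]
    rw [lintegral_const_mul' _ _ ENNReal.ofReal_ne_top, lintegral_kappa hsb he,
      ← ENNReal.ofReal_mul (by positivity), ← ENNReal.ofReal_mul
        (div_nonneg (kappa_nonneg _ _) (abs_nonneg _))]
    congr 1
    ring
  have hmem : ∀ (u : Rn n) (r : ℝ), ‖u‖ = 1 → 0 < r →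
      ‖r • u‖ = r ∧ |inner ℝ (c • e) (r • u)| = r * (c * |inner ℝ e u|) := by
    intro u r hu hr
    refine ⟨by rw [norm_smul, hu, mul_one, Real.norm_of_nonneg hr.le], ?_⟩
    rw [real_inner_smul_left, real_inner_smul_right, abs_mul, abs_mul, abs_of_nonneg hc,
      abs_of_pos hr]
    ring
  refine ⟨?_, ?_⟩
  · rw [lintegral_rpow_region hn hsb (measurableSet_limitRegion _ b)
      (a := fun u => c * |inner ℝ e u|) (fun _ => by positivity) (Or.inl ?_), hval]
    intro u r hu hr
    obtain ⟨h1, h2⟩ := hmem u r hu hr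
    rw [limitRegion, mem_ofPred_eq, h1, h2]
    exact (rpow_one_add_lt_iff hr).1
  · rw [lintegral_rpow_region hn hsb (measurableSet_limitRegionClosed _ b)
      (a := fun u => c * |inner ℝ e u|) (fun _ => by positivity) (Or.inr ?_), hval]
    intro u r hu hr
    obtain ⟨h1, h2⟩ := hmem u r hu hr
    rw [limitRegionClosed, mem_ofPred_eq, h1, h2]
    exact (rpow_one_add_lt_iff hr).2

/-- The value of the limiting integral; the direction of `v` is removed by a reflection. -/
theorem lintegral_limitRegion (hn : 1 ≤ n) {b s : ℝ} (hsb : 0 < s / b) {e : Rn n}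
    (he : ‖e‖ = 1) (v : Rn n) :
    ∫⁻ z in limitRegion v b, ENNReal.ofReal (‖z‖ ^ (s - n)) =
        ENNReal.ofReal (kappa (s / b) e / |s|) * ENNReal.ofReal (‖v‖ ^ (s / b)) ∧
      ∫⁻ z in limitRegionClosed v b, ENNReal.ofReal (‖z‖ ^ (s - n)) =
        ENNReal.ofReal (kappa (s / b) e / |s|) * ENNReal.ofReal (‖v‖ ^ (s / b)) := by
  set w : Rn n := ‖v‖ • e with hw
  have hvw : ‖v‖ = ‖w‖ := by rw [hw, norm_smul, he, mul_one, norm_norm]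
  set T := (ℝ ∙ (v - w))ᗮ.reflection with hT
  have hTv : T v = w := Submodule.reflection_sub hvw
  have hm : Measurable fun z : Rn n => ENNReal.ofReal (‖z‖ ^ (s - n)) := by fun_prop
  have hmp := T.measurePreserving
  have hinner : ∀ z, inner ℝ w (T z) = inner ℝ v z := fun z => by
    rw [← hTv, LinearIsometryEquiv.inner_map_map]
  have h := lintegral_limitRegion_aux hn hsb he (norm_nonneg v)
  constructor
  · rw [← h.1, ← hmp.setLIntegral_comp_preimage (measurableSet_limitRegion (‖v‖ • e) b) hm]
    have : T ⁻¹' limitRegion (‖v‖ • e) b = limitRegion v b := by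
      ext z
      simp only [limitRegion, mem_preimage, mem_ofPred_eq, ← hw, hinner,
        LinearIsometryEquiv.norm_map]
    rw [this]
    simp only [LinearIsometryEquiv.norm_map]
  · rw [← h.2, ← hmp.setLIntegral_comp_preimage (measurableSet_limitRegionClosed (‖v‖ • e) b) hm]
    have : T ⁻¹' limitRegionClosed (‖v‖ • e) b = limitRegionClosed v b := by
      ext z
      simp only [limitRegionClosed, mem_preimage, mem_ofPred_eq, ← hw, hinner,
        LinearIsometryEquiv.norm_map]
    rw [this]
    simp only [LinearIsometryEquiv.norm_map]

end Polar

/-! ### Power kernels and a covering estimate -/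

section Covering

variable {n : ℕ}

theorem rpow_le_of_mem_Icc {ρ r e : ℝ} (hρ : 0 < ρ) (h1 : ρ ≤ r) (h2 : r ≤ 2 * ρ) :
    ρ ^ e ≤ 2 ^ |e| * r ^ e ∧ r ^ e ≤ 2 ^ |e| * ρ ^ e := by
  have hr : 0 < r := hρ.trans_le h1
  have h2e : (1 : ℝ) ≤ 2 ^ |e| := Real.one_le_rpow (by norm_num) (abs_nonneg _)
  rcases le_total 0 e with he | he
  · constructor
    · calc ρ ^ e ≤ r ^ e := Real.rpow_le_rpow hρ.le h1 he
        _ ≤ 2 ^ |e| * r ^ e := le_mul_of_one_le_left (by positivity) h2e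
    · rw [abs_of_nonneg he, ← Real.mul_rpow (by norm_num) hρ.le]
      exact Real.rpow_le_rpow hr.le h2 he
  · constructor
    · have h3 : (2 * ρ) ^ e ≤ r ^ e := Real.rpow_le_rpow_of_nonpos hr h2 he
      rw [Real.mul_rpow (by norm_num) hρ.le] at h3
      calc ρ ^ e = 2 ^ |e| * (2 ^ e * ρ ^ e) := by
            rw [← mul_assoc, ← Real.rpow_add (by norm_num), abs_of_nonpos he, neg_add_cancel,
              Real.rpow_zero, one_mul]
        _ ≤ _ := by gcongr
    · calc r ^ e ≤ ρ ^ e := Real.rpow_le_rpow_of_nonpos hρ h1 he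
        _ ≤ 2 ^ |e| * ρ ^ e := le_mul_of_one_le_left (by positivity) h2e

/-- A power is controlled by the integral of the power one less over a dyadic interval. -/
theorem ofReal_rpow_le_setLIntegral {ρ : ℝ} (hρ : 0 < ρ) (e : ℝ) :
    ENNReal.ofReal (ρ ^ (e + 1)) ≤
      ENNReal.ofReal (2 ^ |e|) * ∫⁻ r in Ioo ρ (2 * ρ), ENNReal.ofReal (r ^ e) := by
  calc ENNReal.ofReal (ρ ^ (e + 1)) = ∫⁻ r in Ioo ρ (2 * ρ), ENNReal.ofReal (ρ ^ e) := by
        rw [setLIntegral_const, Real.volume_Ioo, ← ENNReal.ofReal_mul (by positivity),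
          Real.rpow_add hρ, Real.rpow_one]
        congr 2
        ring
    _ ≤ ∫⁻ r in Ioo ρ (2 * ρ), ENNReal.ofReal (2 ^ |e|) * ENNReal.ofReal (r ^ e) := by
        refine setLIntegral_mono' measurableSet_Ioo fun r hr => ?_
        rw [← ENNReal.ofReal_mul (by positivity)]
        exact ENNReal.ofReal_le_ofReal (rpow_le_of_mem_Icc hρ hr.1.le hr.2.le).1
    _ = _ := lintegral_const_mul' _ _ ENNReal.ofReal_ne_top

/-- Integrals of power kernels against a weight are controlled by its integrals over balls. The
kernel is written as a superposition of indicators of balls. -/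
theorem exists_kernel_le (hn : 1 ≤ n) {b : ℝ} (hb : b ≠ 0) :
    ∃ C : ℝ≥0, ∀ (w : Rn n → ℝ≥0∞), Measurable w → ∀ (y : Rn n) (a : ℝ), 0 ≤ a → ∀ M : ℝ≥0∞,
      (∀ r : ℝ, 0 < r → r ^ b < 2 ^ |b| * a →
        ∫⁻ x in Metric.ball y r, w x ≤ ENNReal.ofReal (r ^ n) * M) →
      ∫⁻ x in {x | ‖x - y‖ ^ b < a}, ENNReal.ofReal (‖x - y‖ ^ (b - n)) * w x ≤
        C * ENNReal.ofReal a * M := by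
  have := nontrivial_Rn hn
  set e : ℝ := b - n - 1 with he
  refine ⟨Real.toNNReal (2 ^ |e| * (2 ^ |b| / |b|)), fun w hw y a ha M hM => ?_⟩
  set T : Set ℝ := {r : ℝ | 0 < r ∧ r ^ b < 2 ^ |b| * a} with hT
  have hpow : Measurable fun r : ℝ => r ^ b := by fun_prop
  have hTm : MeasurableSet T := (measurableSet_lt measurable_const measurable_id).inter
    (measurableSet_lt hpow measurable_const)
  have hAm : MeasurableSet {x : Rn n | ‖x - y‖ ^ b < a} :=
    measurableSet_lt (by fun_prop) measurable_const
  have hpt : ∀ x : Rn n, x ≠ y → ‖x - y‖ ^ b < a →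
      ENNReal.ofReal (‖x - y‖ ^ (b - n)) * w x ≤ ENNReal.ofReal (2 ^ |e|) *
        ∫⁻ r in T, ENNReal.ofReal (r ^ e) * (Metric.ball y r).indicator w x := by
    intro x hxy hx
    have hρ : 0 < ‖x - y‖ := by rwa [norm_pos_iff, sub_ne_zero]
    have h1 := ofReal_rpow_le_setLIntegral hρ e
    rw [he, sub_add_cancel, ← he] at h1
    calc ENNReal.ofReal (‖x - y‖ ^ (b - n)) * w x
        ≤ ENNReal.ofReal (2 ^ |e|) * (∫⁻ r in Ioo ‖x - y‖ (2 * ‖x - y‖), ENNReal.ofReal (r ^ e)) * w x := by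
          gcongr
      _ = ENNReal.ofReal (2 ^ |e|) * ∫⁻ r in Ioo ‖x - y‖ (2 * ‖x - y‖),
            ENNReal.ofReal (r ^ e) * w x := by
          rw [mul_assoc, lintegral_mul_const _ (by fun_prop)]
      _ ≤ ENNReal.ofReal (2 ^ |e|) * ∫⁻ r in Ioo ‖x - y‖ (2 * ‖x - y‖),
            ENNReal.ofReal (r ^ e) * (Metric.ball y r).indicator w x := by
          refine mul_le_mul_right ?_ _
          refine setLIntegral_mono' measurableSet_Ioo fun r hr => ?_
          rw [indicator_of_mem]
          rw [mem_ball_iff_norm]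
          exact hr.1
      _ ≤ _ := by
          refine mul_le_mul_right ?_ _
          refine lintegral_mono_set fun r hr => ⟨hρ.trans hr.1, ?_⟩
          have h2b : (0 : ℝ) < 2 ^ |b| := by positivity
          exact (rpow_le_of_mem_Icc hρ hr.1.le hr.2.le).2.trans_lt
            (mul_lt_mul_of_pos_left hx h2b)
  have hmeas : Measurable fun p : Rn n × ℝ =>
      ENNReal.ofReal (p.2 ^ e) * (Metric.ball y p.2).indicator w p.1 := by
    have h1 : Measurable fun p : Rn n × ℝ =>
        {p : Rn n × ℝ | dist p.1 y < p.2}.indicator (fun p => w p.1) p :=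
      (hw.comp measurable_fst).indicator (measurableSet_lt (by fun_prop) measurable_snd)
    have h2 : (fun p : Rn n × ℝ => (Metric.ball y p.2).indicator w p.1) = fun p : Rn n × ℝ =>
        {p : Rn n × ℝ | dist p.1 y < p.2}.indicator (fun p => w p.1) p := by
      ext p
      simp [indicator, Metric.mem_ball]
    exact (by fun_prop : Measurable fun p : Rn n × ℝ => ENNReal.ofReal (p.2 ^ e)).mul (h2 ▸ h1)
  calc ∫⁻ x in {x | ‖x - y‖ ^ b < a}, ENNReal.ofReal (‖x - y‖ ^ (b - n)) * w x
      ≤ ∫⁻ x in {x | ‖x - y‖ ^ b < a}, ENNReal.ofReal (2 ^ |e|) *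
        ∫⁻ r in T, ENNReal.ofReal (r ^ e) * (Metric.ball y r).indicator w x := by
        refine lintegral_mono_ae ?_
        have hne : ∀ᵐ x ∂(volume : Measure (Rn n)), x ≠ y := by
          simp [ae_iff]
        filter_upwards [ae_restrict_mem hAm, ae_restrict_of_ae hne] with x hx hxy using hpt x hxy hx
    _ ≤ ENNReal.ofReal (2 ^ |e|) * ∫⁻ x, ∫⁻ r in T,
        ENNReal.ofReal (r ^ e) * (Metric.ball y r).indicator w x := by
        rw [lintegral_const_mul' _ _ ENNReal.ofReal_ne_top]
        gcongr
        exact Measure.restrict_le_self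
    _ = ENNReal.ofReal (2 ^ |e|) * ∫⁻ r in T, ENNReal.ofReal (r ^ e) *
        ∫⁻ x in Metric.ball y r, w x := by
        rw [lintegral_lintegral_swap hmeas.aemeasurable]
        congr 1
        refine lintegral_congr fun r => ?_
        rw [lintegral_const_mul' _ _ ENNReal.ofReal_ne_top, lintegral_indicator measurableSet_ball]
    _ ≤ ENNReal.ofReal (2 ^ |e|) * ∫⁻ r in T, ENNReal.ofReal (r ^ (b - 1)) * M := by
        refine mul_le_mul_right ?_ _
        refine setLIntegral_mono' hTm fun r hr => ?_
        have hr0 : 0 < r := hr.1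
        calc _ ≤ ENNReal.ofReal (r ^ e) * (ENNReal.ofReal (r ^ n) * M) := by
              gcongr; exact hM r hr.1 hr.2
          _ = _ := by
              rw [← mul_assoc, ← ENNReal.ofReal_mul (by positivity), ← Real.rpow_natCast,
                ← Real.rpow_add hr0]
              congr 3
              rw [he]
              ring
    _ = _ := by
        have h1 := (lintegral_rpow_level (b := b) (s := b) (a := 2 ^ |b| * a)
          (by rw [div_self hb]; exact one_pos) (by positivity)).1
        rw [div_self hb, Real.rpow_one] at h1
        rw [lintegral_mul_const _ (by fun_prop), h1, ← mul_assoc,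
          ← ENNReal.ofReal_mul (by positivity)]
        change _ = ENNReal.ofReal (2 ^ |e| * (2 ^ |b| / |b|)) * ENNReal.ofReal a * M
        rw [← ENNReal.ofReal_mul (by positivity)]
        congr 2
        ring

/-- Geometric series: the sum of the powers `2^{lb}` not exceeding `a` is bounded by a multiple
of `a`. -/
theorem exists_tsum_dyadic_le {b : ℝ} (hb : b ≠ 0) :
    ∃ C : ℝ≥0, ∀ a : ℝ, 0 ≤ a →
      ∑' l : ℤ, (if ((2 : ℝ) ^ l) ^ b ≤ a then ENNReal.ofReal (((2 : ℝ) ^ l) ^ b) else 0) ≤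
        C * ENNReal.ofReal a := by
  refine ⟨Real.toNNReal (2 ^ |b - 1| * (2 ^ |b| / |b|)), fun a ha => ?_⟩
  set T : Set ℝ := {r : ℝ | 0 < r ∧ r ^ b ≤ 2 ^ |b| * a} with hT
  have hle : ∀ l : ℤ, (if ((2 : ℝ) ^ l) ^ b ≤ a then ENNReal.ofReal (((2 : ℝ) ^ l) ^ b) else 0) ≤
      ENNReal.ofReal (2 ^ |b - 1|) *
        ∫⁻ r in Ioo ((2 : ℝ) ^ l) (2 ^ (l + 1)) ∩ T, ENNReal.ofReal (r ^ (b - 1)) := by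
    intro l
    have h2l : (0 : ℝ) < 2 ^ l := by positivity
    have h2l' : (2 : ℝ) ^ (l + 1) = 2 * 2 ^ l := by rw [zpow_add_one₀ two_ne_zero, mul_comm]
    split_ifs with h
    · have h1 := ofReal_rpow_le_setLIntegral h2l (b - 1)
      rw [sub_add_cancel] at h1
      refine h1.trans ?_
      rw [h2l']
      have hsub : Ioo ((2 : ℝ) ^ l) (2 * 2 ^ l) ⊆ Ioo ((2 : ℝ) ^ l) (2 * 2 ^ l) ∩ T := fun r hr =>
        ⟨hr, h2l.trans hr.1, (rpow_le_of_mem_Icc h2l hr.1.le hr.2.le).2.trans (by gcongr)⟩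
      exact mul_le_mul_right (lintegral_mono_set hsub) _
    · exact zero_le
  refine (ENNReal.tsum_le_tsum hle).trans ?_
  have hpow : Measurable fun r : ℝ => r ^ b := by fun_prop
  have hTm : MeasurableSet T := (measurableSet_lt measurable_const measurable_id).inter
    (measurableSet_le hpow measurable_const)
  rw [ENNReal.tsum_mul_left, ← lintegral_iUnion (fun l => measurableSet_Ioo.inter hTm)]
  · have h1 := (lintegral_rpow_level (b := b) (s := b) (a := 2 ^ |b| * a)
          (by rw [div_self hb]; exact one_pos) (by positivity)).2
    rw [div_self hb, Real.rpow_one] at h1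
    calc _ ≤ ENNReal.ofReal (2 ^ |b - 1|) * ∫⁻ r in T, ENNReal.ofReal (r ^ (b - 1)) := by
          refine mul_le_mul_right ?_ _
          exact lintegral_mono_set (iUnion_subset fun l => inter_subset_right)
      _ = _ := by
          rw [h1]
          change _ = ENNReal.ofReal (2 ^ |b - 1| * (2 ^ |b| / |b|)) * ENNReal.ofReal a
          rw [← ENNReal.ofReal_mul (by positivity), ← ENNReal.ofReal_mul (by positivity)]
          congr 1
          ring
  · have hd : ∀ i j : ℤ, i < j →
        Disjoint (Ioo ((2 : ℝ) ^ i) (2 ^ (i + 1))) (Ioo ((2 : ℝ) ^ j) (2 ^ (j + 1))) := by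
      intro i j hij
      rw [Set.disjoint_left]
      intro r hr hr'
      have : (2 : ℝ) ^ (i + 1) ≤ 2 ^ j := zpow_le_zpow_right₀ (by norm_num) hij
      exact absurd (hr.2.trans_le this) hr'.1.not_gt
    intro i j hij
    refine Disjoint.mono inter_subset_left inter_subset_left ?_
    rcases lt_or_gt_of_ne hij with h | h
    · exact hd i j h
    · exact (hd j i h).symm

end Covering

section CoveringSum

variable {n : ℕ}

/-- For `b > 0` the kernel is a multiple of the indicator of a ball, since only radii comparable to `r`
and smaller are involved. -/
theorem exists_radial_majorant_of_pos {b : ℝ} (hb : 0 < b) :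
    ∃ C : ℝ≥0, ∀ (w : Rn n → ℝ≥0∞), Measurable w → ∀ (y : Rn n) (r : ℝ), 0 < r → ∀ M : ℝ≥0∞,
      (∀ ρ : ℝ, r ≤ ρ → ∫⁻ x in Metric.ball y ρ, w x ≤ ENNReal.ofReal (ρ ^ n) * M) →
      ∃ K : Rn n → ℝ≥0∞, Measurable K ∧
        (∀ (x : Rn n) (s : ℝ), 0 < s → s ^ b ≤ 2 * r ^ b → dist x y < s + r →
          ENNReal.ofReal (s ^ b) ≤ K x) ∧
        ∫⁻ x, K x * w x ≤ C * ENNReal.ofReal (r ^ b * r ^ n) * M := by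
  set κ : ℝ := 2 ^ (1 / b) + 1 with hκ
  have hκ1 : 1 ≤ κ := by
    have : (0 : ℝ) ≤ 2 ^ (1 / b) := by positivity
    linarith
  have hκ0 : 0 < κ := by linarith
  refine ⟨Real.toNNReal (2 * κ ^ n), fun w hw y r hr M hM =>
    ⟨(Metric.ball y (κ * r)).indicator fun _ => ENNReal.ofReal (2 * r ^ b),
      measurable_const.indicator measurableSet_ball, fun x s hs hsr hd => ?_, ?_⟩⟩
  · rw [indicator_of_mem]
    · exact ENNReal.ofReal_le_ofReal hsr
    · have h1 : s ≤ 2 ^ (1 / b) * r := by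
        have h2 : (s ^ b) ^ (1 / b) ≤ (2 * r ^ b) ^ (1 / b) :=
          Real.rpow_le_rpow (by positivity) hsr (by positivity)
        rwa [Real.mul_rpow (by norm_num) (by positivity), ← Real.rpow_mul hs.le,
          ← Real.rpow_mul hr.le, mul_one_div_cancel hb.ne', Real.rpow_one, Real.rpow_one] at h2
      rw [Metric.mem_ball, hκ]
      linarith
  · have h1 : ∀ x, (Metric.ball y (κ * r)).indicator (fun _ => ENNReal.ofReal (2 * r ^ b)) x * w x =
        (Metric.ball y (κ * r)).indicator (fun x => ENNReal.ofReal (2 * r ^ b) * w x) x := fun x => by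
      by_cases hx : x ∈ Metric.ball y (κ * r) <;> simp [hx]
    rw [lintegral_congr h1, lintegral_indicator measurableSet_ball,
      lintegral_const_mul' _ _ ENNReal.ofReal_ne_top]
    calc _ ≤ ENNReal.ofReal (2 * r ^ b) * (ENNReal.ofReal ((κ * r) ^ n) * M) := by
          gcongr
          exact hM _ (le_mul_of_one_le_left hr.le hκ1)
      _ = _ := by
          change _ = ENNReal.ofReal (2 * κ ^ n) * _ * M
          rw [← mul_assoc, ← ENNReal.ofReal_mul (by positivity), ← ENNReal.ofReal_mul (by positivity),
            mul_pow]
          congr 2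
          ring

/-- For `b < -n` the kernel is a multiple of the indicator of a ball plus a decreasing power of the
distance, integrable at infinity against a weight with bounded averages. -/
theorem exists_radial_majorant_of_lt (hn : 1 ≤ n) {b : ℝ} (hb : b < -n) :
    ∃ C : ℝ≥0, ∀ (w : Rn n → ℝ≥0∞), Measurable w → ∀ (y : Rn n) (r : ℝ), 0 < r → ∀ M : ℝ≥0∞,
      (∀ ρ : ℝ, r ≤ ρ → ∫⁻ x in Metric.ball y ρ, w x ≤ ENNReal.ofReal (ρ ^ n) * M) →
      ∃ K : Rn n → ℝ≥0∞, Measurable K ∧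
        (∀ (x : Rn n) (s : ℝ), 0 < s → s ^ b ≤ 2 * r ^ b → dist x y < s + r →
          ENNReal.ofReal (s ^ b) ≤ K x) ∧
        ∫⁻ x, K x * w x ≤ C * ENNReal.ofReal (r ^ b * r ^ n) * M := by
  have hbn : b + n < 0 := by linarith
  have hb0 : b < 0 := hb.trans_le (by simp)
  obtain ⟨C, hC⟩ := exists_kernel_le hn hbn.ne
  refine ⟨Real.toNNReal (2 * 3 ^ n) + Real.toNNReal (2 ^ (-b)) * C * Real.toNNReal (2 ^ (b + n)),
    fun w hw y r hr M hM => ?_⟩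
  have hAm : MeasurableSet {x : Rn n | ‖x - y‖ ^ (b + n) < (2 * r) ^ (b + n)} :=
    measurableSet_lt (by fun_prop) measurable_const
  set A := {x : Rn n | ‖x - y‖ ^ (b + n) < (2 * r) ^ (b + n)} with hA
  refine ⟨fun x => (Metric.ball y (3 * r)).indicator (fun _ => ENNReal.ofReal (2 * r ^ b)) x +
      A.indicator (fun x => ENNReal.ofReal (2 ^ (-b)) * ENNReal.ofReal (‖x - y‖ ^ b)) x,
    (measurable_const.indicator measurableSet_ball).add (Measurable.indicator (by fun_prop) hAm),
    fun x s hs hsr hd => ?_, ?_⟩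
  · beta_reduce
    rcases lt_or_ge (dist x y) (3 * r) with h | h
    · rw [indicator_of_mem (Metric.mem_ball.2 h)]
      exact (ENNReal.ofReal_le_ofReal hsr).trans le_self_add
    · rw [dist_eq_norm] at h hd
      have h0 : 0 < ‖x - y‖ := by linarith
      have hxA : x ∈ A :=
        Real.rpow_lt_rpow_of_neg (by positivity) (by linarith) hbn
      rw [indicator_of_mem hxA]
      refine le_trans ?_ le_add_self
      rw [← ENNReal.ofReal_mul (by positivity)]
      refine ENNReal.ofReal_le_ofReal ?_
      calc s ^ b ≤ (‖x - y‖ / 2) ^ b :=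
            Real.rpow_le_rpow_of_nonpos (by positivity) (by linarith) hb0.le
        _ = _ := by
            rw [Real.div_rpow h0.le (by norm_num), Real.rpow_neg (by norm_num), div_eq_inv_mul]
  · have h1 : ∀ x, ((Metric.ball y (3 * r)).indicator (fun _ => ENNReal.ofReal (2 * r ^ b)) x +
        A.indicator (fun x => ENNReal.ofReal (2 ^ (-b)) * ENNReal.ofReal (‖x - y‖ ^ b)) x) * w x =
        (Metric.ball y (3 * r)).indicator (fun x => ENNReal.ofReal (2 * r ^ b) * w x) x +
        A.indicator (fun x => ENNReal.ofReal (2 ^ (-b)) *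
          (ENNReal.ofReal (‖x - y‖ ^ b) * w x)) x := fun x => by
      by_cases hx : x ∈ Metric.ball y (3 * r) <;> by_cases hx' : x ∈ A <;>
        simp [hx, hx', add_mul, mul_assoc]
    have h2 := hC w hw y ((2 * r) ^ (b + n)) (by positivity) M (fun ρ hρ hρr => hM ρ ?_)
    · rw [add_sub_cancel_right] at h2
      have h3 : Measurable ((Metric.ball y (3 * r)).indicator
          (fun x => ENNReal.ofReal (2 * r ^ b) * w x)) :=
        (hw.const_mul _).indicator measurableSet_ball
      rw [lintegral_congr h1, lintegral_add_left h3, lintegral_indicator measurableSet_ball,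
        lintegral_indicator hAm,
        lintegral_const_mul' _ _ ENNReal.ofReal_ne_top, lintegral_const_mul' _ _ ENNReal.ofReal_ne_top]
      calc _ ≤ ENNReal.ofReal (2 * r ^ b) * (ENNReal.ofReal ((3 * r) ^ n) * M) +
            ENNReal.ofReal (2 ^ (-b)) * (C * ENNReal.ofReal ((2 * r) ^ (b + n)) * M) := by
            gcongr
            exact hM _ (by linarith)
        _ = _ := by
            push_cast
            rw [add_mul, add_mul]
            congr 1
            · change _ = ENNReal.ofReal (2 * 3 ^ n) * _ * M
              rw [← mul_assoc, ← ENNReal.ofReal_mul (by positivity),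
                ← ENNReal.ofReal_mul (by positivity)]
              congr 2
              ring
            · change _ = ENNReal.ofReal (2 ^ (-b)) * C * ENNReal.ofReal (2 ^ (b + n)) * _ * M
              rw [Real.mul_rpow (by norm_num) hr.le, ENNReal.ofReal_mul (by positivity),
                Real.rpow_add hr, Real.rpow_natCast]
              ring
    · by_contra! hlt
      have h3 : r ^ (b + n) ≤ ρ ^ (b + n) := Real.rpow_le_rpow_of_nonpos hρ hlt.le hbn.le
      rw [Real.mul_rpow (by norm_num) hr.le, ← mul_assoc, abs_of_neg hbn,
        ← Real.rpow_add (by norm_num), neg_add_cancel, Real.rpow_zero, one_mul] at hρr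
      exact absurd h3 hρr.not_ge

/-- A single kernel dominates the powers `s ^ b` of the radii of all balls that meet a given ball
and are not much larger, where size is measured by `s ^ b`. -/
theorem exists_radial_majorant (hn : 1 ≤ n) {b : ℝ} (hb : 0 < b ∨ b < -n) :
    ∃ C : ℝ≥0, ∀ (w : Rn n → ℝ≥0∞), Measurable w → ∀ (y : Rn n) (r : ℝ), 0 < r → ∀ M : ℝ≥0∞,
      (∀ ρ : ℝ, r ≤ ρ → ∫⁻ x in Metric.ball y ρ, w x ≤ ENNReal.ofReal (ρ ^ n) * M) →
      ∃ K : Rn n → ℝ≥0∞, Measurable K ∧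
        (∀ (x : Rn n) (s : ℝ), 0 < s → s ^ b ≤ 2 * r ^ b → dist x y < s + r →
          ENNReal.ofReal (s ^ b) ≤ K x) ∧
        ∫⁻ x, K x * w x ≤ C * ENNReal.ofReal (r ^ b * r ^ n) * M :=
  hb.elim exists_radial_majorant_of_pos (exists_radial_majorant_of_lt hn)

theorem setLIntegral_ball_le_iInf_maximal (w : Rn n → ℝ≥0∞) (y : Rn n) {r ρ : ℝ} (hr : 0 < r)
    (hρ : r ≤ ρ) : ∫⁻ x in Metric.ball y ρ, w x ≤ ENNReal.ofReal (ρ ^ n) *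
      (volume (Metric.ball (0 : Rn n) 1) * ⨅ z ∈ Metric.ball y r, maximal w z) := by
  have hρ0 := hr.trans_le hρ
  rw [setLIntegral_ball_eq _ _ hρ0, volume_ball_eq _ hρ0, mul_assoc]
  gcongr
  exact le_iInf₂ fun z hz => laverage_le_maximal w hρ0 (Metric.ball_subset_ball hρ hz)

/-- The covering estimate for finitely many scales and a selection of a bad scale at each bad
point. -/
theorem exists_lintegral_selection_le (hn : 1 ≤ n) {b : ℝ} (hb : 0 < b ∨ b < -n) :
    ∃ C : ℝ≥0, ∀ (g w : Rn n → ℝ≥0∞), Measurable g → Measurable w → ∀ (Λ : ℝ≥0∞)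
      (t : Set (Rn n)) (ρ : Rn n → ℝ) (R : ℝ), (∀ x ∈ t, 0 < ρ x) → (∀ x ∈ t, ρ x ^ b ≤ R) →
      (∀ x ∈ t, Λ * ENNReal.ofReal (ρ x ^ b) < ballAverage (ρ x) g x) →
      ∀ Φ : Rn n → ℝ≥0∞, (∀ x, x ∉ t → Φ x = 0) →
        (∀ x ∈ t, Φ x ≤ ENNReal.ofReal (ρ x ^ b)) →
        Λ * ∫⁻ x, Φ x * w x ≤ C * ∫⁻ x, g x * maximal w x := by
  obtain ⟨C, hC⟩ := exists_radial_majorant hn hb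
  refine ⟨C, fun g w hg hw Λ t ρ R hρ hR hbad Φ hΦ0 hΦ => ?_⟩
  obtain ⟨u, hut, hdisj, hcov⟩ := Vitali.exists_disjoint_subfamily_covering_enlargement
    (fun x : Rn n => Metric.ball x (ρ x)) t (fun x => ρ x ^ b) 2 one_lt_two
    (fun x hx => Real.rpow_nonneg (hρ x hx).le _) R hR
    (fun x hx => ⟨x, Metric.mem_ball_self (hρ x hx)⟩)
  have hucount : u.Countable := hdisj.countable_of_isOpen (fun _ _ => Metric.isOpen_ball)
    (fun x hx => ⟨x, Metric.mem_ball_self (hρ x (hut hx))⟩)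
  have := hucount.to_subtype
  set M : Rn n → ℝ≥0∞ := fun y =>
    volume (Metric.ball (0 : Rn n) 1) * ⨅ z ∈ Metric.ball y (ρ y), maximal w z with hM
  choose! K hKm hKx hKi using fun (y : u) => hC w hw y (ρ y) (hρ y (hut y.2)) (M y)
    (fun s hs => setLIntegral_ball_le_iInf_maximal w y (hρ y (hut y.2)) hs)
  have hpt : ∀ x, Φ x * w x ≤ ∑' y : u, K y x * w x := by
    intro x
    by_cases hx : x ∈ t
    · obtain ⟨y, hyu, ⟨z, hzx, hzy⟩, hδ⟩ := hcov x hx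
      have hd : dist x y < ρ x + ρ y := by
        rw [Metric.mem_ball] at hzx hzy
        linarith [dist_triangle_left x y z]
      refine le_trans ?_ (ENNReal.le_tsum (⟨y, hyu⟩ : u))
      gcongr
      exact (hΦ x hx).trans (hKx ⟨y, hyu⟩ x (ρ x) (hρ x hx) hδ hd)
    · rw [hΦ0 x hx, zero_mul]
      exact zero_le
  have hKw : ∀ y : u, AEMeasurable (fun x => K y x * w x) volume := fun y =>
    ((hKm y).mul hw).aemeasurable
  calc Λ * ∫⁻ x, Φ x * w x ≤ Λ * ∑' y : u, ∫⁻ x, K y x * w x := by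
        rw [← lintegral_tsum hKw]
        gcongr
        exact hpt _
    _ ≤ ∑' y : u, C * ∫⁻ x in Metric.ball (y : Rn n) (ρ y), g x * maximal w x := by
        rw [← ENNReal.tsum_mul_left]
        refine ENNReal.tsum_le_tsum fun y => ?_
        have hy := hρ y (hut y.2)
        have hb1 : Λ * ENNReal.ofReal (ρ y ^ b) *
            (ENNReal.ofReal (ρ y ^ n) * volume (Metric.ball (0 : Rn n) 1)) ≤
            ∫⁻ x in Metric.ball (y : Rn n) (ρ y), g x := by
          rw [setLIntegral_ball_eq _ _ hy, volume_ball_eq _ hy, mul_comm]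
          gcongr
          exact (hbad y (hut y.2)).le
        calc Λ * ∫⁻ x, K y x * w x ≤ Λ * (C * ENNReal.ofReal (ρ y ^ b * ρ y ^ n) * M y) := by
              gcongr; exact hKi y
          _ = C * (Λ * ENNReal.ofReal (ρ y ^ b) *
            (ENNReal.ofReal (ρ y ^ n) * volume (Metric.ball (0 : Rn n) 1)) *
              ⨅ z ∈ Metric.ball (y : Rn n) (ρ y), maximal w z) := by
              rw [hM, ENNReal.ofReal_mul (by positivity)]
              ring
          _ ≤ C * ((∫⁻ x in Metric.ball (y : Rn n) (ρ y), g x) *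
              ⨅ z ∈ Metric.ball (y : Rn n) (ρ y), maximal w z) := by gcongr
          _ ≤ _ := by
              gcongr
              rw [← lintegral_mul_const _ hg]
              refine setLIntegral_mono' measurableSet_ball fun x hx => ?_
              gcongr
              exact iInf₂_le x hx
    _ = C * ∫⁻ x in ⋃ y : u, Metric.ball (y : Rn n) (ρ y), g x * maximal w x := by
        rw [ENNReal.tsum_mul_left, lintegral_iUnion (fun _ => measurableSet_ball)]
        exact hdisj.subtype _ _
    _ ≤ _ := by gcongr; exact Measure.restrict_le_self

/-- The covering estimate: a weighted count of the dyadic scales at which the averages of `g` are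
large. -/
theorem exists_tsum_covering_le (hn : 1 ≤ n) {b : ℝ} (hb : 0 < b ∨ b < -n) :
    ∃ C : ℝ≥0, ∀ (g w : Rn n → ℝ≥0∞), Measurable g → Measurable w → ∀ Λ : ℝ≥0∞,
      ∑' l : ℤ, ENNReal.ofReal (((2 : ℝ) ^ l) ^ b) * Λ *
        ∫⁻ x in {x | Λ * ENNReal.ofReal (((2 : ℝ) ^ l) ^ b) < ballAverage (2 ^ l) g x}, w x ≤
      C * ∫⁻ x, g x * maximal w x := by
  have hb0 : b ≠ 0 := by
    rcases hb with h | h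
    · exact h.ne'
    · exact (h.trans_le (by simp)).ne
  obtain ⟨C₀, hC₀⟩ := exists_tsum_dyadic_le hb0
  obtain ⟨C, hC⟩ := exists_lintegral_selection_le hn hb
  refine ⟨C₀ * C, fun g w hg hw Λ => ?_⟩
  set A : ℤ → Set (Rn n) := fun l =>
    {x | Λ * ENNReal.ofReal (((2 : ℝ) ^ l) ^ b) < ballAverage (2 ^ l) g x} with hA
  have hAm : ∀ l, MeasurableSet (A l) := fun l =>
    measurableSet_lt measurable_const (measurable_ballAverage hg _)
  rw [ENNReal.tsum_eq_iSup_sum]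
  refine iSup_le fun F => ?_
  have hsel : ∀ x, ∃ l : ℤ, (∃ m ∈ F, x ∈ A m) → l ∈ F ∧ x ∈ A l ∧
      ∀ m ∈ F, x ∈ A m → ((2 : ℝ) ^ m) ^ b ≤ ((2 : ℝ) ^ l) ^ b := by
    intro x
    classical
    by_cases h : ∃ m ∈ F, x ∈ A m
    · obtain ⟨m, hm, hxm⟩ := h
      obtain ⟨l, hl, hmax⟩ := Finset.exists_max_image (F.filter fun m => x ∈ A m)
        (fun m : ℤ => ((2 : ℝ) ^ m) ^ b) ⟨m, Finset.mem_filter.2 ⟨hm, hxm⟩⟩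
      rw [Finset.mem_filter] at hl
      exact ⟨l, fun _ => ⟨hl.1, hl.2, fun m hm hxm => hmax m (Finset.mem_filter.2 ⟨hm, hxm⟩)⟩⟩
    · exact ⟨0, fun h' => absurd h' h⟩
  choose l hl using hsel
  set Φ : Rn n → ℝ≥0∞ := fun x => ∑ m ∈ F, (A m).indicator
    (fun _ => ENNReal.ofReal (((2 : ℝ) ^ m) ^ b)) x with hΦ
  have hΦle : ∀ x, (∃ m ∈ F, x ∈ A m) → Φ x ≤ C₀ * ENNReal.ofReal (((2 : ℝ) ^ l x) ^ b) := by
    intro x hx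
    refine le_trans ?_ (hC₀ (((2 : ℝ) ^ l x) ^ b) (by positivity))
    refine le_trans (Finset.sum_le_sum fun m hm => ?_) (ENNReal.sum_le_tsum F)
    by_cases hxm : x ∈ A m
    · rw [indicator_of_mem hxm, if_pos ((hl x hx).2.2 m hm hxm)]
    · rw [indicator_of_notMem hxm]
      exact zero_le
  obtain ⟨R, hR⟩ : ∃ R : ℝ, ∀ m ∈ F, ((2 : ℝ) ^ m) ^ b ≤ R := by
    refine ⟨∑ m ∈ F, ((2 : ℝ) ^ m) ^ b, fun m hm => ?_⟩
    exact Finset.single_le_sum (f := fun m : ℤ => ((2 : ℝ) ^ m) ^ b)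
      (fun i _ => by positivity) hm
  have h1 := hC g w hg hw Λ {x | ∃ m ∈ F, x ∈ A m} (fun x => 2 ^ l x) R
    (fun x _ => by positivity) (fun x hx => hR _ (hl x hx).1) (fun x hx => (hl x hx).2.1)
    ({x | ∃ m ∈ F, x ∈ A m}.indicator fun x => ENNReal.ofReal (((2 : ℝ) ^ l x) ^ b))
    (fun x hx => indicator_of_notMem hx _) (fun x hx => (indicator_of_mem hx _).le)
  have hΦle' : ∀ x, Φ x ≤ C₀ * ({x | ∃ m ∈ F, x ∈ A m}.indicator
      fun x => ENNReal.ofReal (((2 : ℝ) ^ l x) ^ b)) x := by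
    intro x
    by_cases hx : x ∈ {x | ∃ m ∈ F, x ∈ A m}
    · rw [indicator_of_mem hx]
      exact hΦle x hx
    · have : Φ x = 0 := Finset.sum_eq_zero fun m hm => by
        rw [indicator_of_notMem]
        exact fun h => hx ⟨m, hm, h⟩
      rw [this]
      exact zero_le
  calc ∑ m ∈ F, ENNReal.ofReal (((2 : ℝ) ^ m) ^ b) * Λ * ∫⁻ x in A m, w x
      = Λ * ∫⁻ x, Φ x * w x := by
        have h2 : ∀ x, Φ x * w x = ∑ m ∈ F, (A m).indicator
            (fun x => ENNReal.ofReal (((2 : ℝ) ^ m) ^ b) * w x) x := fun x => by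
          rw [hΦ, Finset.sum_mul]
          refine Finset.sum_congr rfl fun m _ => ?_
          by_cases hx : x ∈ A m <;> simp [hx]
        rw [lintegral_congr h2, lintegral_finsetSum _ fun m _ => (hw.const_mul _).indicator (hAm m),
          Finset.mul_sum]
        refine Finset.sum_congr rfl fun m _ => ?_
        rw [lintegral_indicator (hAm m), lintegral_const_mul' _ _ ENNReal.ofReal_ne_top]
        ring
    _ ≤ C₀ * (Λ * ∫⁻ x, ({x | ∃ m ∈ F, x ∈ A m}.indicator
          fun x => ENNReal.ofReal (((2 : ℝ) ^ l x) ^ b)) x * w x) := by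
        rw [mul_left_comm, ← lintegral_const_mul' _ _ ENNReal.coe_ne_top]
        refine mul_le_mul_right (lintegral_mono fun x => ?_) _
        rw [← mul_assoc]
        exact mul_le_mul_left (hΦle' x) _
    _ ≤ C₀ * (C * ∫⁻ x, g x * maximal w x) := by gcongr
    _ = _ := by push_cast; ring

end CoveringSum

/-! ### Kernel integrals over sets of pairs -/

section KernelInt

variable {n : ℕ}

/-- The integral of `|x - y| ^ (s - n)` over the section at `x` of a set `E` of pairs. -/
noncomputable def kernelInt (s : ℝ) (E : Set (Rn n × Rn n)) (x : Rn n) : ℝ≥0∞ :=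
  ∫⁻ y, E.indicator (fun z => ENNReal.ofReal (‖z.1 - z.2‖ ^ (s - (n : ℝ)))) (x, y)

theorem kernelInt_le_of_ae {s : ℝ} {E F : Set (Rn n × Rn n)} {x : Rn n}
    (h : ∀ᵐ y ∂(volume : Measure (Rn n)), (x, y) ∈ E → (x, y) ∈ F) :
    kernelInt s E x ≤ kernelInt s F x := by
  refine lintegral_mono_ae ?_
  filter_upwards [h] with y hy
  by_cases hE : (x, y) ∈ E
  · rw [indicator_of_mem hE, indicator_of_mem (hy hE)]
  · rw [indicator_of_notMem hE]
    exact zero_le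

theorem kernelInt_mono {s : ℝ} {E F : Set (Rn n × Rn n)} (h : E ⊆ F) (x : Rn n) :
    kernelInt s E x ≤ kernelInt s F x :=
  kernelInt_le_of_ae (ae_of_all _ fun _ hy => h hy)

theorem measurable_indicator_kernel {s : ℝ} {E : Set (Rn n × Rn n)} (hE : MeasurableSet E) :
    Measurable (E.indicator (fun z : Rn n × Rn n => ENNReal.ofReal (‖z.1 - z.2‖ ^ (s - (n : ℝ))))) :=
  Measurable.indicator (by fun_prop) hE

theorem measurable_kernelInt {s : ℝ} {E : Set (Rn n × Rn n)} (hE : MeasurableSet E) :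
    Measurable (kernelInt s E) :=
  (measurable_indicator_kernel hE).lintegral_prod_right'

theorem kernelInt_iUnion_le {ι : Type*} [Countable ι] {s : ℝ} {E : ι → Set (Rn n × Rn n)}
    (hE : ∀ i, MeasurableSet (E i)) (x : Rn n) :
    kernelInt s (⋃ i, E i) x ≤ ∑' i, kernelInt s (E i) x := by
  have hm : ∀ i, AEMeasurable (fun y => (E i).indicator
      (fun z : Rn n × Rn n => ENNReal.ofReal (‖z.1 - z.2‖ ^ (s - (n : ℝ)))) (x, y)) volume := fun i =>
    ((measurable_indicator_kernel (hE i)).comp measurable_prodMk_left).aemeasurable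
  unfold kernelInt
  rw [← lintegral_tsum hm]
  refine lintegral_mono fun y => ?_
  by_cases h : (x, y) ∈ ⋃ i, E i
  · obtain ⟨i, hi⟩ := mem_iUnion.1 h
    rw [indicator_of_mem h]
    refine le_trans ?_ (ENNReal.le_tsum i)
    rw [indicator_of_mem hi]
  · rw [indicator_of_notMem h]
    exact zero_le

theorem kernelInt_union_le {s : ℝ} {E F : Set (Rn n × Rn n)} (hE : MeasurableSet E) (x : Rn n) :
    kernelInt s (E ∪ F) x ≤ kernelInt s E x + kernelInt s F x := by
  unfold kernelInt
  have hm : Measurable fun y => E.indicator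
      (fun z : Rn n × Rn n => ENNReal.ofReal (‖z.1 - z.2‖ ^ (s - (n : ℝ)))) (x, y) :=
    (measurable_indicator_kernel hE).comp measurable_prodMk_left
  rw [← lintegral_add_left hm]
  refine lintegral_mono fun y => ?_
  by_cases h : (x, y) ∈ E
  · rw [indicator_of_mem h, indicator_of_mem (mem_union_left _ h)]
    exact le_self_add
  · by_cases h' : (x, y) ∈ F
    · rw [indicator_of_mem h', indicator_of_mem (mem_union_right _ h')]
      exact le_add_self
    · rw [indicator_of_notMem (by simp [h, h'])]
      exact zero_le

theorem rpow_tsum_le {ι : Type*} (a : ι → ℝ≥0∞) {p : ℝ} (hp : 0 < p) (hp1 : p ≤ 1) :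
    (∑' i, a i) ^ p ≤ ∑' i, a i ^ p := by
  have h1 : ∀ F : Finset ι, (∑ i ∈ F, a i) ^ p ≤ ∑ i ∈ F, a i ^ p := by
    classical
    intro F
    induction F using Finset.induction_on with
    | empty => simp [hp]
    | insert i F hi ih =>
      rw [Finset.sum_insert hi, Finset.sum_insert hi]
      exact (ENNReal.rpow_add_le_add_rpow _ _ hp.le hp1).trans (by gcongr)
  have h2 : (∑' i, a i) ≤ (∑' i, a i ^ p) ^ (1 / p) := by
    rw [ENNReal.tsum_eq_iSup_sum]
    refine iSup_le fun F => ?_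
    rw [one_div, ENNReal.le_rpow_inv_iff hp]
    exact (h1 F).trans (ENNReal.sum_le_tsum F)
  rwa [one_div, ENNReal.le_rpow_inv_iff hp] at h2

theorem measurable_ballAverage_prod {g : Rn n → ℝ≥0∞} (hg : Measurable g) :
    Measurable fun p : Rn n × ℝ => ballAverage p.2 g p.1 := by
  have h : ∀ f : Rn n → ℝ≥0∞, Measurable f →
      Measurable fun p : Rn n × ℝ => ∫⁻ y in Metric.ball p.1 p.2, f y := by
    intro f hf
    have h1 : Measurable fun p : (Rn n × ℝ) × Rn n =>
        {p : (Rn n × ℝ) × Rn n | dist p.2 p.1.1 < p.1.2}.indicator (fun p => f p.2) p :=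
      (hf.comp measurable_snd).indicator (measurableSet_lt
        (measurable_snd.dist (measurable_fst.comp measurable_fst))
        (measurable_snd.comp measurable_fst))
    have h2 : (fun p : Rn n × ℝ => ∫⁻ y in Metric.ball p.1 p.2, f y) = fun p : Rn n × ℝ => ∫⁻ y,
        {p : (Rn n × ℝ) × Rn n | dist p.2 p.1.1 < p.1.2}.indicator (fun p => f p.2) (p, y) := by
      ext p
      rw [← lintegral_indicator measurableSet_ball]
      refine lintegral_congr fun y => ?_
      simp [indicator, Metric.mem_ball]
    rw [h2]
    exact h1.lintegral_prod_right'
  have h3 := h (fun _ => 1) measurable_const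
  simp only [setLIntegral_one] at h3
  simp only [ballAverage_eq]
  exact (h g hg).div h3

/-- The pairs `(x, y)` at which `lam * |x - y| ^ b` lies below the sum of the dyadic averages of `g`
at the scale `2 |x - y|` around `x` and around `y`. -/
def majorantSet (g : Rn n → ℝ≥0∞) (lam b : ℝ) : Set (Rn n × Rn n) :=
  {z | z.1 ≠ z.2 ∧ ENNReal.ofReal (lam * ‖z.1 - z.2‖ ^ b) <
    dyadicAverage g z.1 (2 * ‖z.1 - z.2‖) + dyadicAverage g z.2 (2 * ‖z.1 - z.2‖)}

theorem measurableSet_majorantSet {g : Rn n → ℝ≥0∞} (hg : Measurable g) (lam b : ℝ) :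
    MeasurableSet (majorantSet g lam b) := by
  have h1 : ∀ φ : Rn n × Rn n → Rn n, Measurable φ → Measurable fun z : Rn n × Rn n =>
      dyadicAverage g (φ z) (2 * ‖z.1 - z.2‖) := by
    intro φ hφ
    have h2 : ∀ j : ℕ, Measurable fun z : Rn n × Rn n =>
        (2 : ℝ≥0∞)⁻¹ ^ j * ballAverage (2 * ‖z.1 - z.2‖ / 2 ^ j) g (φ z) := by
      intro j
      have h3 : Measurable fun z : Rn n × Rn n => 2 * ‖z.1 - z.2‖ / 2 ^ j := by fun_prop
      exact ((measurable_ballAverage_prod hg).comp (hφ.prodMk h3)).const_mul _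
    exact Measurable.tsum h2
  have h4 : Measurable fun z : Rn n × Rn n => ENNReal.ofReal (lam * ‖z.1 - z.2‖ ^ b) := by
    fun_prop
  exact (measurableSet_eq_fun measurable_fst measurable_snd).compl.inter
    (measurableSet_lt h4 ((h1 _ measurable_fst).add (h1 _ measurable_snd)))

/-- The set where the average of `g` over balls of radius `r` exceeds `c`. -/
def superlevel (g : Rn n → ℝ≥0∞) (c r : ℝ) : Set (Rn n) :=
  {x | ENNReal.ofReal c < ballAverage r g x}

theorem measurableSet_superlevel {g : Rn n → ℝ≥0∞} (hg : Measurable g) (c r : ℝ) :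
    MeasurableSet (superlevel g c r) :=
  measurableSet_lt measurable_const (measurable_ballAverage hg r)

/-- If the weighted sum of averages exceeds `K`, then one of the averages exceeds the corresponding term
of a geometric distribution of `K`. The threshold `(2t)ʲ` grows with `j` when `t > 1/2`. -/
theorem exists_lt_of_lt_dyadicAverage {t : ℝ} (ht : t ∈ Ioo (0 : ℝ) 1) {K : ℝ≥0∞}
    {g : Rn n → ℝ≥0∞} {x : Rn n} {r : ℝ} (h : K < dyadicAverage g x r) :
    ∃ j : ℕ, K * ENNReal.ofReal ((1 - t) * (2 * t) ^ j) < ballAverage (r / 2 ^ j) g x := by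
  by_contra! hcon
  refine h.not_ge ?_
  have h1t : 0 < 1 - t := by linarith [ht.2]
  have ht0 := ht.1
  calc dyadicAverage g x r ≤ ∑' j : ℕ, K * ENNReal.ofReal ((1 - t) * t ^ j) := by
        refine ENNReal.tsum_le_tsum fun j => ?_
        calc (2 : ℝ≥0∞)⁻¹ ^ j * ballAverage (r / 2 ^ j) g x
            ≤ (2 : ℝ≥0∞)⁻¹ ^ j * (K * ENNReal.ofReal ((1 - t) * (2 * t) ^ j)) := by
              gcongr; exact hcon j
          _ = _ := by
              have : (2 : ℝ≥0∞)⁻¹ ^ j = ENNReal.ofReal ((2 : ℝ)⁻¹ ^ j) := by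
                rw [ENNReal.ofReal_pow (by norm_num), ENNReal.ofReal_inv_of_pos (by norm_num),
                  ENNReal.ofReal_ofNat]
              rw [this, mul_left_comm, ← ENNReal.ofReal_mul (by positivity)]
              congr 2
              rw [mul_pow, inv_pow]
              field_simp
    _ = K * ENNReal.ofReal (∑' j : ℕ, (1 - t) * t ^ j) := by
        rw [ENNReal.tsum_mul_left, ENNReal.ofReal_tsum_of_nonneg (fun j => by positivity)]
        exact (summable_geometric_of_lt_one ht0.le ht.2).mul_left _
    _ = K := by
        rw [tsum_mul_left, tsum_geometric_of_lt_one ht0.le ht.2, mul_inv_cancel₀ h1t.ne',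
          ENNReal.ofReal_one, mul_one]

theorem mem_superlevel_of_lt {t : ℝ} (ht : t ∈ Ioo (0 : ℝ) 1) {lam b ρ u : ℝ} (hlam : 0 < lam)
    (hu : 0 < u) (hρ : u ≤ ρ) (hρ2 : ρ < 2 * u) {g : Rn n → ℝ≥0∞} {x : Rn n}
    (h : ENNReal.ofReal (lam * ρ ^ b / 2) < dyadicAverage g x (2 * ρ)) :
    ∃ j : ℕ, x ∈ superlevel g ((1 - t) / (2 ^ (n + 1) * 2 ^ |b|) * (2 * t) ^ j * lam * u ^ b)
      (4 * u / 2 ^ j) := by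
  obtain ⟨j, hj⟩ := exists_lt_of_lt_dyadicAverage ht h
  refine ⟨j, ?_⟩
  have h1t : 0 < 1 - t := by linarith [ht.2]
  have ht0 := ht.1
  have hρ0 : 0 < ρ := hu.trans_le hρ
  have h1 : ballAverage (2 * ρ / 2 ^ j) g x ≤
      ENNReal.ofReal (2 ^ n) * ballAverage (4 * u / 2 ^ j) g x := by
    refine ballAverage_le_of_subset (by positivity) (Metric.ball_subset_ball ?_) (by positivity) ?_
    · exact div_le_div_of_nonneg_right (by linarith) (by positivity)
    · rw [← mul_div_assoc]
      exact div_le_div_of_nonneg_right (by linarith) (by positivity)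
  have h2 := hj.trans_le h1
  rw [← ENNReal.ofReal_mul (by positivity)] at h2
  have h3 : u ^ b ≤ 2 ^ |b| * ρ ^ b := (rpow_le_of_mem_Icc hu hρ hρ2.le).1
  have h4 : ENNReal.ofReal (2 ^ n) * ENNReal.ofReal
      ((1 - t) / (2 ^ (n + 1) * 2 ^ |b|) * (2 * t) ^ j * lam * u ^ b) ≤
      ENNReal.ofReal (lam * ρ ^ b / 2 * ((1 - t) * (2 * t) ^ j)) := by
    rw [← ENNReal.ofReal_mul (by positivity)]
    refine ENNReal.ofReal_le_ofReal ?_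
    calc _ ≤ 2 ^ n * ((1 - t) / (2 ^ (n + 1) * 2 ^ |b|) * (2 * t) ^ j * lam * (2 ^ |b| * ρ ^ b)) := by
          gcongr
      _ = _ := by
          rw [pow_succ (2 : ℝ) n]
          have : (0 : ℝ) < 2 ^ |b| := by positivity
          field_simp
  exact lt_of_mul_lt_mul_left' (h4.trans_lt h2)

/-- Decomposition of `majorantSet` according to the dyadic scale of `|x - y|` and to the index of the
average that is large. -/
theorem majorantSet_subset {t : ℝ} (ht : t ∈ Ioo (0 : ℝ) 1) {lam b : ℝ} (hlam : 0 < lam)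
    (g : Rn n → ℝ≥0∞) {c : ℝ} (hc : c = (1 - t) / (2 ^ (n + 1) * 2 ^ |b|)) :
    majorantSet g lam b ⊆ ⋃ p : ℤ × ℕ, {z | (2 : ℝ) ^ p.1 ≤ ‖z.1 - z.2‖ ∧
      ‖z.1 - z.2‖ < 2 * 2 ^ p.1 ∧
      (z.1 ∈ superlevel g (c * (2 * t) ^ p.2 * lam * ((2 : ℝ) ^ p.1) ^ b) (4 * 2 ^ p.1 / 2 ^ p.2) ∨
       z.2 ∈ superlevel g (c * (2 * t) ^ p.2 * lam * ((2 : ℝ) ^ p.1) ^ b)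
        (4 * 2 ^ p.1 / 2 ^ p.2))} := by
  rintro ⟨x, y⟩ ⟨hxy, hz⟩
  subst hc
  have hρ : 0 < ‖x - y‖ := by rwa [norm_pos_iff, sub_ne_zero]
  obtain ⟨k, hk1, hk2⟩ := exists_mem_Ico_zpow hρ one_lt_two
  rw [zpow_add_one₀ two_ne_zero, mul_comm] at hk2
  have h2k : (0 : ℝ) < 2 ^ k := by positivity
  have hor : ENNReal.ofReal (lam * ‖x - y‖ ^ b / 2) < dyadicAverage g x (2 * ‖x - y‖) ∨
      ENNReal.ofReal (lam * ‖x - y‖ ^ b / 2) < dyadicAverage g y (2 * ‖x - y‖) := by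
    by_contra! h
    refine (add_le_add h.1 h.2).not_gt ?_
    rw [← ENNReal.ofReal_add (by positivity) (by positivity), add_halves]
    exact hz
  rw [mem_iUnion]
  rcases hor with h | h
  · obtain ⟨j, hj⟩ := mem_superlevel_of_lt ht hlam h2k hk1 hk2 h
    exact ⟨(k, j), hk1, hk2, Or.inl hj⟩
  · obtain ⟨j, hj⟩ := mem_superlevel_of_lt ht hlam h2k hk1 hk2 h
    exact ⟨(k, j), hk1, hk2, Or.inr hj⟩

theorem mem_superlevel_two_mul {g : Rn n → ℝ≥0∞} {c r : ℝ} (hr : 0 < r) {y z : Rn n}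
    (hy : y ∈ superlevel g c r) (hz : z ∈ Metric.ball y r) :
    z ∈ superlevel g (c / 2 ^ n) (2 * r) := by
  have h1 : ballAverage r g y ≤ ENNReal.ofReal (2 ^ n) * ballAverage (2 * r) g z := by
    refine ballAverage_le_of_subset hr (Metric.ball_subset_ball' ?_) (by positivity) le_rfl
    rw [Metric.mem_ball, dist_comm] at hz
    linarith
  have h2 : ENNReal.ofReal (2 ^ n) * ENNReal.ofReal (c / 2 ^ n) = ENNReal.ofReal c := by
    rw [← ENNReal.ofReal_mul (by positivity)]
    congr 1
    field_simp
  exact lt_of_mul_lt_mul_left' (h2.trans_lt (lt_of_lt_of_le hy h1))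

/-- A point where an average is large comes with a whole ball of such points at twice the scale;
this linearizes the fractional power of the measure. -/
theorem volume_superlevel_rpow_le {q : ℝ} (hq : 1 ≤ q) (g : Rn n → ℝ≥0∞) (c : ℝ) {r R : ℝ}
    (hr : 0 < r) (hrR : r ≤ 2 * R) (x : Rn n) :
    volume (superlevel g c r ∩ Metric.ball x R) ^ (1 / q) ≤
      ENNReal.ofReal (r ^ ((n : ℝ) * (1 / q - 1))) *
        volume (Metric.ball (0 : Rn n) 1) ^ (1 / q - 1) *
        volume (superlevel g (c / 2 ^ n) (2 * r) ∩ Metric.ball x (4 * R)) := by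
  have hq0 : 0 < q := by linarith
  rcases (superlevel g c r ∩ Metric.ball x R).eq_empty_or_nonempty with h0 | ⟨y, hy, hyx⟩
  · rw [h0, measure_empty, ENNReal.zero_rpow_of_pos (by positivity)]
    exact zero_le
  rw [Metric.mem_ball] at hyx
  set A' := superlevel g (c / 2 ^ n) (2 * r) ∩ Metric.ball x (4 * R) with hA'
  have h1 : superlevel g c r ∩ Metric.ball x R ⊆ A' := fun z hz =>
    ⟨mem_superlevel_two_mul hr hz.1 (Metric.mem_ball_self hr),
      Metric.ball_subset_ball (by linarith) hz.2⟩
  have h2 : Metric.ball y r ⊆ A' := fun z hz =>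
    ⟨mem_superlevel_two_mul hr hy hz, by
      rw [Metric.mem_ball] at hz ⊢
      linarith [dist_triangle z y x]⟩
  have hfin : volume A' ≠ ⊤ :=
    ((measure_mono inter_subset_right).trans_lt measure_ball_lt_top).ne
  have hlow : volume (Metric.ball y r) ≤ volume A' := measure_mono h2
  have hpos : volume A' ≠ 0 :=
    ((Metric.measure_ball_pos _ _ hr).trans_le hlow).ne'
  have he : 1 / q - 1 ≤ 0 := by
    rw [sub_nonpos, div_le_one hq0]
    exact hq
  calc volume (superlevel g c r ∩ Metric.ball x R) ^ (1 / q) ≤ volume A' ^ (1 / q) := by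
        gcongr
    _ = volume A' ^ (1 / q - 1) * volume A' := by
        conv_rhs => rw [← ENNReal.rpow_one (volume A'), ← ENNReal.rpow_mul, one_mul]
        rw [← ENNReal.rpow_add _ _ hpos hfin, sub_add_cancel]
    _ ≤ volume (Metric.ball y r) ^ (1 / q - 1) * volume A' := by
        gcongr ?_ * _
        rw [← neg_sub 1 (1 / q), ENNReal.rpow_neg, ENNReal.rpow_neg]
        gcongr
        linarith
    _ = _ := by
        rw [volume_ball_eq _ hr, ENNReal.mul_rpow_of_ne_top ENNReal.ofReal_ne_top
          volume_unitBall_ne_top, ENNReal.ofReal_rpow_of_pos (by positivity),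
          ← Real.rpow_natCast, ← Real.rpow_mul hr.le]

end KernelInt

section DyadicMajorant

variable {n : ℕ}

/-- For a weight of class `A₁`, the measure of a set near `x` is, on average against the weight,
controlled by the weight of the set. -/
theorem lintegral_mul_volume_inter_ball_le {w : Rn n → ℝ≥0∞} (hw : Measurable w) {A : ℝ≥0∞}
    (hA : ∀ x, maximal w x ≤ A * w x) {Y : Set (Rn n)} (hY : MeasurableSet Y) {R : ℝ}
    (hR : 0 < R) :
    ∫⁻ x, w x * volume (Y ∩ Metric.ball x R) ≤
      ENNReal.ofReal (R ^ n) * volume (Metric.ball (0 : Rn n) 1) * (A * ∫⁻ y in Y, w y) := by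
  have hm : Measurable fun p : Rn n × Rn n =>
      {p : Rn n × Rn n | p.2 ∈ Y ∧ dist p.2 p.1 < R}.indicator (fun p => w p.1) p :=
    (hw.comp measurable_fst).indicator ((measurable_snd hY).inter
      (measurableSet_lt (measurable_snd.dist measurable_fst) measurable_const))
  calc ∫⁻ x, w x * volume (Y ∩ Metric.ball x R)
      = ∫⁻ x, ∫⁻ y, {p : Rn n × Rn n | p.2 ∈ Y ∧ dist p.2 p.1 < R}.indicator
          (fun p => w p.1) (x, y) := by
        refine lintegral_congr fun x => ?_
        rw [← setLIntegral_const, ← lintegral_indicator (hY.inter measurableSet_ball)]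
        refine lintegral_congr fun y => ?_
        by_cases h : y ∈ Y ∩ Metric.ball x R
        · rw [indicator_of_mem h, indicator_of_mem]
          exact h
        · rw [indicator_of_notMem h, indicator_of_notMem]
          exact h
    _ = ∫⁻ y, ∫⁻ x, {p : Rn n × Rn n | p.2 ∈ Y ∧ dist p.2 p.1 < R}.indicator
          (fun p => w p.1) (x, y) := lintegral_lintegral_swap hm.aemeasurable
    _ ≤ ∫⁻ y, Y.indicator (fun y => ENNReal.ofReal (R ^ n) *
          volume (Metric.ball (0 : Rn n) 1) * (A * w y)) y := by
        refine lintegral_mono fun y => ?_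
        by_cases hy : y ∈ Y
        · have h1 : ∀ x, {p : Rn n × Rn n | p.2 ∈ Y ∧ dist p.2 p.1 < R}.indicator
              (fun p => w p.1) (x, y) = (Metric.ball y R).indicator w x := fun x => by
            simp [indicator, hy, Metric.mem_ball, dist_comm y x]
          rw [indicator_of_mem hy, lintegral_congr h1, lintegral_indicator measurableSet_ball,
            setLIntegral_ball_eq _ _ hR, volume_ball_eq _ hR]
          gcongr
          exact (ballAverage_le_maximal w y hR).trans (hA y)
        · have h1 : ∀ x, {p : Rn n × Rn n | p.2 ∈ Y ∧ dist p.2 p.1 < R}.indicator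
              (fun p => w p.1) (x, y) = 0 := fun x => by
            simp [indicator, hy]
          rw [lintegral_congr h1, lintegral_zero]
          exact zero_le
    _ = _ := by
        rw [lintegral_indicator hY, lintegral_const_mul _ (hw.const_mul _),
          lintegral_const_mul _ hw]

/-- The pairs at distance in `[u, 2u)` one of whose points lies in `Y`. -/
def annulusPairs (u : ℝ) (Y : Set (Rn n)) : Set (Rn n × Rn n) :=
  {z | u ≤ ‖z.1 - z.2‖ ∧ ‖z.1 - z.2‖ < 2 * u ∧ (z.1 ∈ Y ∨ z.2 ∈ Y)}

theorem measurableSet_annulusPairs (u : ℝ) {Y : Set (Rn n)} (hY : MeasurableSet Y) :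
    MeasurableSet (annulusPairs u Y) := by
  have h : Measurable fun z : Rn n × Rn n => ‖z.1 - z.2‖ := by fun_prop
  exact (measurableSet_le measurable_const h).inter
    ((measurableSet_lt h measurable_const).inter ((measurable_fst hY).union (measurable_snd hY)))

theorem kernelInt_annulusPairs_le (s : ℝ) {u : ℝ} (hu : 0 < u) {Y : Set (Rn n)}
    (hY : MeasurableSet Y) (x : Rn n) :
    kernelInt s (annulusPairs u Y) x ≤ ENNReal.ofReal (2 ^ |s - n| * u ^ (s - n)) *
      (Y.indicator 1 x * volume (Metric.ball x (2 * u)) +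
        volume (Y ∩ Metric.ball x (2 * u))) := by
  have h2 : volume (Y ∩ Metric.ball x (2 * u)) =
      ∫⁻ y, (Y ∩ Metric.ball x (2 * u)).indicator 1 y :=
    (lintegral_indicator_one (hY.inter measurableSet_ball)).symm
  have h1 : volume (Metric.ball x (2 * u)) = ∫⁻ y, (Metric.ball x (2 * u)).indicator 1 y :=
    (lintegral_indicator_one measurableSet_ball).symm
  have hm1 : Measurable fun y => (Metric.ball x (2 * u)).indicator (1 : Rn n → ℝ≥0∞) y :=
    measurable_one.indicator measurableSet_ball
  rw [h1, h2, ← lintegral_const_mul _ hm1, ← lintegral_add_left (hm1.const_mul _),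
    ← lintegral_const_mul' _ _ ENNReal.ofReal_ne_top]
  refine lintegral_mono fun y => ?_
  by_cases h : (x, y) ∈ annulusPairs u Y
  · have ⟨ha, hb, hc⟩ := h
    have hball : y ∈ Metric.ball x (2 * u) := by rwa [mem_ball_iff_norm']
    rw [indicator_of_mem h]
    refine (ENNReal.ofReal_le_ofReal (rpow_le_of_mem_Icc hu ha hb.le).2).trans
      (le_mul_of_one_le_right' ?_)
    rcases hc with hc | hc
    · rw [indicator_of_mem hc, indicator_of_mem hball]
      simp
    · have hc' : y ∈ Y ∩ Metric.ball x (2 * u) := mem_inter hc hball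
      rw [indicator_of_mem hc']
      exact le_add_self
  · rw [indicator_of_notMem h]
    exact zero_le

theorem annulus_exponents {u b q N : ℝ} (hu : 0 < u) (j : ℕ) :
    u ^ (b - N / q) * (2 * u) ^ (N / q) = 2 ^ (N / q) * u ^ b ∧
    u ^ (b - N / q) * (4 * u / 2 ^ j) ^ (N * (1 / q - 1)) * (8 * u) ^ N =
      4 ^ (N * (1 / q - 1)) * 8 ^ N * ((2 ^ (N * (1 - 1 / q))) ^ j * u ^ b) := by
  constructor
  · rw [Real.mul_rpow (by norm_num) hu.le, mul_left_comm, ← Real.rpow_add hu, sub_add_cancel]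
  · have h1 : ((2 : ℝ) ^ j) ^ (N * (1 / q - 1)) = ((2 ^ (N * (1 - 1 / q))) ^ j)⁻¹ := by
      rw [← Real.rpow_natCast, ← Real.rpow_natCast, ← Real.rpow_mul (by norm_num),
        ← Real.rpow_mul (by norm_num), ← Real.rpow_neg (by norm_num)]
      congr 1
      ring
    rw [Real.div_rpow (by positivity) (by positivity), Real.mul_rpow (by norm_num) hu.le,
      Real.mul_rpow (by norm_num) hu.le, h1, div_inv_eq_mul]
    have h2 : u ^ b = u ^ (b - N / q) * u ^ (N * (1 / q - 1)) * u ^ N := by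
      rw [← Real.rpow_add hu, ← Real.rpow_add hu]
      congr 1
      ring
    rw [h2]
    ring

/-- The weighted estimate for a single dyadic annulus and a single average. The factor
`2^{n(1 - 1/q)j}` is the price of linearizing the power `1/q` at a scale `2ʲ` times smaller than the
annulus. -/
theorem exists_lintegral_annulus_le {b q : ℝ} (hq : 1 ≤ q) :
    ∃ C : ℝ≥0∞, C ≠ ⊤ ∧ ∀ (g w : Rn n → ℝ≥0∞), Measurable g → Measurable w → ∀ A : ℝ≥0∞,
      (∀ x, maximal w x ≤ A * w x) → ∀ (c u : ℝ), 0 < u → ∀ j : ℕ,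
      ∫⁻ x, w x * kernelInt (b * q) (annulusPairs u (superlevel g c (4 * u / 2 ^ j))) x ^ (1 / q) ≤
        C * ENNReal.ofReal ((2 ^ ((n : ℝ) * (1 - 1 / q))) ^ j * u ^ b) * (1 + A) *
          ∫⁻ x in superlevel g (c / 2 ^ n) (2 * (4 * u / 2 ^ j)), w x := by
  have hq0 : 0 < q := by linarith
  set V := volume (Metric.ball (0 : Rn n) 1) with hV
  set c₁ : ℝ := (2 ^ |b * q - n|) ^ (1 / q) with hc₁
  have hc₁0 : 0 ≤ c₁ := by positivity
  set c₂ : ℝ := 2 ^ ((n : ℝ) / q) with hc₂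
  set c₃ : ℝ := 4 ^ ((n : ℝ) * (1 / q - 1)) * 8 ^ (n : ℝ) with hc₃
  have hc₂0 : 0 ≤ c₂ := by positivity
  have hc₃0 : 0 ≤ c₃ := by positivity
  refine ⟨ENNReal.ofReal (c₁ * (c₂ + c₃)) * V ^ (1 / q), ENNReal.mul_ne_top ENNReal.ofReal_ne_top
    (ENNReal.rpow_ne_top_of_nonneg (by positivity) volume_unitBall_ne_top),
    fun g w hg hw A hA c u hu j => ?_⟩
  set r := 4 * u / 2 ^ j with hr
  have hr0 : 0 < r := by positivity
  have hru : r ≤ 2 * (2 * u) := by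
    rw [hr, div_le_iff₀ (by positivity)]
    nlinarith [one_le_pow₀ (n := j) (one_le_two : (1 : ℝ) ≤ 2)]
  set Y := superlevel g c r with hY
  have hYm : MeasurableSet Y := measurableSet_superlevel hg c r
  set Y' := superlevel g (c / 2 ^ n) (2 * r) with hY'
  have hY'm : MeasurableSet Y' := measurableSet_superlevel hg _ _
  have hYY' : Y ⊆ Y' := fun z hz => mem_superlevel_two_mul hr0 hz (Metric.mem_ball_self hr0)
  set σ : ℝ := (n : ℝ) * (1 - 1 / q) with hσ
  have h2σ : (1 : ℝ) ≤ (2 ^ σ) ^ j := by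
    refine one_le_pow₀ (Real.one_le_rpow one_le_two ?_)
    have : 1 / q ≤ 1 := by rw [div_le_one hq0]; exact hq
    have h0 : (0 : ℝ) ≤ n := by positivity
    exact mul_nonneg h0 (by linarith)
  obtain ⟨he1, he2⟩ := annulus_exponents (b := b) (q := q) (N := n) hu j
  -- the pointwise bound obtained by taking the root of the kernel integral
  have hpt : ∀ x, kernelInt (b * q) (annulusPairs u Y) x ^ (1 / q) ≤
      ENNReal.ofReal (c₁ * u ^ (b - n / q)) *
        (Y.indicator 1 x * (ENNReal.ofReal ((2 * u) ^ ((n : ℝ) / q)) * V ^ (1 / q)) +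
          ENNReal.ofReal (r ^ ((n : ℝ) * (1 / q - 1))) * V ^ (1 / q - 1) *
            volume (Y' ∩ Metric.ball x (8 * u))) := by
    intro x
    have h1 := ENNReal.rpow_le_rpow (kernelInt_annulusPairs_le (b * q) hu hYm x)
      (by positivity : 0 ≤ 1 / q)
    refine h1.trans ?_
    rw [ENNReal.mul_rpow_of_nonneg _ _ (by positivity), ENNReal.ofReal_rpow_of_pos (by positivity),
      Real.mul_rpow (by positivity) (by positivity), ← hc₁, ← Real.rpow_mul hu.le,
      show (b * q - n) * (1 / q) = b - n / q by field_simp]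
    gcongr
    refine (ENNReal.rpow_add_le_add_rpow _ _ (by positivity)
      (by rw [div_le_one hq0]; exact hq)).trans (add_le_add ?_ ?_)
    · rw [ENNReal.mul_rpow_of_nonneg _ _ (by positivity), volume_ball_eq _ (by positivity),
        ENNReal.mul_rpow_of_nonneg _ _ (by positivity), ENNReal.ofReal_rpow_of_pos (by positivity),
        ← Real.rpow_natCast, ← Real.rpow_mul (by positivity), mul_one_div]
      gcongr
      by_cases hx : x ∈ Y
      · simp [hx]
      · simp [hx, hq0]
    · have h2 := volume_superlevel_rpow_le hq g c hr0 hru x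
      rwa [show 4 * (2 * u) = 8 * u by ring] at h2
  calc ∫⁻ x, w x * kernelInt (b * q) (annulusPairs u Y) x ^ (1 / q)
      ≤ ∫⁻ x, (ENNReal.ofReal (c₁ * u ^ (b - n / q)) *
          (ENNReal.ofReal ((2 * u) ^ ((n : ℝ) / q)) * V ^ (1 / q)) * Y.indicator w x +
        ENNReal.ofReal (c₁ * u ^ (b - n / q)) * (ENNReal.ofReal (r ^ ((n : ℝ) * (1 / q - 1))) *
          V ^ (1 / q - 1)) * (w x * volume (Y' ∩ Metric.ball x (8 * u)))) := by
        refine lintegral_mono fun x => ?_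
        refine (mul_le_mul_right (hpt x) _).trans (le_of_eq ?_)
        have : Y.indicator w x = w x * Y.indicator 1 x := by
          by_cases hx : x ∈ Y <;> simp [hx]
        rw [this]
        ring
    _ ≤ ENNReal.ofReal (c₁ * u ^ (b - n / q)) *
          (ENNReal.ofReal ((2 * u) ^ ((n : ℝ) / q)) * V ^ (1 / q)) * (∫⁻ x in Y', w x) +
        ENNReal.ofReal (c₁ * u ^ (b - n / q)) * (ENNReal.ofReal (r ^ ((n : ℝ) * (1 / q - 1))) *
          V ^ (1 / q - 1)) * (ENNReal.ofReal ((8 * u) ^ n) * V * (A * ∫⁻ x in Y', w x)) := by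
        have hYw : Measurable (Y.indicator w) := hw.indicator hYm
        have hV1 : V ^ (1 / q - 1) ≠ ⊤ :=
          ENNReal.rpow_ne_top_of_ne_zero volume_unitBall_ne_zero volume_unitBall_ne_top
        rw [lintegral_add_left (hYw.const_mul _), lintegral_const_mul _ hYw,
          lintegral_const_mul' _ _ (ENNReal.mul_ne_top ENNReal.ofReal_ne_top
            (ENNReal.mul_ne_top ENNReal.ofReal_ne_top hV1)), lintegral_indicator hYm]
        gcongr
        exact lintegral_mul_volume_inter_ball_le hw hA hY'm (by positivity)
    _ = ENNReal.ofReal (c₁ * (c₂ * u ^ b)) * V ^ (1 / q) * (∫⁻ x in Y', w x) +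
        ENNReal.ofReal (c₁ * (c₃ * ((2 ^ σ) ^ j * u ^ b))) * V ^ (1 / q) *
          (A * ∫⁻ x in Y', w x) := by
        have hVV : V ^ (1 / q - 1) * V = V ^ (1 / q) := by
          conv_lhs => rw [← ENNReal.rpow_one V, ← ENNReal.rpow_mul, one_mul]
          rw [← ENNReal.rpow_add _ _ volume_unitBall_ne_zero volume_unitBall_ne_top,
            sub_add_cancel]
        have h1 : ENNReal.ofReal (c₁ * (c₂ * u ^ b)) = ENNReal.ofReal (c₁ * u ^ (b - n / q)) *
            ENNReal.ofReal ((2 * u) ^ ((n : ℝ) / q)) := by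
          rw [← ENNReal.ofReal_mul (by positivity), mul_assoc, he1]
        have h2 : ENNReal.ofReal (c₁ * (c₃ * ((2 ^ σ) ^ j * u ^ b))) =
            ENNReal.ofReal (c₁ * u ^ (b - n / q)) * ENNReal.ofReal (r ^ ((n : ℝ) * (1 / q - 1))) *
              ENNReal.ofReal ((8 * u) ^ n) := by
          rw [← ENNReal.ofReal_mul (by positivity), ← ENNReal.ofReal_mul (by positivity),
            ← Real.rpow_natCast (8 * u) n, mul_assoc c₁, mul_assoc c₁, he2]
        rw [h1, h2, ← hVV]
        ring
    _ ≤ ENNReal.ofReal (c₁ * (c₂ + c₃) * ((2 ^ σ) ^ j * u ^ b)) * V ^ (1 / q) *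
          (∫⁻ x in Y', w x) +
        ENNReal.ofReal (c₁ * (c₂ + c₃) * ((2 ^ σ) ^ j * u ^ b)) * V ^ (1 / q) *
          (A * ∫⁻ x in Y', w x) := by
        have hub : 0 ≤ u ^ b := by positivity
        gcongr ENNReal.ofReal ?_ * _ * _ + ENNReal.ofReal ?_ * _ * _
        · rw [mul_assoc]
          refine mul_le_mul_of_nonneg_left ?_ hc₁0
          exact mul_le_mul (by linarith) (le_mul_of_one_le_left hub h2σ) hub (by positivity)
        · have h1 : c₃ * ((2 ^ σ) ^ j * u ^ b) ≤ (c₂ + c₃) * ((2 ^ σ) ^ j * u ^ b) :=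
            mul_le_mul_of_nonneg_right (by linarith) (by positivity)
          exact (mul_le_mul_of_nonneg_left h1 hc₁0).trans_eq (mul_assoc _ _ _).symm
    _ = _ := by
        rw [ENNReal.ofReal_mul (by positivity)]
        ring

/-- The weighted estimate for the pairs below the dyadic averages. -/
theorem exists_lintegral_majorantSet_le (hn : 1 ≤ n) {b q : ℝ} (hq : 1 ≤ q)
    (hnq : (n : ℝ) * (1 - 1 / q) < 1) (hb : 0 < b ∨ b < -n) :
    ∃ C : ℝ≥0∞, C ≠ ⊤ ∧ ∀ (g w : Rn n → ℝ≥0∞), Measurable g → Measurable w → ∀ A : ℝ≥0∞,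
      (∀ x, maximal w x ≤ A * w x) → ∀ lam : ℝ, 0 < lam →
      ∫⁻ x, w x * (ENNReal.ofReal lam * kernelInt (b * q) (majorantSet g lam b) x ^ (1 / q)) ≤
        C * ((1 + A) * A) * ∫⁻ x, w x * g x := by
  have hq0 : 0 < q := by linarith
  obtain ⟨C₁, hC₁⟩ := exists_tsum_covering_le hn hb
  obtain ⟨C₂, hC₂t, hC₂⟩ := exists_lintegral_annulus_le (n := n) (b := b) hq
  set a : ℝ := 2 ^ ((n : ℝ) * (1 - 1 / q)) with ha
  have ha0 : 0 < a := by positivity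
  have ha2 : a < 2 := by
    have := Real.rpow_lt_rpow_of_exponent_lt (one_lt_two : (1 : ℝ) < 2) hnq
    rwa [Real.rpow_one] at this
  -- any `t` with `a / 2 < t < 1` makes the series of scales converge
  set t : ℝ := (a / 2 + 1) / 2 with ht
  have htI : t ∈ Ioo (0 : ℝ) 1 := ⟨by positivity, by rw [ht]; linarith⟩
  have hat : a < 2 * t := by rw [ht]; linarith
  have ht0 : 0 < t := htI.1
  have h1t : 0 < 1 - t := by linarith [htI.2]
  set c : ℝ := (1 - t) / (2 ^ (n + 1) * 2 ^ |b|) with hc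
  have hc0 : 0 < c := by positivity
  set S : ℝ≥0∞ := ∑' j : ℕ, ENNReal.ofReal ((a / (2 * t)) ^ j) with hS
  have hratio : a / (2 * t) < 1 := by rw [div_lt_one (by positivity)]; exact hat
  have hSt : S ≠ ⊤ := by
    rw [hS, ← ENNReal.ofReal_tsum_of_nonneg (fun j => by positivity)
      (summable_geometric_of_lt_one (by positivity) hratio)]
    exact ENNReal.ofReal_ne_top
  refine ⟨C₂ * ENNReal.ofReal (2 ^ n / c) * C₁ * S, by finiteness,
    fun g w hg hw A hA lam hlam => ?_⟩
  set Y : ℤ × ℕ → Set (Rn n) := fun p =>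
    superlevel g (c * (2 * t) ^ p.2 * lam * ((2 : ℝ) ^ p.1) ^ b) (4 * 2 ^ p.1 / 2 ^ p.2) with hY
  have hYm : ∀ p, MeasurableSet (Y p) := fun p => measurableSet_superlevel hg _ _
  have hEm : ∀ p : ℤ × ℕ, MeasurableSet (annulusPairs ((2 : ℝ) ^ p.1) (Y p)) := fun p =>
    measurableSet_annulusPairs _ (hYm p)
  have hpt : ∀ x, kernelInt (b * q) (majorantSet g lam b) x ^ (1 / q) ≤
      ∑' p : ℤ × ℕ, kernelInt (b * q) (annulusPairs ((2 : ℝ) ^ p.1) (Y p)) x ^ (1 / q) := by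
    intro x
    refine (ENNReal.rpow_le_rpow ((kernelInt_mono (majorantSet_subset htI hlam g hc) x).trans
      (kernelInt_iUnion_le hEm x)) (by positivity)).trans
      (rpow_tsum_le _ (by positivity) (by rw [div_le_one hq0]; exact hq))
  -- the contribution of a fixed `j`, summed over all scales
  have hj : ∀ j : ℕ, ∑' k : ℤ, ENNReal.ofReal lam * ∫⁻ x, w x *
      kernelInt (b * q) (annulusPairs ((2 : ℝ) ^ k) (Y (k, j))) x ^ (1 / q) ≤
      C₂ * ENNReal.ofReal (2 ^ n / c) * C₁ * ENNReal.ofReal ((a / (2 * t)) ^ j) *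
        ((1 + A) * A * ∫⁻ x, w x * g x) := by
    intro j
    set d : ℝ := ((2 : ℝ) ^ ((j : ℤ) - 3)) ^ b with hd
    have hd0 : 0 < d := by positivity
    set Λ : ℝ := c * (2 * t) ^ j * lam * d / 2 ^ n with hΛ
    have hΛ0 : 0 < Λ := by positivity
    have hkey := hC₁ g w hg hw (ENNReal.ofReal Λ)
    rw [← (Equiv.addRight ((j : ℤ) - 3)).tsum_eq]
    calc _ ≤ ∑' l : ℤ, C₂ * ENNReal.ofReal (2 ^ n / c) * ENNReal.ofReal ((a / (2 * t)) ^ j) *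
          (1 + A) * (ENNReal.ofReal (((2 : ℝ) ^ l) ^ b) * ENNReal.ofReal Λ *
            ∫⁻ x in {x | ENNReal.ofReal Λ * ENNReal.ofReal (((2 : ℝ) ^ l) ^ b) <
              ballAverage (2 ^ l) g x}, w x) := by
          refine ENNReal.tsum_le_tsum fun l => ?_
          have hpow : ((2 : ℝ) ^ (l + ((j : ℤ) - 3))) ^ b = ((2 : ℝ) ^ l) ^ b * d := by
            rw [zpow_add₀ two_ne_zero, Real.mul_rpow (by positivity) (by positivity)]
          have hrad : 2 * (4 * (2 : ℝ) ^ (l + ((j : ℤ) - 3)) / 2 ^ j) = 2 ^ l := by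
            rw [zpow_add₀ two_ne_zero, zpow_sub₀ two_ne_zero, zpow_natCast]
            have : (0 : ℝ) < 2 ^ j := by positivity
            field_simp
            norm_num
          have hset : superlevel g (c * (2 * t) ^ j * lam * ((2 : ℝ) ^ (l + ((j : ℤ) - 3))) ^ b / 2 ^ n)
              (2 * (4 * (2 : ℝ) ^ (l + ((j : ℤ) - 3)) / 2 ^ j)) =
              {x | ENNReal.ofReal Λ * ENNReal.ofReal (((2 : ℝ) ^ l) ^ b) <
                ballAverage (2 ^ l) g x} := by
            rw [hrad, hpow, ← ENNReal.ofReal_mul hΛ0.le, superlevel, hΛ]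
            congr! 4
            ring
          have h1 := hC₂ g w hg hw A hA (c * (2 * t) ^ j * lam * ((2 : ℝ) ^ (l + ((j : ℤ) - 3))) ^ b)
            (2 ^ (l + ((j : ℤ) - 3))) (by positivity) j
          rw [hset] at h1
          refine (mul_le_mul_right h1 _).trans (le_of_eq ?_)
          have h2 : ENNReal.ofReal lam *
              ENNReal.ofReal (a ^ j * ((2 : ℝ) ^ (l + ((j : ℤ) - 3))) ^ b) =
              ENNReal.ofReal (2 ^ n / c) * ENNReal.ofReal ((a / (2 * t)) ^ j) *
                (ENNReal.ofReal (((2 : ℝ) ^ l) ^ b) * ENNReal.ofReal Λ) := by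
            rw [← ENNReal.ofReal_mul (by positivity), ← ENNReal.ofReal_mul (by positivity),
              ← ENNReal.ofReal_mul (by positivity), ← ENNReal.ofReal_mul (by positivity)]
            congr 1
            rw [hpow, hΛ, div_pow]
            field_simp
          rw [show ∀ I : ℝ≥0∞, ENNReal.ofReal lam *
              (C₂ * ENNReal.ofReal (a ^ j * ((2 : ℝ) ^ (l + ((j : ℤ) - 3))) ^ b) * (1 + A) * I) =
              C₂ * (ENNReal.ofReal lam *
                ENNReal.ofReal (a ^ j * ((2 : ℝ) ^ (l + ((j : ℤ) - 3))) ^ b)) * (1 + A) * I from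
            fun I => by ring, h2]
          ring
      _ ≤ C₂ * ENNReal.ofReal (2 ^ n / c) * ENNReal.ofReal ((a / (2 * t)) ^ j) *
          (1 + A) * (C₁ * ∫⁻ x, g x * maximal w x) := by
          rw [ENNReal.tsum_mul_left]
          gcongr
      _ ≤ C₂ * ENNReal.ofReal (2 ^ n / c) * ENNReal.ofReal ((a / (2 * t)) ^ j) *
          (1 + A) * (C₁ * (A * ∫⁻ x, w x * g x)) := by
          gcongr
          have hwg : Measurable fun x => w x * g x := hw.mul hg
          rw [← lintegral_const_mul _ hwg]
          refine lintegral_mono fun x => ?_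
          calc g x * maximal w x ≤ g x * (A * w x) := by gcongr; exact hA x
            _ = _ := by ring
      _ = _ := by ring
  calc ∫⁻ x, w x * (ENNReal.ofReal lam * kernelInt (b * q) (majorantSet g lam b) x ^ (1 / q))
      ≤ ∫⁻ x, ∑' p : ℤ × ℕ, ENNReal.ofReal lam * (w x *
          kernelInt (b * q) (annulusPairs ((2 : ℝ) ^ p.1) (Y p)) x ^ (1 / q)) := by
        refine lintegral_mono fun x => ?_
        rw [ENNReal.tsum_mul_left, ENNReal.tsum_mul_left, mul_left_comm]
        gcongr
        exact hpt x
    _ = ∑' p : ℤ × ℕ, ENNReal.ofReal lam * ∫⁻ x, w x *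
          kernelInt (b * q) (annulusPairs ((2 : ℝ) ^ p.1) (Y p)) x ^ (1 / q) := by
        have hm : ∀ p : ℤ × ℕ, Measurable fun x => w x *
            kernelInt (b * q) (annulusPairs ((2 : ℝ) ^ p.1) (Y p)) x ^ (1 / q) := fun p =>
          hw.mul ((measurable_kernelInt (hEm p)).pow_const _)
        rw [lintegral_tsum fun p => ((hm p).const_mul _).aemeasurable]
        exact tsum_congr fun p => lintegral_const_mul _ (hm p)
    _ = ∑' j : ℕ, ∑' k : ℤ, ENNReal.ofReal lam * ∫⁻ x, w x *
          kernelInt (b * q) (annulusPairs ((2 : ℝ) ^ k) (Y (k, j))) x ^ (1 / q) := by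
        rw [ENNReal.tsum_prod', ENNReal.tsum_comm]
    _ ≤ _ := by
        refine (ENNReal.tsum_le_tsum hj).trans (le_of_eq ?_)
        rw [ENNReal.tsum_mul_right, ENNReal.tsum_mul_left, mul_assoc _ ((1 + A) * A)]

end DyadicMajorant

/-! ### Norm bounds for kernel integrals -/

section NormBounds

variable {n : ℕ}

/-- The pairs `(x, y)` with `lam * |x - y| ^ b < D x`. -/
def truncSet (D : Rn n → ℝ≥0∞) (lam b : ℝ) : Set (Rn n × Rn n) :=
  {z | ENNReal.ofReal (lam * ‖z.1 - z.2‖ ^ b) < D z.1}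

theorem measurableSet_truncSet {D : Rn n → ℝ≥0∞} (hD : Measurable D) (lam b : ℝ) :
    MeasurableSet (truncSet D lam b) := by
  have h : Measurable fun z : Rn n × Rn n => ENNReal.ofReal (lam * ‖z.1 - z.2‖ ^ b) := by fun_prop
  exact measurableSet_lt h (hD.comp measurable_fst)

theorem lintegral_radial_sub (hn : 1 ≤ n) {b s a : ℝ} (hsb : 0 < s / b) (ha : 0 ≤ a) (x : Rn n) :
    ∫⁻ y in {y : Rn n | ‖x - y‖ ^ b < a}, ENNReal.ofReal (‖x - y‖ ^ (s - n)) =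
      ENNReal.ofReal (a ^ (s / b) / |s|) * (volume : Measure (Rn n)).toSphere univ := by
  rw [← lintegral_radial hn hsb ha, ← lintegral_indicator, ← lintegral_indicator]
  · exact lintegral_sub_left_eq_self
      ({z : Rn n | ‖z‖ ^ b < a}.indicator fun z => ENNReal.ofReal (‖z‖ ^ (s - n))) x
  · exact measurableSet_lt (by fun_prop) measurable_const
  · exact measurableSet_lt (by fun_prop) measurable_const

theorem kernelInt_truncSet_le (hn : 1 ≤ n) {b s lam : ℝ} (hsb : 0 < s / b) (hlam : 0 < lam)
    {D : Rn n → ℝ≥0∞} {x : Rn n} (hD : D x ≠ ⊤) :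
    kernelInt s (truncSet D lam b) x ≤
      ENNReal.ofReal (((D x).toReal / lam) ^ (s / b) / |s|) *
        (volume : Measure (Rn n)).toSphere univ := by
  have hm : MeasurableSet {y : Rn n | ‖x - y‖ ^ b < (D x).toReal / lam} :=
    measurableSet_lt (by fun_prop) measurable_const
  rw [← lintegral_radial_sub hn hsb (by positivity) x, ← lintegral_indicator hm, kernelInt]
  refine lintegral_mono fun y => ?_
  by_cases h : (x, y) ∈ truncSet D lam b
  · have h1 : ENNReal.ofReal (lam * ‖x - y‖ ^ b) < D x := h
    have hy : y ∈ {y : Rn n | ‖x - y‖ ^ b < (D x).toReal / lam} := by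
      rw [mem_ofPred_eq, lt_div_iff₀' hlam]
      exact (ENNReal.ofReal_lt_iff_lt_toReal (by positivity) hD).1 h1
    rw [indicator_of_mem h, indicator_of_mem hy]
  · rw [indicator_of_notMem h]
    exact zero_le

theorem add_rpow_le_two (a b : ℝ≥0∞) {s : ℝ} (hs : 0 ≤ s) :
    (a + b) ^ s ≤ 2 ^ s * (a ^ s + b ^ s) := by
  have key : ∀ a b : ℝ≥0∞, a ≤ b → (a + b) ^ s ≤ 2 ^ s * (a ^ s + b ^ s) := by
    intro a b h
    calc (a + b) ^ s ≤ (2 * b) ^ s := by rw [two_mul]; gcongr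
      _ = 2 ^ s * b ^ s := ENNReal.mul_rpow_of_nonneg _ _ hs
      _ ≤ _ := by gcongr; exact le_add_self
  rcases le_total a b with h | h
  · exact key a b h
  · rw [add_comm a, add_comm (a ^ s)]
    exact key b a h

/-- The factor relating truncated kernel integrals to the truncation height. -/
noncomputable def radialConst (n : ℕ) (γ q : ℝ) : ℝ≥0∞ :=
  (ENNReal.ofReal (1 / |γ|) * (volume : Measure (Rn n)).toSphere univ) ^ (1 / q)

theorem radialConst_ne_top (γ : ℝ) {q : ℝ} (hq : 0 < q) : radialConst n γ q ≠ ⊤ :=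
  ENNReal.rpow_ne_top_of_nonneg (by positivity)
    (ENNReal.mul_ne_top ENNReal.ofReal_ne_top (measure_ne_top _ _))

theorem ofReal_mul_rpow_inv {lam q : ℝ} (hlam : 0 < lam) (hq : 0 < q) (I : ℝ≥0∞) :
    ENNReal.ofReal lam * I ^ (1 / q) = (ENNReal.ofReal (lam ^ q) * I) ^ (1 / q) := by
  rw [ENNReal.mul_rpow_of_nonneg _ _ (by positivity), ENNReal.ofReal_rpow_of_pos (by positivity),
    ← Real.rpow_mul hlam.le, mul_one_div_cancel hq.ne', Real.rpow_one]

/-- Truncated level sets contribute at most a multiple of the truncation height. -/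
theorem functional_truncSet_le (hn : 1 ≤ n) {γ q lam : ℝ} (hγ : γ ≠ 0) (hq : 0 < q) (hlam : 0 < lam)
    {D : Rn n → ℝ≥0∞} {x : Rn n} (hD : D x ≠ ⊤) :
    ENNReal.ofReal lam * kernelInt γ (truncSet D lam (γ / q)) x ^ (1 / q) ≤
      radialConst n γ q * D x := by
  have hsb : γ / (γ / q) = q := by field_simp
  have h1 := kernelInt_truncSet_le hn (b := γ / q) (s := γ) (by rw [hsb]; exact hq) hlam hD
  rw [hsb] at h1
  have hDx : D x = ENNReal.ofReal ((D x).toReal ^ q) ^ (1 / q) := by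
    rw [ENNReal.ofReal_rpow_of_nonneg (by positivity) (by positivity),
      ← Real.rpow_mul (by positivity), mul_one_div_cancel hq.ne', Real.rpow_one,
      ENNReal.ofReal_toReal hD]
  rw [ofReal_mul_rpow_inv hlam hq, radialConst]
  conv_rhs => rw [hDx]
  rw [← ENNReal.mul_rpow_of_nonneg _ _ (by positivity)]
  refine ENNReal.rpow_le_rpow ?_ (by positivity)
  refine (mul_le_mul_right h1 _).trans (le_of_eq ?_)
  rw [← mul_assoc, ← ENNReal.ofReal_mul (by positivity), mul_right_comm,
    ← ENNReal.ofReal_mul (by positivity)]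
  congr 2
  rw [Real.div_rpow (by positivity) hlam.le]
  have : 0 < lam ^ q := by positivity
  field_simp

/-- Kernel integrals of different homogeneities over the same set of pairs are comparable in the
direction of increasing exponents. -/
theorem exists_kernelInt_rpow_le (hn : 1 ≤ n) {b p q : ℝ} (hb : b ≠ 0) (hp : 0 < p) (hpq : p ≤ q) :
    ∃ C : ℝ≥0∞, C ≠ ⊤ ∧ ∀ E : Set (Rn n × Rn n), MeasurableSet E → ∀ x,
      kernelInt (b * p) E x ^ (1 / p) ≤ C * kernelInt (b * q) E x ^ (1 / q) := by
  have hq : 0 < q := hp.trans_le hpq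
  set c : ℝ≥0∞ := ENNReal.ofReal (1 / |b * p|) * (volume : Measure (Rn n)).toSphere univ with hc
  have hct : c ≠ ⊤ := ENNReal.mul_ne_top ENNReal.ofReal_ne_top (measure_ne_top _ _)
  refine ⟨(c + 1) ^ (1 / p), ENNReal.rpow_ne_top_of_nonneg (by positivity) (by finiteness),
    fun E hE x => ?_⟩
  set I := kernelInt (b * q) E x with hI
  have hc1 : (c + 1) ^ (1 / p) ≠ 0 := by
    rw [Ne, ENNReal.rpow_eq_zero_iff_of_pos (by positivity)]
    simp
  rcases eq_or_ne I ⊤ with hIt | hIt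
  · rw [hIt, ENNReal.top_rpow_of_pos (by positivity), ENNReal.mul_top hc1]
    exact le_top
  have hxm : Measurable fun y : Rn n =>
      E.indicator (fun z => ENNReal.ofReal (‖z.1 - z.2‖ ^ (b * q - (n : ℝ)))) (x, y) :=
    (measurable_indicator_kernel hE).comp measurable_prodMk_left
  rcases eq_or_ne I 0 with hI0 | hI0
  · have h1 : ∀ᵐ y ∂(volume : Measure (Rn n)), (x, y) ∉ E := by
      rw [hI, kernelInt, lintegral_eq_zero_iff hxm] at hI0
      have := nontrivial_Rn hn
      have hne : ∀ᵐ y ∂(volume : Measure (Rn n)), y ≠ x := by simp [ae_iff]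
      filter_upwards [hI0, hne] with y hy hyx hyE
      rw [indicator_of_mem hyE] at hy
      have h2 : 0 < ‖x - y‖ := by rw [norm_pos_iff, sub_ne_zero]; exact hyx.symm
      have h3 : 0 < ‖x - y‖ ^ (b * q - n) := by positivity
      exact (ENNReal.ofReal_pos.2 h3).ne' hy
    have h2 : kernelInt (b * p) E x = 0 := by
      rw [kernelInt, lintegral_congr_ae (g := 0), lintegral_zero_fun]
      filter_upwards [h1] with y hy
      rw [indicator_of_notMem hy]
      rfl
    rw [h2, ENNReal.zero_rpow_of_pos (by positivity)]
    exact zero_le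
  -- the threshold balancing the two regimes
  set m : ℝ := I.toReal ^ (1 / q) with hm
  have hIr : 0 < I.toReal := ENNReal.toReal_pos hI0 hIt
  have hm0 : 0 < m := by positivity
  have hmq : m ^ q = I.toReal := by
    rw [hm, ← Real.rpow_mul hIr.le, one_div_mul_cancel hq.ne', Real.rpow_one]
  have hAm : MeasurableSet {y : Rn n | ‖x - y‖ ^ b < m} :=
    measurableSet_lt (by fun_prop) measurable_const
  have hbp : b * p / b = p := by field_simp
  have hrad := lintegral_radial_sub hn (b := b) (s := b * p) (a := m) (by rw [hbp]; exact hp)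
    hm0.le x
  rw [hbp] at hrad
  have hmain : kernelInt (b * p) E x ≤ (c + 1) * ENNReal.ofReal (m ^ p) := by
    calc kernelInt (b * p) E x
        ≤ ∫⁻ y, ({y : Rn n | ‖x - y‖ ^ b < m}.indicator
            (fun y => ENNReal.ofReal (‖x - y‖ ^ (b * p - n))) y +
          ENNReal.ofReal (m ^ (p - q)) *
            E.indicator (fun z => ENNReal.ofReal (‖z.1 - z.2‖ ^ (b * q - (n : ℝ)))) (x, y)) := by
          have := nontrivial_Rn hn
          have hne : ∀ᵐ y ∂(volume : Measure (Rn n)), y ≠ x := by simp [ae_iff]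
          refine lintegral_mono_ae ?_
          filter_upwards [hne] with y hyx
          by_cases hyE : (x, y) ∈ E
          · rw [indicator_of_mem hyE, indicator_of_mem hyE]
            by_cases hy : y ∈ {y : Rn n | ‖x - y‖ ^ b < m}
            · rw [indicator_of_mem hy]
              exact le_self_add
            · refine le_trans ?_ le_add_self
              rw [mem_ofPred_eq, not_lt] at hy
              have h2 : 0 < ‖x - y‖ := by rw [norm_pos_iff, sub_ne_zero]; exact hyx.symm
              rw [← ENNReal.ofReal_mul (by positivity)]
              refine ENNReal.ofReal_le_ofReal ?_
              dsimp only
              calc ‖x - y‖ ^ (b * p - n) = (‖x - y‖ ^ b) ^ (p - q) * ‖x - y‖ ^ (b * q - n) := by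
                    rw [← Real.rpow_mul h2.le, ← Real.rpow_add h2]
                    congr 1
                    ring
                _ ≤ _ := by
                    gcongr ?_ * _
                    exact Real.rpow_le_rpow_of_nonpos hm0 hy (by linarith)
          · rw [indicator_of_notMem hyE]
            exact zero_le
      _ = ENNReal.ofReal (m ^ p / |b * p|) * (volume : Measure (Rn n)).toSphere univ +
          ENNReal.ofReal (m ^ (p - q)) * I := by
          rw [lintegral_add_left (Measurable.indicator (by fun_prop) hAm), lintegral_indicator hAm,
            hrad, lintegral_const_mul' _ _ ENNReal.ofReal_ne_top]
          rfl
      _ = (c + 1) * ENNReal.ofReal (m ^ p) := by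
          have h1 : ENNReal.ofReal (m ^ (p - q)) * I = ENNReal.ofReal (m ^ p) := by
            rw [← ENNReal.ofReal_toReal hIt, ← ENNReal.ofReal_mul (by positivity), ← hmq,
              ← Real.rpow_add hm0, sub_add_cancel]
          rw [h1, hc, add_mul, one_mul, mul_right_comm, ← ENNReal.ofReal_mul (by positivity)]
          congr 3
          ring
  calc kernelInt (b * p) E x ^ (1 / p) ≤ ((c + 1) * ENNReal.ofReal (m ^ p)) ^ (1 / p) :=
        ENNReal.rpow_le_rpow hmain (by positivity)
    _ = _ := by
        rw [ENNReal.mul_rpow_of_nonneg _ _ (by positivity), ENNReal.ofReal_rpow_of_pos (by positivity),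
          ← Real.rpow_mul hm0.le, mul_one_div_cancel hp.ne', Real.rpow_one, hm,
          ← ENNReal.ofReal_rpow_of_pos hIr, ENNReal.ofReal_toReal hIt]

/-- The norm estimate for the pairs below the dyadic averages. -/
theorem IsBallBanach.exists_majorantSet_le {N : FunctionNorm n} (hN : IsBallBanach N) (hn : 1 ≤ n)
    {L : ℝ≥0} (hL1 : 1 ≤ L)
    (hL : ∀ h : Rn n → ℝ≥0∞, Measurable h → associate N (maximal h) ≤ L * associate N h)
    {b q : ℝ} (hq : 0 < q) (hnq : (n : ℝ) * (1 - 1 / q) < 1) (hb : 0 < b ∨ b < -n) :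
    ∃ C : ℝ≥0∞, C ≠ ⊤ ∧ ∀ g : Rn n → ℝ≥0∞, Measurable g → N g < ⊤ → ∀ lam : ℝ, 0 < lam →
      N (fun x => ENNReal.ofReal lam * kernelInt (b * q) (majorantSet g lam b) x ^ (1 / q)) ≤
        C * N g := by
  have hb0 : b ≠ 0 := by
    rcases hb with h | h
    · exact h.ne'
    · exact (h.trans_le (by simp)).ne
  set p : ℝ := max q 1 with hp
  have hp1 : 1 ≤ p := le_max_right _ _
  have hnp : (n : ℝ) * (1 - 1 / p) < 1 := by
    rcases le_total q 1 with h | h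
    · rw [hp, max_eq_right h]
      norm_num
    · rwa [hp, max_eq_left h]
  obtain ⟨C₁, hC₁t, hC₁⟩ := exists_kernelInt_rpow_le hn hb0 hq (le_max_left q 1)
  obtain ⟨C₂, hC₂t, hC₂⟩ := exists_lintegral_majorantSet_le hn hp1 hnp hb
  refine ⟨C₁ * (2 * (C₂ * ((1 + ((2 * L : ℝ≥0) : ℝ≥0∞)) * ((2 * L : ℝ≥0) : ℝ≥0∞)))),
    by finiteness, fun g hg hgN lam hlam => ?_⟩
  have hWm := measurableSet_majorantSet hg lam b
  have hm : ∀ s e : ℝ, Measurable fun x =>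
      ENNReal.ofReal lam * kernelInt s (majorantSet g lam b) x ^ e := fun s e =>
    ((measurable_kernelInt hWm).pow_const _).const_mul _
  have h1 := hN.extrapolation hL1 hL (hm (b * p) (1 / p)).aemeasurable hg.aemeasurable hgN
    (fun w hw hwA => hC₂ g w hg hw _ hwA lam hlam)
  calc _ ≤ N (fun x => C₁ * (ENNReal.ofReal lam *
          kernelInt (b * p) (majorantSet g lam b) x ^ (1 / p))) := by
        refine hN.mono _ _ ((hm _ _).const_mul _).aemeasurable (hm _ _).aemeasurable
          (ae_of_all _ fun x => ?_)
        exact (mul_le_mul_right (hC₁ _ hWm x) _).trans_eq (mul_left_comm _ _ _)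
    _ ≤ _ := by
        rw [hN.const_mul hC₁t (hm _ _).aemeasurable, mul_assoc]
        gcongr

end NormBounds

/-! ### The pointwise limit -/

section PointwiseLimit

variable {n : ℕ}

/-- Local convergence in mean implies convergence in measure for the finite measure with density `k`. -/
theorem tendstoInMeasure_of_lintegral_ball {k : Rn n → ℝ≥0∞}
    (hkt : ∫⁻ z, k z ≠ ⊤) {H : ℕ → Rn n → ℝ} {h : Rn n → ℝ} (hH : ∀ i, Measurable (H i))
    (hh : Measurable h)
    (hconv : ∀ R : ℝ, 0 < R →
      Tendsto (fun i => ∫⁻ z in Metric.ball 0 R, ‖H i z - h z‖ₑ) atTop (𝓝 0)) :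
    TendstoInMeasure (volume.withDensity k) H atTop h := by
  intro ε hε
  set ν := (volume : Measure (Rn n)).withDensity k with hν
  have : IsFiniteMeasure ν := isFiniteMeasure_withDensity hkt
  -- it suffices to treat finite thresholds
  wlog hεt : ε ≠ ⊤ generalizing ε
  · refine tendsto_of_tendsto_of_tendsto_of_le_of_le tendsto_const_nhds
      (this 1 one_pos (by simp)) (fun _ => zero_le) fun i => measure_mono fun z hz => ?_
    rw [mem_ofPred_eq] at hz ⊢
    exact le_trans (by simp at hεt; simp [hεt]) hz
  rw [ENNReal.tendsto_nhds_zero]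
  intro δ hδ
  have hδ2 : 0 < δ / 2 := ENNReal.half_pos hδ.ne'
  have htail : Tendsto (ν ∘ fun m : ℕ => (Metric.ball (0 : Rn n) m)ᶜ) atTop
      (𝓝 (ν (⋂ m : ℕ, (Metric.ball (0 : Rn n) m)ᶜ))) :=
    tendsto_measure_iInter_atTop (fun m => measurableSet_ball.compl.nullMeasurableSet)
      (fun a b hab => compl_subset_compl.2 (Metric.ball_subset_ball (by exact_mod_cast hab)))
      ⟨0, measure_ne_top _ _⟩
  have hempty : (⋂ m : ℕ, (Metric.ball (0 : Rn n) m)ᶜ) = ∅ := by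
    rw [← compl_iUnion, Metric.iUnion_ball_nat, compl_univ]
  rw [hempty, measure_empty] at htail
  obtain ⟨m, hm, hm0⟩ := ((htail.eventually (ge_mem_nhds hδ2)).and (eventually_gt_atTop 0)).exists
  obtain ⟨η, hη, hηk⟩ := exists_pos_setLIntegral_lt_of_measure_lt hkt hδ2.ne'
  have hev := (hconv m (by exact_mod_cast hm0)).eventually (gt_mem_nhds
    (ENNReal.mul_pos hε.ne' hη.ne'))
  filter_upwards [hev] with i hi
  set S := {z | ε ≤ edist (H i z) (h z)} with hS
  have hSm : MeasurableSet S :=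
    measurableSet_le measurable_const ((hH i).edist hh)
  have hvol : volume (S ∩ Metric.ball 0 m) < η := by
    have h1 := mul_meas_ge_le_lintegral₀ (μ := volume.restrict (Metric.ball (0 : Rn n) m))
      (f := fun z => ‖H i z - h z‖ₑ) ((hH i).sub hh).enorm.aemeasurable ε
    have h2 : {z | ε ≤ ‖H i z - h z‖ₑ} = S := by
      ext z
      rw [hS, mem_ofPred_eq, mem_ofPred_eq, edist_eq_enorm_sub]
    rw [h2, Measure.restrict_apply hSm] at h1
    exact lt_of_mul_lt_mul_left' (h1.trans_lt hi)
  calc ν S ≤ ν ((Metric.ball (0 : Rn n) m)ᶜ) + ν (S ∩ Metric.ball 0 m) := by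
        refine (measure_mono fun z hz => ?_).trans (measure_union_le _ _)
        by_cases hzm : z ∈ Metric.ball (0 : Rn n) m
        · exact Or.inr ⟨hz, hzm⟩
        · exact Or.inl hzm
    _ ≤ δ / 2 + δ / 2 := by
        refine add_le_add hm ?_
        rw [hν, withDensity_apply _ (hSm.inter measurableSet_ball)]
        exact (hηk _ hvol).le
    _ = δ := ENNReal.add_halves δ

theorem tendsto_measure_lt_abs {ν : Measure (Rn n)} [IsFiniteMeasure ν] {H : ℕ → Rn n → ℝ}
    {h a : Rn n → ℝ} (hH : ∀ i, Measurable (H i)) (hh : Measurable h) (ha : Measurable a)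
    (hconv : TendstoInMeasure ν H atTop h) (hnull : ∀ᵐ z ∂ν, a z ≠ |h z|) :
    Tendsto (fun i => ν {z | a z < |H i z|}) atTop (𝓝 (ν {z | a z < |h z|})) := by
  refine tendsto_of_subseq_tendsto fun ns hns => ?_
  have h1 : TendstoInMeasure ν (fun i => H (ns i)) atTop h := fun ε hε => (hconv ε hε).comp hns
  obtain ⟨ms, -, hms⟩ := h1.exists_seq_tendsto_ae
  refine ⟨ms, ?_⟩
  have hmeas : ∀ H : Rn n → ℝ, Measurable H → MeasurableSet {z | a z < |H z|} := fun H hH =>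
    measurableSet_lt ha hH.norm
  have h2 := tendsto_lintegral_of_dominated_convergence (μ := ν)
    (F := fun i => {z | a z < |H (ns (ms i)) z|}.indicator 1)
    (f := {z | a z < |h z|}.indicator 1) (fun _ => 1)
    (fun i => measurable_one.indicator (hmeas _ (hH _)))
    (fun i => ae_of_all _ fun z => indicator_le_self' (fun _ _ => zero_le) z)
    (by simp) ?_
  · simpa only [lintegral_indicator_one (hmeas _ (hH _)), lintegral_indicator_one (hmeas _ hh)]
      using h2
  · filter_upwards [hms, hnull] with z hz hne
    have habs := hz.abs
    refine tendsto_nhds_of_eventually_eq ?_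
    rcases lt_or_gt_of_ne hne with hlt | hgt
    · filter_upwards [habs.eventually (lt_mem_nhds hlt)] with i hi
      rw [indicator_of_mem (show z ∈ {z | a z < |H (ns (ms i)) z|} from hi),
        indicator_of_mem (show z ∈ {z | a z < |h z|} from hlt)]
    · filter_upwards [habs.eventually (gt_mem_nhds hgt)] with i hi
      rw [indicator_of_notMem (show z ∉ {z | a z < |H (ns (ms i)) z|} from hi.not_gt),
        indicator_of_notMem (show z ∉ {z | a z < |h z|} from hgt.not_gt)]

/-- The kernel integral over a truncated level set, in the coordinates `y = x + r z` with
`lam * r ^ b = 1`. -/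
theorem kernelInt_levelSet_rescale (hn : 1 ≤ n) {γ q : ℝ} (hγ : γ ≠ 0) (hq : 0 < q) (f : Rn n → ℝ)
    {D : Rn n → ℝ≥0∞} {x : Rn n} (hD : D x ≠ ⊤) {lam r : ℝ} (hlam : 0 < lam)
    (hr : r = lam ^ (-1 / (γ / q))) :
    ENNReal.ofReal (lam ^ q) *
      kernelInt γ (levelSet f lam (γ / q) ∩ truncSet D lam (γ / q)) x =
    ∫⁻ z, {z | ‖z‖ ^ (1 + γ / q) < |(f (x + r • z) - f x) / r|}.indicator
      ({z : Rn n | ‖z‖ ^ (γ / q) < (D x).toReal}.indicator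
        fun z => ENNReal.ofReal (‖z‖ ^ (γ - n))) z := by
  have := nontrivial_Rn hn
  set b := γ / q with hb
  have hb0 : b ≠ 0 := div_ne_zero hγ hq.ne'
  have hr0 : 0 < r := by rw [hr]; positivity
  have hlr : lam * r ^ b = 1 := by
    rw [hr, ← Real.rpow_mul hlam.le, div_mul_cancel₀ _ hb0, Real.rpow_neg_one,
      mul_inv_cancel₀ hlam.ne']
  have hlrq : lam ^ q * r ^ γ = 1 := by
    have : r ^ γ = (r ^ b) ^ q := by
      rw [← Real.rpow_mul hr0.le, hb, div_mul_cancel₀ _ hq.ne']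
    rw [this, ← Real.mul_rpow hlam.le (by positivity), hlr, Real.one_rpow]
  rw [kernelInt, lintegral_comp_add_smul _ x hr0, ← mul_assoc,
    ← ENNReal.ofReal_mul (by positivity), ← lintegral_const_mul' _ _ ENNReal.ofReal_ne_top]
  refine lintegral_congr_ae ?_
  have hne : ∀ᵐ z ∂(volume : Measure (Rn n)), z ≠ 0 := by simp [ae_iff]
  filter_upwards [hne] with z hz
  have hz0 : 0 < ‖z‖ := norm_pos_iff.2 hz
  have hnorm : ‖x - (x + r • z)‖ = r * ‖z‖ := by
    rw [sub_add_cancel_left, norm_neg, norm_smul, Real.norm_of_nonneg hr0.le]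
  have hlevel : (x, x + r • z) ∈ levelSet f lam b ↔
      ‖z‖ ^ (1 + b) < |(f (x + r • z) - f x) / r| := by
    have hx : x ≠ x + r • z := fun h => by
      rw [left_eq_add] at h
      exact (smul_ne_zero hr0.ne' hz) h
    have h1 : lam * (r * ‖z‖) ^ (1 + b) = r * ‖z‖ ^ (1 + b) := by
      rw [Real.mul_rpow hr0.le hz0.le, Real.rpow_add hr0, Real.rpow_one]
      calc lam * (r * r ^ b * ‖z‖ ^ (1 + b)) = (lam * r ^ b) * (r * ‖z‖ ^ (1 + b)) := by ring
        _ = _ := by rw [hlr, one_mul]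
    constructor
    · rintro ⟨-, h⟩
      dsimp only at h
      rw [hnorm, lt_div_iff₀ (by positivity), h1] at h
      rw [abs_div, abs_of_pos hr0, lt_div_iff₀' hr0, abs_sub_comm]
      exact h
    · intro h
      refine ⟨hx, ?_⟩
      dsimp only
      rw [abs_div, abs_of_pos hr0, lt_div_iff₀' hr0, abs_sub_comm] at h
      rw [hnorm, lt_div_iff₀ (by positivity), h1]
      exact h
  have htrunc : (x, x + r • z) ∈ truncSet D lam b ↔ ‖z‖ ^ b < (D x).toReal := by
    rw [truncSet, mem_ofPred_eq]
    dsimp only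
    rw [hnorm, Real.mul_rpow hr0.le hz0.le, ← mul_assoc, hlr, one_mul,
      ENNReal.ofReal_lt_iff_lt_toReal (by positivity) hD]
  have hval : lam ^ q * r ^ n * (r * ‖z‖) ^ (γ - n) = ‖z‖ ^ (γ - n) := by
    rw [Real.mul_rpow hr0.le hz0.le, Real.rpow_sub hr0, Real.rpow_natCast]
    have : (0 : ℝ) < r ^ n := by positivity
    calc lam ^ q * r ^ n * (r ^ γ / r ^ n * ‖z‖ ^ (γ - n)) = lam ^ q * r ^ γ * ‖z‖ ^ (γ - n) := by
          field_simp
      _ = _ := by rw [hlrq, one_mul]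
  have hlevel' : (x, x + r • z) ∈ levelSet f lam b ↔
      z ∈ {z : Rn n | ‖z‖ ^ (1 + b) < |(f (x + r • z) - f x) / r|} := hlevel
  have htrunc' : (x, x + r • z) ∈ truncSet D lam b ↔
      z ∈ {z : Rn n | ‖z‖ ^ b < (D x).toReal} := htrunc
  by_cases h1 : (x, x + r • z) ∈ levelSet f lam b
  · by_cases h2 : (x, x + r • z) ∈ truncSet D lam b
    · rw [indicator_of_mem (mem_inter h1 h2), indicator_of_mem (hlevel'.1 h1),
        indicator_of_mem (htrunc'.1 h2)]
      dsimp only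
      rw [hnorm, ← ENNReal.ofReal_mul (by positivity), hval]
    · rw [indicator_of_notMem (fun h => h2 h.2), indicator_of_mem (hlevel'.1 h1),
        indicator_of_notMem (fun h => h2 (htrunc'.2 h)), mul_zero]
  · rw [indicator_of_notMem (fun h => h1 h.1),
      indicator_of_notMem (fun h => h1 (hlevel'.2 h)), mul_zero]

theorem limitRegion_subset {v z : Rn n} {b : ℝ} (hz0 : z ≠ 0) (hz : z ∈ limitRegion v b) :
    ‖z‖ ^ b < ‖v‖ := by
  have h0 : 0 < ‖z‖ := norm_pos_iff.2 hz0
  have h1 : ‖z‖ ^ (1 + b) < |inner ℝ v z| := hz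
  rw [Real.rpow_add h0, Real.rpow_one] at h1
  have h2 := h1.trans_le ((abs_real_inner_le_norm v z).trans_eq (mul_comm _ _))
  exact lt_of_mul_lt_mul_left h2 h0.le

/-- The limit of the rescaled kernel integrals over truncated level sets at a point where the
difference quotients of `f` converge locally in mean to the linear map given by `v`. -/
theorem tendsto_kernelInt_truncSet (hn : 1 ≤ n) {γ q : ℝ} (hγ : γ ≠ 0) (hq : 0 < q)
    {f : Rn n → ℝ} (hf : Measurable f) {D : Rn n → ℝ≥0∞} {x v e : Rn n} (he : ‖e‖ = 1)
    (hD : D x ≠ ⊤)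
    (hx : ∀ R : ℝ, 0 < R → Tendsto (fun r : ℝ => ∫⁻ z in Metric.ball 0 R,
        ‖(f (x + r • z) - f x) / r - inner ℝ v z‖ₑ) (𝓝[>] 0) (𝓝 0))
    {lam : ℕ → ℝ} (hlam : ∀ i, 0 < lam i)
    (hlim : Tendsto (fun i => lam i ^ (-1 / (γ / q))) atTop (𝓝 0)) :
    Tendsto (fun i => ENNReal.ofReal (lam i ^ q) *
      kernelInt γ (levelSet f (lam i) (γ / q) ∩ truncSet D (lam i) (γ / q)) x) atTop
      (𝓝 (∫⁻ z in limitRegion v (γ / q) ∩ {z : Rn n | ‖z‖ ^ (γ / q) < (D x).toReal},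
        ENNReal.ofReal (‖z‖ ^ (γ - n)))) := by
  set b := γ / q with hb
  have hb0 : b ≠ 0 := div_ne_zero hγ hq.ne'
  have hγb : γ / b = q := by rw [hb]; field_simp
  set U := {z : Rn n | ‖z‖ ^ b < (D x).toReal} with hU
  have hUm : MeasurableSet U := measurableSet_lt (by fun_prop) measurable_const
  set k : Rn n → ℝ≥0∞ := U.indicator fun z => ENNReal.ofReal (‖z‖ ^ (γ - n)) with hk
  have hkm : Measurable k := Measurable.indicator (by fun_prop) hUm
  have hkt : ∫⁻ z, k z ≠ ⊤ := by
    rw [hk, lintegral_indicator hUm, lintegral_radial hn (by rw [hγb]; exact hq) (by positivity)]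
    exact ENNReal.mul_ne_top ENNReal.ofReal_ne_top (measure_ne_top _ _)
  set ν := (volume : Measure (Rn n)).withDensity k with hν
  have : IsFiniteMeasure ν := isFiniteMeasure_withDensity hkt
  have hr0 : ∀ i, 0 < lam i ^ (-1 / b) := fun i => Real.rpow_pos_of_pos (hlam i) _
  have hlim' : Tendsto (fun i => lam i ^ (-1 / b)) atTop (𝓝[>] 0) :=
    tendsto_nhdsWithin_iff.2 ⟨hlim, Eventually.of_forall hr0⟩
  set H : ℕ → Rn n → ℝ := fun i z =>
    (f (x + (lam i ^ (-1 / b)) • z) - f x) / lam i ^ (-1 / b) with hH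
  have hHm : ∀ i, Measurable (H i) := fun i => by
    have h1 : Measurable fun z : Rn n => x + (lam i ^ (-1 / b)) • z := by fun_prop
    exact ((hf.comp h1).sub_const _).div_const _
  have hhm : Measurable fun z : Rn n => (inner ℝ v z : ℝ) := by fun_prop
  have ham : Measurable fun z : Rn n => ‖z‖ ^ (1 + b) := by fun_prop
  have hmeas : TendstoInMeasure ν H atTop fun z => inner ℝ v z :=
    tendstoInMeasure_of_lintegral_ball hkt hHm hhm fun R hR => (hx R hR).comp hlim'
  -- the boundary of the limit region is a null set, since its open and closed versions have the
  -- same finite mass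
  have hnull : ∀ᵐ z ∂ν, ‖z‖ ^ (1 + b) ≠ |inner ℝ v z| := by
    obtain ⟨h1, h2⟩ := lintegral_limitRegion hn (b := b) (s := γ) (by rw [hγb]; exact hq) he v
    set κ : Measure (Rn n) :=
      (volume : Measure (Rn n)).withDensity fun z => ENNReal.ofReal (‖z‖ ^ (γ - n)) with hκ
    have hO := measurableSet_limitRegion v b
    have hCl := measurableSet_limitRegionClosed v b
    rw [← withDensity_apply _ hO] at h1
    rw [← withDensity_apply _ hCl] at h2
    have h3 : κ (limitRegionClosed v b \ limitRegion v b) = 0 := by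
      have hfin : κ (limitRegion v b) ≠ ⊤ := by
        rw [hκ, h1]
        finiteness
      have hsub : limitRegion v b ⊆ limitRegionClosed v b := fun z hz =>
        le_of_lt (show ‖z‖ ^ (1 + b) < |inner ℝ v z| from hz)
      rw [measure_sdiff hsub hO.nullMeasurableSet hfin, hκ, h1, h2, tsub_self]
    have hle : ν ≤ κ := withDensity_mono (ae_of_all _ fun z => indicator_le_self' (fun _ _ => zero_le) z)
    have h4 : ν (limitRegionClosed v b \ limitRegion v b) = 0 := le_antisymm ((hle _).trans_eq h3) zero_le
    rw [ae_iff]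
    refine measure_mono_null (fun z hz => ?_) h4
    simp only [mem_ofPred_eq, not_not] at hz
    exact ⟨hz.le, hz.not_lt⟩
  have hmain := tendsto_measure_lt_abs hHm hhm ham hmeas hnull
  have hlhs : ∀ i, ENNReal.ofReal (lam i ^ q) *
      kernelInt γ (levelSet f (lam i) b ∩ truncSet D (lam i) b) x =
      ν {z | ‖z‖ ^ (1 + b) < |H i z|} := by
    intro i
    have hS : MeasurableSet {z | ‖z‖ ^ (1 + b) < |H i z|} := measurableSet_lt ham (hHm i).norm
    rw [kernelInt_levelSet_rescale hn hγ hq f hD (hlam i) rfl, hν, withDensity_apply _ hS,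
      lintegral_indicator hS]
  have hrhs : ∫⁻ z in limitRegion v b ∩ U, ENNReal.ofReal (‖z‖ ^ (γ - n)) =
      ν {z | ‖z‖ ^ (1 + b) < |inner ℝ v z|} := by
    have hS : MeasurableSet {z : Rn n | ‖z‖ ^ (1 + b) < |inner ℝ v z|} :=
      measurableSet_lt ham hhm.norm
    rw [hν, withDensity_apply _ hS, hk, setLIntegral_indicator hUm, inter_comm]
    rfl
  rw [hrhs]
  exact hmain.congr fun i => (hlhs i).symm

theorem limit_root_eq {γ q κ a : ℝ} (hq : 0 < q) (hκ : 0 ≤ κ) (ha : 0 ≤ a) :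
    (ENNReal.ofReal (κ / |γ|) * ENNReal.ofReal (a ^ q)) ^ (1 / q) =
      ENNReal.ofReal ((κ / |γ|) ^ (1 / q)) * ENNReal.ofReal a := by
  rw [ENNReal.mul_rpow_of_nonneg _ _ (by positivity),
    ENNReal.ofReal_rpow_of_nonneg (by positivity) (by positivity),
    ENNReal.ofReal_rpow_of_nonneg (by positivity) (by positivity), ← Real.rpow_mul ha,
    mul_one_div_cancel hq.ne', Real.rpow_one]

/-- The limit over truncated level sets does not exceed the full limit, and agrees with it once the
truncation height reaches the length of the gradient. -/
theorem exists_tendsto_truncSet (hn : 1 ≤ n) {γ q : ℝ} (hγ : γ ≠ 0) (hq : 0 < q)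
    {f : Rn n → ℝ} (hf : Measurable f) {D : Rn n → ℝ≥0∞} {x v e : Rn n} (he : ‖e‖ = 1)
    (hD : D x ≠ ⊤)
    (hx : ∀ R : ℝ, 0 < R → Tendsto (fun r : ℝ => ∫⁻ z in Metric.ball 0 R,
        ‖(f (x + r • z) - f x) / r - inner ℝ v z‖ₑ) (𝓝[>] 0) (𝓝 0))
    {lam : ℕ → ℝ} (hlam : ∀ i, 0 < lam i)
    (hlim : Tendsto (fun i => lam i ^ (-1 / (γ / q))) atTop (𝓝 0)) :
    ∃ I : ℝ≥0∞, I ≤ ENNReal.ofReal ((kappa q e / |γ|) ^ (1 / q)) * ‖v‖ₑ ∧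
      (‖v‖ₑ ≤ D x → I = ENNReal.ofReal ((kappa q e / |γ|) ^ (1 / q)) * ‖v‖ₑ) ∧
      Tendsto (fun i => ENNReal.ofReal (lam i) *
        kernelInt γ (levelSet f (lam i) (γ / q) ∩ truncSet D (lam i) (γ / q)) x ^ (1 / q)) atTop
        (𝓝 I) := by
  have := nontrivial_Rn hn
  have hγb : γ / (γ / q) = q := by field_simp
  have h0 := (lintegral_limitRegion hn (b := γ / q) (s := γ) (by rw [hγb]; exact hq) he v).1
  rw [hγb] at h0
  have h1 := limit_root_eq (γ := γ) (κ := kappa q e) (a := ‖v‖) hq (kappa_nonneg q e) (norm_nonneg v)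
  rw [← h0, ofReal_norm] at h1
  refine ⟨(∫⁻ z in limitRegion v (γ / q) ∩ {z : Rn n | ‖z‖ ^ (γ / q) < (D x).toReal},
        ENNReal.ofReal (‖z‖ ^ (γ - n))) ^ (1 / q), ?_, fun hvD => ?_, ?_⟩
  · rw [← h1]
    exact ENNReal.rpow_le_rpow (lintegral_mono_set inter_subset_left) (by positivity)
  · rw [← h1]
    congr 1
    refine setLIntegral_congr ?_
    have hne : ∀ᵐ z ∂(volume : Measure (Rn n)), z ≠ 0 := by simp [ae_iff]
    filter_upwards [hne] with z hz
    refine propext ⟨fun h => h.1, fun h => ⟨h, ?_⟩⟩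
    refine (limitRegion_subset hz h).trans_le ?_
    rwa [← ofReal_norm, ENNReal.ofReal_le_iff_le_toReal hD] at hvD
  · simp_rw [fun i => ofReal_mul_rpow_inv (hlam i) hq]
    exact ((ENNReal.continuous_rpow_const).tendsto _).comp
      (tendsto_kernelInt_truncSet hn hγ hq hf he hD hx hlam hlim)

end PointwiseLimit

/-! ### Limits of the functionals -/

section Limits

variable {n : ℕ} {N : FunctionNorm n}

theorem measurableSet_levelSet {f : Rn n → ℝ} (hf : Measurable f) (lam b : ℝ) :
    MeasurableSet (levelSet f lam b) := by
  have h1 : Measurable fun z : Rn n × Rn n => |f z.1 - f z.2| :=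
    ((hf.comp measurable_fst).sub (hf.comp measurable_snd)).norm
  have h2 : Measurable fun z : Rn n × Rn n => ‖z.1 - z.2‖ ^ (1 + b) := by fun_prop
  exact (measurableSet_eq_fun measurable_fst measurable_snd).compl.inter
    (measurableSet_lt measurable_const (h1.div h2))

theorem functional_eq (hN : IsBallBanach N) {γ q : ℝ} {f : Rn n → ℝ} (hf : Measurable f) (lam : ℝ) :
    functional N γ q f lam =
      N (fun x => ENNReal.ofReal lam * kernelInt γ (levelSet f lam (γ / q)) x ^ (1 / q)) := by
  rw [hN.const_mul ENNReal.ofReal_ne_top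
    ((measurable_kernelInt (measurableSet_levelSet hf _ _)).pow_const _).aemeasurable]
  rfl

/-- The lower bound, by Fatou's lemma in the function space: at almost every point the truncated kernel
integrals converge to the full limit once the truncation height exceeds the length of the gradient. -/
theorem le_liminf_functional (hN : IsBallBanach N) (hn : 1 ≤ n) {γ q : ℝ} (hγ : γ ≠ 0) (hq : 0 < q)
    {f : Rn n → ℝ} (hf : Measurable f) {g : Rn n → Rn n} (hg : Measurable g)
    {e : Rn n} (he : ‖e‖ = 1)
    (hx : ∀ᵐ x ∂(volume : Measure (Rn n)), ∀ R : ℝ, 0 < R →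
      Tendsto (fun r : ℝ => ∫⁻ z in Metric.ball 0 R,
        ‖(f (x + r • z) - f x) / r - inner ℝ (g x) z‖ₑ) (𝓝[>] 0) (𝓝 0))
    {lam : ℕ → ℝ} (hlam : ∀ i, 0 < lam i)
    (hlim : Tendsto (fun i => lam i ^ (-1 / (γ / q))) atTop (𝓝 0)) :
    ENNReal.ofReal ((kappa q e / |γ|) ^ (1 / q)) * N (fun x => ‖g x‖ₑ) ≤
      liminf (fun i => functional N γ q f (lam i)) atTop := by
  set F : ℕ → Rn n → ℝ≥0∞ := fun i x =>
    ENNReal.ofReal (lam i) * kernelInt γ (levelSet f (lam i) (γ / q)) x ^ (1 / q) with hF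
  have hFm : ∀ i, Measurable (F i) := fun i =>
    ((measurable_kernelInt (measurableSet_levelSet hf _ _)).pow_const _).const_mul _
  simp_rw [functional_eq hN hf]
  refine le_trans ?_ (hN.liminf_le fun i => (hFm i).aemeasurable)
  rw [← hN.const_mul ENNReal.ofReal_ne_top hg.enorm.aemeasurable]
  refine hN.mono _ _ (Measurable.liminf hFm).aemeasurable
    (hg.enorm.const_mul _).aemeasurable ?_
  filter_upwards [hx] with x hx
  obtain ⟨I, -, hI, hlimI⟩ := exists_tendsto_truncSet hn hγ hq hf (D := fun y => ‖g y‖ₑ)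
    (x := x) (v := g x) he enorm_ne_top hx hlam hlim
  rw [← hI le_rfl, ← hlimI.liminf_eq]
  refine liminf_le_liminf (Eventually.of_forall fun i => ?_)
  exact mul_le_mul_right (ENNReal.rpow_le_rpow (kernelInt_mono inter_subset_left x)
    (by positivity)) _

/-- A quasi-triangle inequality whose constant at `a` tends to one as `t → 0`. -/
theorem add_rpow_le_weighted (a b : ℝ≥0∞) {s : ℝ} (hs : 0 ≤ s) {t : ℝ≥0∞} (ht0 : t ≠ 0)
    (htt : t ≠ ⊤) : (a + b) ^ s ≤ (1 + t) ^ s * a ^ s + (1 + t⁻¹) ^ s * b ^ s := by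
  rcases le_total b (t * a) with h | h
  · refine le_trans ?_ le_self_add
    rw [← ENNReal.mul_rpow_of_nonneg _ _ hs, add_mul, one_mul]
    gcongr
  · refine le_trans ?_ le_add_self
    rw [← ENNReal.mul_rpow_of_nonneg _ _ hs, add_mul, one_mul, add_comm]
    have : a ≤ t⁻¹ * b := by
      calc a = t⁻¹ * (t * a) := by rw [← mul_assoc, ENNReal.inv_mul_cancel ht0 htt, one_mul]
        _ ≤ _ := by gcongr
    gcongr

/-- The upper bound for the truncated level sets, by dominated convergence in a space with absolutely
continuous norm. -/
theorem limsup_truncated_le (hN : IsBallBanach N) (hac : HasAbsContNorm N) (hn : 1 ≤ n) {γ q : ℝ}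
    (hγ : γ ≠ 0) (hq : 0 < q)
    {f : Rn n → ℝ} (hf : Measurable f) {g : Rn n → Rn n} (hg : Measurable g)
    {e : Rn n} (he : ‖e‖ = 1)
    (hx : ∀ᵐ x ∂(volume : Measure (Rn n)), ∀ R : ℝ, 0 < R →
      Tendsto (fun r : ℝ => ∫⁻ z in Metric.ball 0 R,
        ‖(f (x + r • z) - f x) / r - inner ℝ (g x) z‖ₑ) (𝓝[>] 0) (𝓝 0))
    {lam : ℕ → ℝ} (hlam : ∀ i, 0 < lam i)
    (hlim : Tendsto (fun i => lam i ^ (-1 / (γ / q))) atTop (𝓝 0))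
    {D : Rn n → ℝ≥0∞} (hD : Measurable D) (hDN : N D < ⊤) :
    limsup (fun i => N fun x => ENNReal.ofReal (lam i) *
        kernelInt γ (levelSet f (lam i) (γ / q) ∩ truncSet D (lam i) (γ / q)) x ^ (1 / q)) atTop ≤
      ENNReal.ofReal ((kappa q e / |γ|) ^ (1 / q)) * N (fun x => ‖g x‖ₑ) := by
  rw [← hN.const_mul ENNReal.ofReal_ne_top hg.enorm.aemeasurable]
  have hEm : ∀ i, MeasurableSet (levelSet f (lam i) (γ / q) ∩ truncSet D (lam i) (γ / q)) := fun i =>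
    (measurableSet_levelSet hf _ _).inter (measurableSet_truncSet hD _ _)
  have hDfin := hN.ae_lt_top hD.aemeasurable hDN
  refine hN.limsup_le hac (D := fun x => radialConst n γ q * D x)
    (fun i => (((measurable_kernelInt (hEm i)).pow_const _).const_mul _).aemeasurable)
    (hD.const_mul _).aemeasurable (hg.enorm.const_mul _).aemeasurable ?_ (fun i => ?_) ?_
  · rw [hN.const_mul (radialConst_ne_top γ hq) hD.aemeasurable]
    exact ENNReal.mul_lt_top (radialConst_ne_top γ hq).lt_top hDN
  · filter_upwards [hDfin] with x hxD
    refine le_trans ?_ (functional_truncSet_le hn hγ hq (hlam i) hxD.ne)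
    exact mul_le_mul_right (ENNReal.rpow_le_rpow (kernelInt_mono inter_subset_right x)
      (by positivity)) _
  · filter_upwards [hx, hDfin] with x hx hxD
    obtain ⟨I, hI, -, hlimI⟩ := exists_tendsto_truncSet hn hγ hq hf (D := D)
      (x := x) (v := g x) he hxD.ne hx hlam hlim
    rw [hlimI.limsup_eq]
    exact hI

/-- The level sets of `f` are controlled along `l`: up to errors of arbitrarily small norm, only the
pairs `(x, y)` with `lam * |x - y| ^ (γ / q) < D x` for a majorant `D` in the space matter. -/
def TailControl (N : FunctionNorm n) (γ q : ℝ) (f : Rn n → ℝ) (l : Filter ℝ) : Prop :=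
  ∀ ε : ℝ≥0∞, 0 < ε → ∃ D : Rn n → ℝ≥0∞, Measurable D ∧ N D < ⊤ ∧
    ∃ T : ℝ → Rn n → ℝ≥0∞, (∀ lam, Measurable (T lam)) ∧ ∀ᶠ lam in l,
      (∀ᵐ x ∂(volume : Measure (Rn n)), kernelInt γ (levelSet f lam (γ / q)) x ≤
        kernelInt γ (levelSet f lam (γ / q) ∩ truncSet D lam (γ / q)) x + T lam x) ∧
      N (fun x => ENNReal.ofReal lam * T lam x ^ (1 / q)) ≤ ε

/-- The upper bound for the full level sets. The quasi-triangle inequality with parameter `t` puts the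
constant `(1 + 1/t)^{1/q}` in front of the tail, whose norm is made small depending on `t` before
`t → 0`. -/
theorem limsup_functional_le (hN : IsBallBanach N) (hac : HasAbsContNorm N) (hn : 1 ≤ n) {γ q : ℝ}
    (hγ : γ ≠ 0) (hq : 0 < q)
    {f : Rn n → ℝ} (hf : Measurable f) {g : Rn n → Rn n} (hg : Measurable g)
    (hgN : N (fun x => ‖g x‖ₑ) < ⊤) {e : Rn n} (he : ‖e‖ = 1)
    (hx : ∀ᵐ x ∂(volume : Measure (Rn n)), ∀ R : ℝ, 0 < R →
      Tendsto (fun r : ℝ => ∫⁻ z in Metric.ball 0 R,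
        ‖(f (x + r • z) - f x) / r - inner ℝ (g x) z‖ₑ) (𝓝[>] 0) (𝓝 0))
    {l : Filter ℝ} (hT : TailControl N γ q f l)
    {lam : ℕ → ℝ} (hlam : ∀ i, 0 < lam i) (hl : Tendsto lam atTop l)
    (hlim : Tendsto (fun i => lam i ^ (-1 / (γ / q))) atTop (𝓝 0)) :
    limsup (fun i => functional N γ q f (lam i)) atTop ≤
      ENNReal.ofReal ((kappa q e / |γ|) ^ (1 / q)) * N (fun x => ‖g x‖ₑ) := by
  set X := ENNReal.ofReal ((kappa q e / |γ|) ^ (1 / q)) * N (fun x => ‖g x‖ₑ) with hX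
  have hXt : X ≠ ⊤ := ENNReal.mul_ne_top ENNReal.ofReal_ne_top hgN.ne
  set s := 1 / q with hs
  have hs0 : 0 ≤ s := by positivity
  have key : ∀ t : ℝ≥0∞, t ≠ 0 → t ≠ ⊤ →
      limsup (fun i => functional N γ q f (lam i)) atTop ≤ (1 + t) ^ s * X + t := by
    intro t ht0 htt
    have hc1 : (1 + t) ^ s ≠ ⊤ := ENNReal.rpow_ne_top_of_nonneg hs0 (by finiteness)
    have hc2 : (1 + t⁻¹) ^ s ≠ ⊤ := ENNReal.rpow_ne_top_of_nonneg hs0 (by finiteness)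
    have hc3 : (1 + t⁻¹) ^ s ≠ 0 := by
      have : (1 : ℝ≥0∞) ≤ (1 + t⁻¹) ^ s := ENNReal.one_le_rpow le_self_add (by positivity)
      exact (zero_lt_one.trans_le this).ne'
    obtain ⟨D, hD, hDN, T, hTm, hev⟩ := hT (t / (1 + t⁻¹) ^ s) (ENNReal.div_pos ht0 hc2)
    set A : ℕ → Rn n → ℝ≥0∞ := fun i x => ENNReal.ofReal (lam i) *
      kernelInt γ (levelSet f (lam i) (γ / q) ∩ truncSet D (lam i) (γ / q)) x ^ s with hA
    have hAm : ∀ i, Measurable (A i) := fun i => ((measurable_kernelInt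
      ((measurableSet_levelSet hf _ _).inter (measurableSet_truncSet hD _ _))).pow_const _).const_mul _
    have hle : ∀ᶠ i in atTop, functional N γ q f (lam i) ≤ (1 + t) ^ s * N (A i) + t := by
      filter_upwards [hl.eventually hev] with i hi
      have hBm : Measurable fun x => ENNReal.ofReal (lam i) * T (lam i) x ^ s :=
        ((hTm _).pow_const _).const_mul _
      rw [functional_eq hN hf]
      calc _ ≤ N (fun x => (1 + t) ^ s * A i x +
            (1 + t⁻¹) ^ s * (ENNReal.ofReal (lam i) * T (lam i) x ^ s)) := by
            refine hN.mono _ _ (((hAm i).const_mul _).add (hBm.const_mul _)).aemeasurable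
              (((measurable_kernelInt (measurableSet_levelSet hf _ _)).pow_const _).const_mul
                _).aemeasurable ?_
            filter_upwards [hi.1] with x hx
            refine (mul_le_mul_right ((ENNReal.rpow_le_rpow hx hs0).trans
              (add_rpow_le_weighted _ _ hs0 ht0 htt)) _).trans (le_of_eq ?_)
            rw [hA]
            ring
        _ ≤ N (fun x => (1 + t) ^ s * A i x) +
            N (fun x => (1 + t⁻¹) ^ s * (ENNReal.ofReal (lam i) * T (lam i) x ^ s)) :=
            hN.add_le _ _ ((hAm i).const_mul _).aemeasurable (hBm.const_mul _).aemeasurable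
        _ ≤ _ := by
            rw [hN.const_mul hc1 (hAm i).aemeasurable, hN.const_mul hc2 hBm.aemeasurable]
            gcongr
            calc _ ≤ (1 + t⁻¹) ^ s * (t / (1 + t⁻¹) ^ s) := by gcongr; exact hi.2
              _ = t := ENNReal.mul_div_cancel hc3 hc2
    calc _ ≤ limsup (fun i => (1 + t) ^ s * N (A i) + t) atTop := limsup_le_limsup hle
      _ = limsup (fun i => (1 + t) ^ s * N (A i)) atTop + t :=
          limsup_add_const _ _ _ (by isBoundedDefault) (by isBoundedDefault)
      _ ≤ _ := by
          rw [ENNReal.limsup_const_mul_of_ne_top hc1]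
          gcongr
          exact limsup_truncated_le hN hac hn hγ hq hf hg he hx hlam hlim hD hDN
  have ht : Tendsto (fun k : ℕ => ((k : ℝ≥0∞) + 1)⁻¹) atTop (𝓝 0) := by
    have := (ENNReal.tendsto_inv_nat_nhds_zero).comp (tendsto_add_atTop_nat 1)
    refine this.congr fun k => ?_
    simp
  have hlimit : Tendsto (fun k : ℕ => (1 + ((k : ℝ≥0∞) + 1)⁻¹) ^ s * X + ((k : ℝ≥0∞) + 1)⁻¹) atTop
      (𝓝 ((1 + 0) ^ s * X + 0)) := by
    refine Tendsto.add (ENNReal.Tendsto.mul_const ?_ (Or.inr hXt)) ht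
    exact (ENNReal.continuous_rpow_const.tendsto _).comp (tendsto_const_nhds.add ht)
  rw [add_zero, add_zero, ENNReal.one_rpow, one_mul] at hlimit
  exact ge_of_tendsto' hlimit fun k => key _ (by simp) (by simp)

/-- Under tail control the functionals converge to the gradient norm. -/
theorem tendsto_functional (hN : IsBallBanach N) (hac : HasAbsContNorm N) (hn : 1 ≤ n) {γ q : ℝ}
    (hγ : γ ≠ 0) (hq : 0 < q)
    {f : Rn n → ℝ} (hf : Measurable f) {g : Rn n → Rn n} (hg : Measurable g)
    (hfg : HasWeakGradient f g)
    (hgN : N (fun x => ‖g x‖ₑ) < ⊤) {e : Rn n} (he : ‖e‖ = 1)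
    {l : Filter ℝ} [l.IsCountablyGenerated] (hT : TailControl N γ q f l)
    (hpos : ∀ᶠ lam in l, 0 < lam) (hlim : Tendsto (fun lam => lam ^ (-1 / (γ / q))) l (𝓝 0)) :
    Tendsto (functional N γ q f) l
      (𝓝 (ENNReal.ofReal ((kappa q e / |γ|) ^ (1 / q)) * N (fun x => ‖g x‖ₑ))) := by
  have hx := hfg.ae_tendsto_increment hg hf
  refine tendsto_of_subseq_tendsto fun u hu => ?_
  obtain ⟨m, hm⟩ := eventually_atTop.1 (hu.eventually hpos)
  have hu' : Tendsto (fun i => u (i + m)) atTop l := hu.comp (tendsto_add_atTop_nat m)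
  have hpos' : ∀ i, 0 < u (i + m) := fun i => hm _ (Nat.le_add_left _ _)
  refine ⟨fun i => i + m, tendsto_of_le_liminf_of_limsup_le ?_ ?_⟩
  · exact le_liminf_functional hN hn hγ hq hf hg he hx hpos' (hlim.comp hu')
  · exact limsup_functional_le hN hac hn hγ hq hf hg hgN he hx hT hpos' hu' (hlim.comp hu')

/-- The lower bound for the supremum of the functionals. -/
theorem le_iSup_functional (hN : IsBallBanach N) (hn : 1 ≤ n) {γ q : ℝ}
    (hγ : γ ≠ 0) (hq : 0 < q)
    {f : Rn n → ℝ} (hf : Measurable f) {g : Rn n → Rn n} (hg : Measurable g)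
    (hfg : HasWeakGradient f g) {e : Rn n} (he : ‖e‖ = 1) :
    ENNReal.ofReal ((kappa q e / |γ|) ^ (1 / q)) * N (fun x => ‖g x‖ₑ) ≤
      ⨆ (lam : ℝ) (_ : 0 < lam), functional N γ q f lam := by
  set b := γ / q with hb
  have hb0 : b ≠ 0 := div_ne_zero hγ hq.ne'
  -- a sequence with `lam ^ (-1 / b) = 1 / (i + 1)`
  set lam : ℕ → ℝ := fun i => (1 / ((i : ℝ) + 1)) ^ (-b) with hlam
  have hpos : ∀ i, 0 < lam i := fun i => by positivity
  have hlim : Tendsto (fun i => lam i ^ (-1 / b)) atTop (𝓝 0) := by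
    refine tendsto_one_div_add_atTop_nhds_zero_nat.congr fun i => ?_
    rw [hlam]
    dsimp only
    rw [← Real.rpow_mul (by positivity), show -b * (-1 / b) = 1 by field_simp, Real.rpow_one]
  refine (le_liminf_functional hN hn hγ hq hf hg he (hfg.ae_tendsto_increment hg hf) hpos
    hlim).trans ?_
  refine (liminf_le_liminf (Eventually.of_forall fun i => ?_)).trans_eq
    (liminf_const (⨆ (lam : ℝ) (_ : 0 < lam), functional N γ q f lam))
  exact le_iSup₂_of_le (lam i) (hpos i) le_rfl

end Limits

/-! ### Decay at infinity and control of tails -/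

section Tails

variable {n : ℕ} {N : FunctionNorm n}

/-- The norms of indicators of large balls grow at most like the volume. -/
theorem exists_indicator_ball_le (hN : IsBallBanach N)
    (havg : ∃ C : ℝ≥0, ∀ r : ℝ, 0 < r → BoundedBy (ballAverage r) N C) :
    ∃ C : ℝ≥0∞, C ≠ ⊤ ∧ ∀ r : ℝ, 1 ≤ r →
      N ((Metric.ball (0 : Rn n) r).indicator 1) ≤ C * ENNReal.ofReal (r ^ n) := by
  obtain ⟨C, hC⟩ := havg
  set φ : Rn n → ℝ≥0∞ := (Metric.ball (0 : Rn n) 1).indicator 1 with hφ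
  have hφm : Measurable φ := measurable_one.indicator measurableSet_ball
  have hφN : N φ < ⊤ := hN.ball_mem 0 1 one_pos
  refine ⟨ENNReal.ofReal (2 ^ n) * (C * N φ), by finiteness, fun r hr => ?_⟩
  have hr0 : 0 < r := by linarith
  have hpt : ∀ x, (Metric.ball (0 : Rn n) r).indicator 1 x ≤
      ENNReal.ofReal ((2 * r) ^ n) * ballAverage (2 * r) φ x := by
    intro x
    by_cases hx : x ∈ Metric.ball (0 : Rn n) r
    · have h1 : ballAverage 1 φ 0 ≤ ENNReal.ofReal ((2 * r) ^ n) * ballAverage (2 * r) φ x := by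
        refine ballAverage_le_of_subset one_pos (Metric.ball_subset_ball' ?_) (by positivity)
          (by rw [mul_one])
        rw [Metric.mem_ball, dist_comm] at hx
        linarith
      have h2 : ballAverage 1 φ (0 : Rn n) = 1 := by
        rw [ballAverage_eq, hφ, lintegral_indicator_one measurableSet_ball,
          Measure.restrict_apply measurableSet_ball, inter_self,
          ENNReal.div_self volume_unitBall_ne_zero volume_unitBall_ne_top]
      rw [indicator_of_mem hx]
      exact h2.symm.trans_le h1
    · rw [indicator_of_notMem hx]
      exact zero_le
  have hm : Measurable (ballAverage (2 * r) φ) := measurable_ballAverage hφm _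
  calc _ ≤ N (fun x => ENNReal.ofReal ((2 * r) ^ n) * ballAverage (2 * r) φ x) :=
        hN.mono _ _ (hm.const_mul _).aemeasurable
          (measurable_one.indicator measurableSet_ball).aemeasurable (ae_of_all _ hpt)
    _ ≤ ENNReal.ofReal ((2 * r) ^ n) * (C * N φ) := by
        rw [hN.const_mul ENNReal.ofReal_ne_top hm.aemeasurable]
        gcongr
        exact hC _ (by positivity) φ hφm.aemeasurable hφN
    _ = _ := by
        rw [mul_pow, ENNReal.ofReal_mul (by positivity)]
        ring

/-- Powers decaying faster than the reciprocal of the volume belong to the space near infinity. -/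
theorem power_norm_lt_top (hN : IsBallBanach N)
    (havg : ∃ C : ℝ≥0, ∀ r : ℝ, 0 < r → BoundedBy (ballAverage r) N C) {a : ℝ} (ha : a < -n) :
    N ({x : Rn n | 1 ≤ ‖x‖}.indicator fun x => ENNReal.ofReal (‖x‖ ^ a)) < ⊤ := by
  obtain ⟨C, hCt, hC⟩ := exists_indicator_ball_le hN havg
  have ha0 : a < 0 := ha.trans_le (by simp)
  set F : ℕ → Rn n → ℝ≥0∞ := fun k x => ENNReal.ofReal (((2 : ℝ) ^ k) ^ a) *
    (Metric.ball (0 : Rn n) (2 ^ (k + 1))).indicator 1 x with hF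
  have h1m : ∀ r : ℝ, Measurable ((Metric.ball (0 : Rn n) r).indicator (1 : Rn n → ℝ≥0∞)) :=
    fun r => measurable_one.indicator measurableSet_ball
  have hFm : ∀ k, Measurable (F k) := fun k => (h1m _).const_mul _
  have hAm : MeasurableSet {x : Rn n | 1 ≤ ‖x‖} := measurableSet_le measurable_const measurable_norm
  have hpt : ∀ x, ({x : Rn n | 1 ≤ ‖x‖}.indicator fun x => ENNReal.ofReal (‖x‖ ^ a)) x ≤
      ∑' k, F k x := by
    intro x
    by_cases hx : x ∈ {x : Rn n | 1 ≤ ‖x‖}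
    · obtain ⟨k, hk1, hk2⟩ := exists_nat_pow_near (show 1 ≤ ‖x‖ from hx) (one_lt_two : (1 : ℝ) < 2)
      rw [indicator_of_mem hx]
      refine le_trans ?_ (ENNReal.le_tsum k)
      rw [hF]
      dsimp only
      rw [indicator_of_mem (by rwa [mem_ball_zero_iff]), Pi.one_apply, mul_one]
      exact ENNReal.ofReal_le_ofReal
        (Real.rpow_le_rpow_of_nonpos (by positivity) hk1 ha0.le)
    · rw [indicator_of_notMem hx]
      exact zero_le
  have hsum : Summable fun k : ℕ => ((2 : ℝ) ^ (a + n)) ^ k :=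
    summable_geometric_of_lt_one (by positivity)
      (Real.rpow_lt_one_of_one_lt_of_neg one_lt_two (by linarith))
  calc _ ≤ N (fun x => ∑' k, F k x) :=
        hN.mono _ _ (Measurable.tsum hFm).aemeasurable
          (Measurable.indicator (by fun_prop) hAm).aemeasurable (ae_of_all _ hpt)
    _ ≤ ∑' k, N (F k) := hN.tsum_le fun k => (hFm k).aemeasurable
    _ ≤ ∑' k : ℕ, C * ENNReal.ofReal (2 ^ n) * ENNReal.ofReal (((2 : ℝ) ^ (a + n)) ^ k) := by
        refine ENNReal.tsum_le_tsum fun k => ?_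
        rw [hF, hN.const_mul ENNReal.ofReal_ne_top (h1m _).aemeasurable]
        calc _ ≤ ENNReal.ofReal (((2 : ℝ) ^ k) ^ a) *
              (C * ENNReal.ofReal (((2 : ℝ) ^ (k + 1)) ^ n)) := by
              gcongr
              exact hC _ (one_le_pow₀ one_le_two)
          _ = C * (ENNReal.ofReal (((2 : ℝ) ^ k) ^ a) *
              ENNReal.ofReal (((2 : ℝ) ^ (k + 1)) ^ n)) := by ring
          _ = _ := by
              rw [mul_assoc, ← ENNReal.ofReal_mul (by positivity),
                ← ENNReal.ofReal_mul (by positivity)]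
              congr 2
              have h1 : ((2 : ℝ) ^ k) ^ a = (2 ^ a) ^ k := by
                rw [← Real.rpow_natCast, ← Real.rpow_mul (by norm_num), mul_comm,
                  Real.rpow_mul (by norm_num), Real.rpow_natCast]
              rw [h1, Real.rpow_add two_pos, Real.rpow_natCast]
              ring
    _ < ⊤ := by
        rw [ENNReal.tsum_mul_left, ← ENNReal.ofReal_tsum_of_nonneg (fun k => by positivity) hsum]
        finiteness

/-- Tail control follows once the level sets are covered by a truncated set, a family `W₁` that is
truncated near the origin and decays at infinity, and a family `W₂` of small norm. -/
theorem tailControl_of_cover (hN : IsBallBanach N)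
    (havg : ∃ C : ℝ≥0, ∀ r : ℝ, 0 < r → BoundedBy (ballAverage r) N C) {γ q : ℝ} (hq : 0 < q)
    {f : Rn n → ℝ} (hf : Measurable f) {l : Filter ℝ} {a : ℝ} (ha : a < -n)
    (h : ∀ ε : ℝ≥0∞, 0 < ε → ∃ D : Rn n → ℝ≥0∞, Measurable D ∧ N D < ⊤ ∧
      ∃ (W₁ W₂ : ℝ → Set (Rn n × Rn n)) (R : ℝ) (c : ℝ → ℝ≥0∞), 1 ≤ R ∧ Tendsto c l (𝓝 0) ∧
        (∀ lam, MeasurableSet (W₁ lam)) ∧ (∀ lam, MeasurableSet (W₂ lam)) ∧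
        ∀ᶠ lam in l,
          (∀ᵐ x ∂(volume : Measure (Rn n)), ∀ᵐ y ∂(volume : Measure (Rn n)),
            (x, y) ∈ levelSet f lam (γ / q) →
              (x, y) ∈ truncSet D lam (γ / q) ∨ (x, y) ∈ W₁ lam ∨ (x, y) ∈ W₂ lam) ∧
          (∀ x y, ‖x‖ < R → (x, y) ∈ W₁ lam → (x, y) ∈ truncSet D lam (γ / q)) ∧
          (∀ x, R ≤ ‖x‖ → ENNReal.ofReal lam * kernelInt γ (W₁ lam) x ^ (1 / q) ≤
            c lam * ENNReal.ofReal (‖x‖ ^ a)) ∧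
          N (fun x => ENNReal.ofReal lam * kernelInt γ (W₂ lam) x ^ (1 / q)) ≤ ε) :
    TailControl N γ q f l := by
  intro ε hε
  set s := 1 / q with hs
  have hs0 : 0 < s := by positivity
  set κ : ℝ≥0∞ := 2 ^ s with hκ
  have hκt : κ ≠ ⊤ := ENNReal.rpow_ne_top_of_nonneg hs0.le (by norm_num)
  have hκ0 : κ ≠ 0 := (ENNReal.rpow_pos (by norm_num) (by norm_num)).ne'
  set P : Rn n → ℝ≥0∞ := {x : Rn n | 1 ≤ ‖x‖}.indicator fun x => ENNReal.ofReal (‖x‖ ^ a) with hP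
  have hPm : Measurable P := Measurable.indicator (by fun_prop)
    (measurableSet_le measurable_const measurable_norm)
  have hPN : N P < ⊤ := power_norm_lt_top hN havg ha
  have hε2 : 0 < ε / 2 := ENNReal.half_pos hε.ne'
  obtain ⟨D, hD, hDN, W₁, W₂, R, c, hR, hc, hW₁, hW₂, hev⟩ := h (ε / 2 / κ)
    (ENNReal.div_pos hε2.ne' hκt)
  have hTm : MeasurableSet {x : Rn n | R ≤ ‖x‖} :=
    measurableSet_le measurable_const measurable_norm
  refine ⟨D, hD, hDN, fun lam x => {x : Rn n | R ≤ ‖x‖}.indicator (kernelInt γ (W₁ lam)) x +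
    kernelInt γ (W₂ lam) x, fun lam => ((measurable_kernelInt (hW₁ lam)).indicator hTm).add
      (measurable_kernelInt (hW₂ lam)), ?_⟩
  have hc' : ∀ᶠ lam in l, κ * (c lam * N P) ≤ ε / 2 := by
    have h1 : Tendsto (fun lam => κ * (c lam * N P)) l (𝓝 (κ * (0 * N P))) :=
      ENNReal.Tendsto.const_mul (ENNReal.Tendsto.mul_const hc (Or.inr hPN.ne)) (Or.inr hκt)
    rw [zero_mul, mul_zero] at h1
    exact h1.eventually (ge_mem_nhds hε2)
  -- only finite values of `c` are used
  have hcfin : ∀ᶠ lam in l, c lam < 1 := hc.eventually (gt_mem_nhds one_pos)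
  filter_upwards [hev, hc', hcfin] with lam ⟨hcov, hnear, hfar, hsmall⟩ hclam hcf
  refine ⟨?_, ?_⟩
  · filter_upwards [hcov] with x hx
    have hEm : MeasurableSet (levelSet f lam (γ / q) ∩ truncSet D lam (γ / q)) :=
      (measurableSet_levelSet hf _ _).inter (measurableSet_truncSet hD _ _)
    by_cases hxR : R ≤ ‖x‖
    · rw [indicator_of_mem (show x ∈ {x : Rn n | R ≤ ‖x‖} from hxR)]
      calc _ ≤ kernelInt γ ((levelSet f lam (γ / q) ∩ truncSet D lam (γ / q)) ∪
            (W₁ lam ∪ W₂ lam)) x := by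
            refine kernelInt_le_of_ae ?_
            filter_upwards [hx] with y hy hE
            rcases hy hE with h | h
            · exact Or.inl ⟨hE, h⟩
            · exact Or.inr h
        _ ≤ _ := (kernelInt_union_le hEm x).trans (by
            gcongr
            exact kernelInt_union_le (hW₁ lam) x)
    · rw [indicator_of_notMem (show x ∉ {x : Rn n | R ≤ ‖x‖} from hxR), zero_add]
      calc _ ≤ kernelInt γ ((levelSet f lam (γ / q) ∩ truncSet D lam (γ / q)) ∪ W₂ lam) x := by
            refine kernelInt_le_of_ae ?_
            filter_upwards [hx] with y hy hE
            rcases hy hE with h | h | h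
            · exact Or.inl ⟨hE, h⟩
            · exact Or.inl ⟨hE, hnear x y (not_le.1 hxR) h⟩
            · exact Or.inr h
        _ ≤ _ := kernelInt_union_le hEm x
  · have hB : Measurable fun x => ENNReal.ofReal lam * kernelInt γ (W₂ lam) x ^ s :=
      ((measurable_kernelInt (hW₂ lam)).pow_const _).const_mul _
    have hA : Measurable fun x => c lam * P x := hPm.const_mul _
    calc _ ≤ N (fun x => κ * (c lam * P x + ENNReal.ofReal lam * kernelInt γ (W₂ lam) x ^ s)) := by
          refine hN.mono _ _ ((hA.add hB).const_mul _).aemeasurable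
            (((((measurable_kernelInt (hW₁ lam)).indicator hTm).add
              (measurable_kernelInt (hW₂ lam))).pow_const _).const_mul _).aemeasurable
            (ae_of_all _ fun x => ?_)
          refine (mul_le_mul_right (add_rpow_le_two _ _ hs0.le) _).trans ?_
          rw [mul_left_comm, mul_add]
          refine mul_le_mul_right (add_le_add_left ?_ _) _
          by_cases hxR : R ≤ ‖x‖
          · rw [indicator_of_mem (show x ∈ {x : Rn n | R ≤ ‖x‖} from hxR), hP,
              indicator_of_mem (show x ∈ {x : Rn n | 1 ≤ ‖x‖} from hR.trans hxR)]
            exact hfar x hxR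
          · rw [indicator_of_notMem (show x ∉ {x : Rn n | R ≤ ‖x‖} from hxR),
              ENNReal.zero_rpow_of_pos hs0, mul_zero]
            exact zero_le
      _ ≤ κ * (c lam * N P + ε / 2 / κ) := by
          have hAB : Measurable fun x =>
              c lam * P x + ENNReal.ofReal lam * kernelInt γ (W₂ lam) x ^ s := hA.add hB
          rw [hN.const_mul hκt hAB.aemeasurable]
          gcongr
          refine (hN.add_le _ _ hA.aemeasurable hB.aemeasurable).trans ?_
          rw [hN.const_mul (hcf.trans ENNReal.one_lt_top).ne hPm.aemeasurable]
          gcongr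
      _ ≤ ε / 2 + ε / 2 := by
          rw [mul_add, ENNReal.mul_div_cancel hκ0 hκt]
          gcongr
      _ = ε := ENNReal.add_halves ε

/-- Outside a null set, the pairs of a level set lie below the dyadic averages of the gradient. -/
theorem HasWeakGradient.ae_mem_majorantSet {f : Rn n → ℝ} {g : Rn n → Rn n}
    (hfg : HasWeakGradient f g) (hg : Measurable g) (hf : Measurable f) (b : ℝ) :
    ∀ᵐ x ∂(volume : Measure (Rn n)), ∀ᵐ y ∂(volume : Measure (Rn n)), ∀ lam : ℝ, 0 < lam →
      (x, y) ∈ levelSet f lam b →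
        (x, y) ∈ majorantSet (fun y => ‖g y‖ₑ) (lam / 2 ^ (2 * n + 1)) b := by
  obtain ⟨S, hS, h⟩ := hfg.enorm_sub_le_dyadicAverage hg hf
  filter_upwards [hS] with x hx
  filter_upwards [hS] with y hy lam hlam hE
  obtain ⟨hxy, hlt⟩ := hE
  refine ⟨hxy, ?_⟩
  dsimp only at hxy hlt ⊢
  have hρ : 0 < ‖x - y‖ := by rwa [norm_pos_iff, sub_ne_zero]
  have h1 := h x hx y hy hxy
  rw [lt_div_iff₀ (by positivity), Real.rpow_add hρ, Real.rpow_one] at hlt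
  set c : ℝ := 2 ^ (2 * n + 1) with hc
  have hc0 : 0 < c := by positivity
  have h2 : ENNReal.ofReal c * ENNReal.ofReal ‖x - y‖ * ENNReal.ofReal (lam / c * ‖x - y‖ ^ b) <
      ENNReal.ofReal c * ENNReal.ofReal ‖x - y‖ *
        (dyadicAverage (fun y => ‖g y‖ₑ) x (2 * ‖x - y‖) +
          dyadicAverage (fun y => ‖g y‖ₑ) y (2 * ‖x - y‖)) := by
    refine lt_of_lt_of_le ?_ h1
    rw [← ENNReal.ofReal_mul hc0.le, ← ENNReal.ofReal_mul (by positivity), ← ofReal_norm,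
      Real.norm_eq_abs]
    refine (ENNReal.ofReal_lt_ofReal_iff (lt_of_le_of_lt (by positivity) hlt)).2 ?_
    refine lt_of_eq_of_lt ?_ hlt
    field_simp
  exact lt_of_mul_lt_mul_left' h2

theorem majorantSet_add_subset {g₁ g₂ : Rn n → ℝ≥0∞} (hg₁ : Measurable g₁) {lam b : ℝ}
    (hlam : 0 < lam) :
    majorantSet (fun x => g₁ x + g₂ x) lam b ⊆
      majorantSet g₁ (lam / 2) b ∪ majorantSet g₂ (lam / 2) b := by
  rintro ⟨x, y⟩ ⟨hxy, h⟩
  by_contra hcon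
  rw [mem_union, not_or] at hcon
  have h1 : dyadicAverage g₁ x (2 * ‖x - y‖) + dyadicAverage g₁ y (2 * ‖x - y‖) ≤
      ENNReal.ofReal (lam / 2 * ‖x - y‖ ^ b) := not_lt.1 fun h' => hcon.1 ⟨hxy, h'⟩
  have h2 : dyadicAverage g₂ x (2 * ‖x - y‖) + dyadicAverage g₂ y (2 * ‖x - y‖) ≤
      ENNReal.ofReal (lam / 2 * ‖x - y‖ ^ b) := not_lt.1 fun h' => hcon.2 ⟨hxy, h'⟩
  refine h.not_ge ?_
  dsimp only
  rw [dyadicAverage_add hg₁, dyadicAverage_add hg₁, add_add_add_comm]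
  refine (add_le_add h1 h2).trans_eq ?_
  rw [← ENNReal.ofReal_add (by positivity) (by positivity)]
  congr 1
  ring

/-- For `g` bounded by `k` and supported in the ball of radius `k`, pairs in the majorant set satisfy an
absolute bound, and a point far from the support can only be paired at a distance comparable to its
own norm. -/
theorem majorantSet_bounded {g : Rn n → ℝ≥0∞} {k : ℕ} (hgk : ∀ x, g x ≤ k)
    (hg0 : ∀ x, (k : ℝ) < ‖x‖ → g x = 0) {lam b : ℝ} {x y : Rn n}
    (h : (x, y) ∈ majorantSet g lam b) :
    ENNReal.ofReal (lam * ‖x - y‖ ^ b) < 4 * k ∧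
      (8 * ((k : ℝ) + 1) ≤ ‖x‖ → ‖x‖ / 8 ≤ ‖x - y‖) := by
  obtain ⟨hxy, h⟩ := h
  dsimp only at hxy h
  have hρ : 0 < ‖x - y‖ := by rwa [norm_pos_iff, sub_ne_zero]
  have hle : ∀ (z : Rn n) (K : ℝ≥0∞), (∀ w ∈ Metric.ball z (2 * ‖x - y‖), g w ≤ K) →
      dyadicAverage g z (2 * ‖x - y‖) ≤ 2 * K := by
    intro z K hK
    refine dyadicAverage_le_of_forall fun j => ?_
    have hj : 0 < 2 * ‖x - y‖ / 2 ^ j := by positivity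
    rw [← ballAverage_const hj K z, ballAverage_eq, ballAverage_eq]
    gcongr ?_ / _
    refine setLIntegral_mono' measurableSet_ball fun w hw => hK w ?_
    exact Metric.ball_subset_ball (div_le_self (by positivity) (one_le_pow₀ one_le_two)) hw
  constructor
  · refine h.trans_le ((add_le_add (hle x k fun w _ => hgk w) (hle y k fun w _ => hgk w)).trans_eq ?_)
    ring
  · intro hx
    by_contra! hlt
    have hfar : ∀ z w : Rn n, ‖x - z‖ ≤ ‖x - y‖ → w ∈ Metric.ball z (2 * ‖x - y‖) → g w ≤ 0 := by
      intro z w hz hw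
      rw [mem_ball_iff_norm'] at hw
      refine (hg0 w ?_).le
      have h1 : ‖x‖ ≤ ‖x - z‖ + ‖z - w‖ + ‖w‖ := by
        calc ‖x‖ = ‖(x - z) + (z - w) + w‖ := by congr 1; abel
          _ ≤ _ := norm_add₃_le
      linarith
    have h1 := add_le_add (hle x 0 fun w hw => hfar x w (by simp) hw)
      (hle y 0 fun w hw => hfar y w le_rfl hw)
    simp only [mul_zero, add_zero] at h1
    exact not_lt_zero (h.trans_le h1)

end Tails

/-! ### The range where dyadic averages suffice -/

section DyadicRange

variable {n : ℕ} {N : FunctionNorm n}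

/-- The functionals are bounded by the gradient norm. -/
def HasUpperBound (N : FunctionNorm n) (γ q : ℝ) : Prop :=
  ∃ C : ℝ≥0∞, C ≠ ⊤ ∧ ∀ (f : Rn n → ℝ) (g : Rn n → Rn n), Measurable f → Measurable g →
    HasWeakGradient f g → N (fun x => ‖g x‖ₑ) < ⊤ → ∀ lam : ℝ, 0 < lam →
      functional N γ q f lam ≤ C * N fun x => ‖g x‖ₑ

theorem functional_le_of_ae (hN : IsBallBanach N) {γ q : ℝ} (hq : 0 < q) {f : Rn n → ℝ}
    (hf : Measurable f) {lam : ℝ} {E : Set (Rn n × Rn n)} (hE : MeasurableSet E)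
    (h : ∀ᵐ x ∂(volume : Measure (Rn n)), ∀ᵐ y ∂(volume : Measure (Rn n)),
      (x, y) ∈ levelSet f lam (γ / q) → (x, y) ∈ E) :
    functional N γ q f lam ≤ N fun x => ENNReal.ofReal lam * kernelInt γ E x ^ (1 / q) := by
  rw [functional_eq hN hf]
  refine hN.mono _ _ (((measurable_kernelInt hE).pow_const _).const_mul _).aemeasurable
    (((measurable_kernelInt (measurableSet_levelSet hf _ _)).pow_const _).const_mul
      _).aemeasurable ?_
  filter_upwards [h] with x hx
  exact mul_le_mul_right (ENNReal.rpow_le_rpow (kernelInt_le_of_ae hx) (by positivity)) _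

theorem norm_rescale (hN : IsBallBanach N) {c lam s : ℝ} (hc : 0 < c) {F : Rn n → ℝ≥0∞}
    (hF : Measurable F) : N (fun x => ENNReal.ofReal lam * F x ^ s) =
      ENNReal.ofReal c * N (fun x => ENNReal.ofReal (lam / c) * F x ^ s) := by
  have hm : Measurable fun x => ENNReal.ofReal (lam / c) * F x ^ s := (hF.pow_const _).const_mul _
  rw [← hN.const_mul ENNReal.ofReal_ne_top hm.aemeasurable]
  congr 1
  ext x
  rw [← mul_assoc, ← ENNReal.ofReal_mul hc.le, mul_div_cancel₀ _ hc.ne']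

/-- The upper bound in the range where the weighted estimate for dyadic averages is available. -/
theorem hasUpperBound_of_dyadic (hN : IsBallBanach N) (hn : 1 ≤ n) {L : ℝ≥0} (hL1 : 1 ≤ L)
    (hL : ∀ h : Rn n → ℝ≥0∞, Measurable h → associate N (maximal h) ≤ L * associate N h)
    {γ q : ℝ} (hq : 0 < q) (hnq : (n : ℝ) * (1 - 1 / q) < 1) (hb : 0 < γ / q ∨ γ / q < -n) :
    HasUpperBound N γ q := by
  obtain ⟨C, hCt, hC⟩ := hN.exists_majorantSet_le hn hL1 hL hq hnq hb
  set c : ℝ := 2 ^ (2 * n + 1) with hc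
  have hc0 : 0 < c := by positivity
  refine ⟨ENNReal.ofReal c * C, by finiteness, fun f g hf hg hfg hgN lam hlam => ?_⟩
  have hWm := measurableSet_majorantSet hg.enorm (lam / c) (γ / q)
  have h1 := hC _ hg.enorm hgN (lam / c) (by positivity)
  rw [div_mul_cancel₀ γ hq.ne'] at h1
  refine (functional_le_of_ae hN hq hf hWm ?_).trans ?_
  · filter_upwards [hfg.ae_mem_majorantSet hg hf (γ / q)] with x hx
    filter_upwards [hx] with y hy using hy lam hlam
  · rw [norm_rescale hN hc0 (measurable_kernelInt hWm), mul_assoc]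
    gcongr

theorem eventually_pos_of_le {γ : ℝ} {l : Filter ℝ}
    (hl : (0 < γ ∧ l ≤ atTop) ∨ (γ < 0 ∧ l ≤ 𝓝[>] 0)) : ∀ᶠ lam in l, 0 < lam := by
  rcases hl with ⟨-, hl⟩ | ⟨-, hl⟩
  · exact hl (eventually_gt_atTop 0)
  · exact hl self_mem_nhdsWithin

/-- Far from the support of a bounded compactly supported function, the kernel integrals of its
majorant sets decay uniformly. -/
theorem exists_majorantSet_decay (hn : 1 ≤ n) {γ q : ℝ} (hq : 0 < q)
    (hb : 0 < γ / q ∨ γ / q < -n) {l : Filter ℝ}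
    (hl : (0 < γ ∧ l ≤ atTop) ∨ (γ < 0 ∧ l ≤ 𝓝[>] 0)) {c₀ : ℝ} (hc₀ : 0 < c₀) :
    ∃ a : ℝ, a < -n ∧ ∀ (k : ℕ) (g : Rn n → ℝ≥0∞), (∀ x, g x ≤ k) →
      (∀ x, (k : ℝ) < ‖x‖ → g x = 0) → ∃ c : ℝ → ℝ≥0∞, Tendsto c l (𝓝 0) ∧
        ∀ᶠ lam in l, ∀ x : Rn n, 8 * ((k : ℝ) + 1) ≤ ‖x‖ →
          ENNReal.ofReal lam * kernelInt γ (majorantSet g (lam / c₀) (γ / q)) x ^ (1 / q) ≤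
            c lam * ENNReal.ofReal (‖x‖ ^ a) := by
  rcases hb with hb | hb
  · have hγ : 0 < γ := by
      have := mul_pos hb hq
      rwa [div_mul_cancel₀ γ hq.ne'] at this
    have hl' : l ≤ atTop := by
      rcases hl with ⟨-, hl⟩ | ⟨h, -⟩
      · exact hl
      · linarith
    refine ⟨-n - 1, by linarith, fun k g hgk hg0 => ⟨fun _ => 0, tendsto_const_nhds, ?_⟩⟩
    filter_upwards [hl' (eventually_ge_atTop (c₀ * (4 * k))), hl' (eventually_gt_atTop 0)]
      with lam hlam hlam0 x hx
    have hempty : ∀ y, (x, y) ∉ majorantSet g (lam / c₀) (γ / q) := by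
      intro y hy
      obtain ⟨h1, h2⟩ := majorantSet_bounded hgk hg0 hy
      have h3 := h2 hx
      have hk0 : (0 : ℝ) ≤ k := by positivity
      have h4 : (1 : ℝ) ≤ ‖x - y‖ ^ (γ / q) := Real.one_le_rpow (by linarith) hb.le
      have h5 : (4 * k : ℝ) ≤ lam / c₀ * ‖x - y‖ ^ (γ / q) := by
        have : 4 * (k : ℝ) ≤ lam / c₀ := by rwa [le_div_iff₀' hc₀]
        exact this.trans (le_mul_of_one_le_right (by positivity) h4)
      refine h1.not_ge ?_
      have h6 : ENNReal.ofReal (4 * k : ℝ) = 4 * k := by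
        rw [ENNReal.ofReal_mul (by norm_num), ENNReal.ofReal_natCast, ENNReal.ofReal_ofNat]
      rw [← h6]
      exact ENNReal.ofReal_le_ofReal h5
    have h0 : kernelInt γ (majorantSet g (lam / c₀) (γ / q)) x = 0 := by
      rw [kernelInt]
      simp [indicator_of_notMem (hempty _)]
    rw [h0, ENNReal.zero_rpow_of_pos (by positivity), mul_zero]
    exact zero_le
  · have hb0 : γ / q < 0 := hb.trans_le (by simp)
    have hγ : γ < 0 := by
      have := mul_neg_of_neg_of_pos hb0 hq
      rwa [div_mul_cancel₀ γ hq.ne'] at this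
    have hl' : l ≤ 𝓝[>] 0 := by
      rcases hl with ⟨h, -⟩ | ⟨-, hl⟩
      · linarith
      · exact hl
    set K : ℝ≥0∞ := (ENNReal.ofReal ((1 / 16) ^ γ / |γ|) *
      (volume : Measure (Rn n)).toSphere univ) ^ (1 / q) with hK
    have hKt : K ≠ ⊤ := ENNReal.rpow_ne_top_of_nonneg (by positivity)
      (ENNReal.mul_ne_top ENNReal.ofReal_ne_top (measure_ne_top _ _))
    refine ⟨γ / q, hb, fun k g hgk hg0 => ⟨fun lam => ENNReal.ofReal lam * K, ?_, ?_⟩⟩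
    · have h1 : Tendsto (fun lam : ℝ => ENNReal.ofReal lam) l (𝓝 0) := by
        have := (ENNReal.continuous_ofReal.tendsto (0 : ℝ)).mono_left
          (hl'.trans nhdsWithin_le_nhds)
        rwa [ENNReal.ofReal_zero] at this
      have h2 := ENNReal.Tendsto.mul_const h1 (Or.inr hKt)
      rwa [zero_mul] at h2
    · refine Eventually.of_forall fun lam x hx => ?_
      have hk0 : (0 : ℝ) ≤ k := by positivity
      have hx0 : 0 < ‖x‖ := by linarith
      rw [mul_assoc]
      gcongr
      set A : Set (Rn n) := {y : Rn n | ‖x - y‖ ^ (-1 : ℝ) < (‖x‖ / 16) ^ (-1 : ℝ)} with hA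
      have hAm : MeasurableSet A := measurableSet_lt (by fun_prop) measurable_const
      have h1 : kernelInt γ (majorantSet g (lam / c₀) (γ / q)) x ≤
          ∫⁻ y in A, ENNReal.ofReal (‖x - y‖ ^ (γ - n)) := by
        rw [← lintegral_indicator hAm, kernelInt]
        refine lintegral_mono fun y => ?_
        by_cases hy : (x, y) ∈ majorantSet g (lam / c₀) (γ / q)
        · have h2 := (majorantSet_bounded hgk hg0 hy).2 hx
          have hyA : y ∈ A :=
            Real.rpow_lt_rpow_of_neg (by positivity) (by linarith) (by norm_num)
          rw [indicator_of_mem hy, indicator_of_mem hyA]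
        · rw [indicator_of_notMem hy]
          exact zero_le
      rw [lintegral_radial_sub hn (by rw [div_neg, div_one]; linarith) (by positivity)] at h1
      refine (ENNReal.rpow_le_rpow h1 (by positivity)).trans (le_of_eq ?_)
      have h3 : ENNReal.ofReal (‖x‖ ^ (γ / q)) = ENNReal.ofReal (‖x‖ ^ γ) ^ (1 / q) := by
        rw [ENNReal.ofReal_rpow_of_pos (by positivity), ← Real.rpow_mul hx0.le, mul_one_div]
      rw [h3, hK, ← ENNReal.mul_rpow_of_nonneg _ _ (by positivity), mul_right_comm,
        ← ENNReal.ofReal_mul (by positivity)]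
      congr 3
      rw [← Real.rpow_mul (by positivity), div_eq_mul_one_div ‖x‖,
        Real.mul_rpow hx0.le (by norm_num), show -1 * (γ / -1) = γ by ring]
      ring

/-- A function in the space is, up to a summand of small norm, bounded and supported in a ball; the two
summands live on disjoint sets. -/
theorem exists_split (hac : HasAbsContNorm N) (hN : IsBallBanach N) {g : Rn n → ℝ≥0∞}
    (hg : Measurable g) (hgN : N g < ⊤) {ε : ℝ≥0∞} (hε : 0 < ε) :
    ∃ (k : ℕ) (g₁ g₂ : Rn n → ℝ≥0∞), Measurable g₁ ∧ Measurable g₂ ∧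
      (∀ x, g x = g₁ x + g₂ x) ∧ (∀ x, g₁ x ≤ k) ∧ (∀ x, (k : ℝ) < ‖x‖ → g₁ x = 0) ∧
      (∀ x, g₁ x = 0 ∨ g₂ x = 0) ∧ N g₂ ≤ ε := by
  obtain ⟨k, hk⟩ := exists_trunc_small hac hN hg hgN hε
  set S : Set (Rn n) := {x | (k : ℝ≥0∞) < g x ∨ (k : ℝ) < ‖x‖} with hS
  have hSm : MeasurableSet S :=
    (measurableSet_lt measurable_const hg).union (measurableSet_lt measurable_const measurable_norm)
  refine ⟨k, Sᶜ.indicator g, S.indicator g, hg.indicator hSm.compl, hg.indicator hSm,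
    fun x => ?_, fun x => ?_, fun x hx => ?_, fun x => ?_, hk.le⟩
  · by_cases hx : x ∈ S <;> simp [hx]
  · by_cases hx : x ∈ S
    · simp [hx]
    · rw [indicator_of_mem (show x ∈ Sᶜ from hx)]
      rw [hS, mem_ofPred_eq, not_or] at hx
      exact not_lt.1 hx.1
  · exact indicator_of_notMem (show x ∉ Sᶜ from fun h => h (Or.inr hx)) _
  · by_cases hx : x ∈ S
    · exact Or.inl (indicator_of_notMem (show x ∉ Sᶜ from fun h => h hx) _)
    · exact Or.inr (indicator_of_notMem hx _)

theorem mul_div_add_one_le {K ε : ℝ≥0∞} : K * (ε / (K + 1)) ≤ ε :=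
  calc K * (ε / (K + 1)) ≤ (K + 1) * (ε / (K + 1)) := by gcongr; exact le_self_add
    _ ≤ ε := ENNReal.mul_div_le

/-- Tail control in the dyadic range. The gradient is split into a bounded, compactly supported part,
whose majorant sets are truncated near the origin and decay at infinity, and a part of small norm. -/
theorem tailControl_of_dyadic (hN : IsBallBanach N) (hac : HasAbsContNorm N) (hn : 1 ≤ n)
    (havg : ∃ C : ℝ≥0, ∀ r : ℝ, 0 < r → BoundedBy (ballAverage r) N C) {L : ℝ≥0} (hL1 : 1 ≤ L)
    (hL : ∀ h : Rn n → ℝ≥0∞, Measurable h → associate N (maximal h) ≤ L * associate N h)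
    {γ q : ℝ} (hq : 0 < q) (hnq : (n : ℝ) * (1 - 1 / q) < 1) (hb : 0 < γ / q ∨ γ / q < -n)
    {l : Filter ℝ} (hl : (0 < γ ∧ l ≤ atTop) ∨ (γ < 0 ∧ l ≤ 𝓝[>] 0))
    {f : Rn n → ℝ} (hf : Measurable f) {g : Rn n → Rn n} (hg : Measurable g)
    (hfg : HasWeakGradient f g) (hgN : N (fun x => ‖g x‖ₑ) < ⊤) : TailControl N γ q f l := by
  obtain ⟨C, hCt, hC⟩ := hN.exists_majorantSet_le hn hL1 hL hq hnq hb
  set c₀ : ℝ := 2 ^ (2 * n + 1) with hc₀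
  have hc₀0 : 0 < c₀ := by positivity
  obtain ⟨a, ha, hdecay⟩ := exists_majorantSet_decay hn hq hb hl (by positivity : 0 < c₀ * 2)
  refine tailControl_of_cover hN havg hq hf ha fun ε hε => ?_
  set K : ℝ≥0∞ := ENNReal.ofReal (c₀ * 2) * C with hK
  obtain ⟨k, g₁, g₂, hg₁, hg₂, hsum, hg₁k, hg₁0, -, hg₂N⟩ := exists_split hac hN hg.enorm hgN
    (ENNReal.div_pos hε.ne' (by finiteness : K + 1 ≠ ⊤))
  obtain ⟨c, hc, hfar⟩ := hdecay k g₁ hg₁k hg₁0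
  set R : ℝ := 8 * ((k : ℝ) + 1) with hR
  have hk0 : (0 : ℝ) ≤ k := by positivity
  set B : Rn n → ℝ≥0∞ := (Metric.ball (0 : Rn n) R).indicator 1 with hB
  have hBm : Measurable B := measurable_one.indicator measurableSet_ball
  have hK' : ENNReal.ofReal (c₀ * 2) * (4 * k) ≠ ⊤ := by finiteness
  refine ⟨fun x => ENNReal.ofReal (c₀ * 2) * (4 * k) * B x, hBm.const_mul _, ?_,
    fun lam => majorantSet g₁ (lam / (c₀ * 2)) (γ / q),
    fun lam => majorantSet g₂ (lam / (c₀ * 2)) (γ / q), R, c, by linarith, hc,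
    fun lam => measurableSet_majorantSet hg₁ _ _, fun lam => measurableSet_majorantSet hg₂ _ _, ?_⟩
  · rw [hN.const_mul hK' hBm.aemeasurable]
    exact ENNReal.mul_lt_top hK'.lt_top (hN.ball_mem 0 R (by linarith))
  filter_upwards [hfar, eventually_pos_of_le hl] with lam hfar hlam
  refine ⟨?_, ?_, hfar, ?_⟩
  · filter_upwards [hfg.ae_mem_majorantSet hg hf (γ / q)] with x hx
    filter_upwards [hx] with y hy hE
    have h1 := hy lam hlam hE
    have h2 : (fun y => ‖g y‖ₑ) = fun x => g₁ x + g₂ x := funext hsum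
    rw [h2] at h1
    have h3 := majorantSet_add_subset hg₁ (by positivity) h1
    rw [div_div] at h3
    exact Or.inr h3
  · intro x y hx hxy
    have h1 := (majorantSet_bounded hg₁k hg₁0 hxy).1
    have hxB : x ∈ Metric.ball (0 : Rn n) R := by rwa [mem_ball_zero_iff]
    rw [truncSet, mem_ofPred_eq, hB]
    dsimp only
    rw [indicator_of_mem hxB, Pi.one_apply, mul_one]
    have h2 : lam * ‖x - y‖ ^ (γ / q) = c₀ * 2 * (lam / (c₀ * 2) * ‖x - y‖ ^ (γ / q)) := by
      field_simp
    rw [h2, ENNReal.ofReal_mul (by positivity)]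
    exact (ENNReal.mul_lt_mul_iff_right (by simp; positivity) ENNReal.ofReal_ne_top).2 h1
  · have hg₂t : N g₂ < ⊤ := (hN.mono _ _ hg.enorm.aemeasurable hg₂.aemeasurable
      (ae_of_all _ fun x => le_add_self.trans_eq (hsum x).symm)).trans_lt hgN
    have h1 := hC g₂ hg₂ hg₂t (lam / (c₀ * 2)) (by positivity)
    rw [div_mul_cancel₀ γ hq.ne'] at h1
    rw [norm_rescale hN (by positivity : 0 < c₀ * 2)
      (measurable_kernelInt (measurableSet_majorantSet hg₂ _ _))]
    calc _ ≤ ENNReal.ofReal (c₀ * 2) * (C * N g₂) := by gcongr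
      _ = K * N g₂ := by rw [hK, mul_assoc]
      _ ≤ K * (ε / (K + 1)) := by gcongr
      _ ≤ ε := mul_div_add_one_le

end DyadicRange

/-! ### Boundedness of the maximal operator on a power space -/

section PowerMaximal

variable {n : ℕ} {N : FunctionNorm n}

/-- Jensen's inequality for averages over balls. -/
theorem ballAverage_le_rpow {r : ℝ} (hr : 1 < r) {g : Rn n → ℝ≥0∞} (hg : Measurable g) (x : Rn n)
    {ρ : ℝ} (hρ : 0 < ρ) : ballAverage ρ g x ≤ ballAverage ρ (fun y => g y ^ r) x ^ (1 / r) := by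
  have hv0 := (Metric.measure_ball_pos volume x hρ).ne'
  have hvt := (measure_ball_lt_top (μ := volume) (x := x) (r := ρ)).ne
  have h1 := ENNReal.lintegral_mul_le_Lp_mul_Lq
    ((volume (Metric.ball x ρ))⁻¹ • volume.restrict (Metric.ball x ρ))
    (Real.HolderConjugate.conjExponent hr) hg.aemeasurable (aemeasurable_const (b := (1 : ℝ≥0∞)))
  have h2 : (volume (Metric.ball x ρ))⁻¹ * volume (Metric.ball x ρ) = 1 :=
    ENNReal.inv_mul_cancel hv0 hvt
  simpa [ballAverage, laverage, h2] using h1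

/-- After Jensen's inequality the averages over the small balls around `z` are compared with one average
around `x` at the cost `2^{jn/r}`, which the weights `2⁻ʲ` absorb because `n < r`. -/
theorem exists_dyadicAverage_le_maximal_rpow {r : ℝ} (hr : 1 < r) (hnr : (n : ℝ) < r) :
    ∃ K : ℝ≥0∞, K ≠ ⊤ ∧ ∀ g : Rn n → ℝ≥0∞, Measurable g → ∀ (x z : Rn n) (ρ : ℝ), 0 < ρ →
      dist z x ≤ ρ → dyadicAverage g z (2 * ρ) ≤ K * maximal (fun y => g y ^ r) x ^ (1 / r) := by
  have hr0 : 0 < r := by linarith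
  set a : ℝ := 2 ^ ((n : ℝ) / r) with ha
  have ha0 : 0 < a := by positivity
  have ha2 : a < 2 := by
    have := Real.rpow_lt_rpow_of_exponent_lt (one_lt_two : (1 : ℝ) < 2)
      (show (n : ℝ) / r < 1 by rwa [div_lt_one hr0])
    rwa [Real.rpow_one] at this
  have hj : ∀ j : ℕ, (2 : ℝ≥0∞)⁻¹ ^ j * ENNReal.ofReal ((2 * 2 ^ j) ^ n) ^ (1 / r) =
      ENNReal.ofReal (a * (a / 2) ^ j) := by
    intro j
    have h1 : (((2 : ℝ) * 2 ^ j) ^ n) ^ (1 / r) = a * a ^ j := by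
      rw [← pow_succ', ← pow_succ', ha, ← Real.rpow_natCast, ← Real.rpow_natCast,
        ← Real.rpow_natCast, ← Real.rpow_mul two_pos.le, ← Real.rpow_mul two_pos.le,
        ← Real.rpow_mul two_pos.le]
      congr 1
      ring
    have h2 : (2 : ℝ≥0∞)⁻¹ ^ j = ENNReal.ofReal ((1 / 2) ^ j) := by
      rw [ENNReal.ofReal_pow (by norm_num), one_div, ENNReal.ofReal_inv_of_pos two_pos,
        ENNReal.ofReal_ofNat]
    rw [ENNReal.ofReal_rpow_of_pos (by positivity), h1, h2, ← ENNReal.ofReal_mul (by positivity),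
      div_pow, div_pow]
    congr 1
    ring
  refine ⟨∑' j : ℕ, ENNReal.ofReal (a * (a / 2) ^ j), ?_, fun g hg x z ρ hρ hzx => ?_⟩
  · rw [← ENNReal.ofReal_tsum_of_nonneg (fun j => by positivity)
      ((summable_geometric_of_lt_one (by positivity) (by linarith)).mul_left a)]
    exact ENNReal.ofReal_ne_top
  · rw [← ENNReal.tsum_mul_right]
    refine ENNReal.tsum_le_tsum fun j => ?_
    have hρj : 0 < 2 * ρ / 2 ^ j := by positivity
    have hle : 2 * ρ / 2 ^ j ≤ 2 * ρ :=
      div_le_self (by positivity) (one_le_pow₀ (by norm_num))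
    have h1 : ballAverage (2 * ρ / 2 ^ j) (fun y => g y ^ r) z ≤
        ENNReal.ofReal ((2 * 2 ^ j) ^ n) * ballAverage (3 * ρ) (fun y => g y ^ r) x :=
      ballAverage_le_of_subset hρj (Metric.ball_subset_ball' (by linarith)) (by positivity) (by
        rw [mul_comm (2 : ℝ) (2 ^ j), mul_assoc, mul_div_assoc', mul_div_assoc',
          le_div_iff₀ (by positivity)]
        nlinarith [mul_pos hρ (by positivity : (0 : ℝ) < 2 ^ j)])
    rw [← hj j, mul_assoc, ← ENNReal.mul_rpow_of_nonneg _ _ (by positivity)]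
    gcongr
    refine (ballAverage_le_rpow hr hg z hρj).trans ?_
    gcongr
    refine h1.trans ?_
    gcongr
    exact ballAverage_le_maximal _ x (by positivity)

theorem truncSet_div_subset {D : Rn n → ℝ≥0∞} {lam c b : ℝ} (hc : 0 < c) :
    truncSet D (lam / c) b ⊆ truncSet (fun x => ENNReal.ofReal c * D x) lam b := by
  rintro ⟨x, y⟩ h
  rw [truncSet, mem_ofPred_eq] at h ⊢
  have h2 : lam * ‖x - y‖ ^ b = c * (lam / c * ‖x - y‖ ^ b) := by field_simp
  dsimp only at h ⊢
  rw [h2, ENNReal.ofReal_mul hc.le]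
  exact (ENNReal.mul_lt_mul_iff_right (by simpa using hc) ENNReal.ofReal_ne_top).2 h

theorem functional_le_of_ae_mem_truncSet (hN : IsBallBanach N) (hn : 1 ≤ n) {γ q : ℝ} (hγ : γ ≠ 0)
    (hq : 0 < q) {f : Rn n → ℝ} (hf : Measurable f) {D : Rn n → ℝ≥0∞} (hD : Measurable D)
    (hDN : N D < ⊤) {lam : ℝ} (hlam : 0 < lam)
    (h : ∀ᵐ x ∂(volume : Measure (Rn n)), ∀ᵐ y ∂(volume : Measure (Rn n)),
      (x, y) ∈ levelSet f lam (γ / q) → (x, y) ∈ truncSet D lam (γ / q)) :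
    functional N γ q f lam ≤ radialConst n γ q * N D := by
  have hDm := measurableSet_truncSet hD lam (γ / q)
  refine (functional_le_of_ae hN hq hf hDm h).trans ?_
  rw [← hN.const_mul (radialConst_ne_top γ hq) hD.aemeasurable]
  refine hN.mono _ _ (hD.const_mul _).aemeasurable
    (((measurable_kernelInt hDm).pow_const _).const_mul _).aemeasurable ?_
  filter_upwards [hN.ae_lt_top hD.aemeasurable hDN] with x hx
  exact functional_truncSet_le hn hγ hq hlam hx.ne

theorem tailControl_of_ae_mem_truncSet (hN : IsBallBanach N) {γ q : ℝ} (hq : 0 < q)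
    {f : Rn n → ℝ} {D : Rn n → ℝ≥0∞} (hD : Measurable D) (hDN : N D < ⊤) {l : Filter ℝ}
    (h : ∀ᶠ lam in l, ∀ᵐ x ∂(volume : Measure (Rn n)), ∀ᵐ y ∂(volume : Measure (Rn n)),
      (x, y) ∈ levelSet f lam (γ / q) → (x, y) ∈ truncSet D lam (γ / q)) :
    TailControl N γ q f l := by
  intro ε hε
  refine ⟨D, hD, hDN, fun _ _ => 0, fun _ => measurable_const, ?_⟩
  filter_upwards [h] with lam h
  refine ⟨?_, ?_⟩
  · filter_upwards [h] with x hx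
    rw [add_zero]
    refine kernelInt_le_of_ae ?_
    filter_upwards [hx] with y hy h1 using ⟨h1, hy h1⟩
  · have h0 : (fun _ : Rn n => ENNReal.ofReal lam * (0 : ℝ≥0∞) ^ (1 / q)) =
        fun _ => (0 : ℝ≥0∞) * 0 := by
      ext
      rw [ENNReal.zero_rpow_of_pos (by positivity), mul_zero, mul_zero]
    rw [h0, hN.const_mul ENNReal.zero_ne_top aemeasurable_const, zero_mul]
    exact zero_le

/-- A Morrey-type bound: when the maximal operator is bounded on `X^{1/r}` for some `r > n`, the
difference quotients at `(x, y)` are dominated by a function of `x` alone whose norm is comparable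
to that of the gradient. -/
theorem exists_ae_mem_truncSet (hn : 1 ≤ n) {r : ℝ} (hnr : (n : ℝ) < r)
    (hM : IsBoundedOn maximal (convexification N (1 / r))) (b : ℝ) (hN : IsBallBanach N) :
    ∃ C : ℝ≥0∞, C ≠ ⊤ ∧ ∀ (f : Rn n → ℝ) (g : Rn n → Rn n), Measurable f → Measurable g →
      HasWeakGradient f g → N (fun x => ‖g x‖ₑ) < ⊤ → ∃ D : Rn n → ℝ≥0∞, Measurable D ∧
        N D ≤ C * N (fun x => ‖g x‖ₑ) ∧ ∀ᵐ x ∂(volume : Measure (Rn n)),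
          ∀ᵐ y ∂(volume : Measure (Rn n)), ∀ lam : ℝ, 0 < lam →
            (x, y) ∈ levelSet f lam b → (x, y) ∈ truncSet D lam b := by
  have hr : 1 < r := lt_of_le_of_lt (by exact_mod_cast hn) hnr
  have hr0 : 0 < r := by linarith
  obtain ⟨K, hKt, hK⟩ := exists_dyadicAverage_le_maximal_rpow hr hnr
  obtain ⟨A, hA⟩ := hM
  set c : ℝ := 2 ^ (2 * n + 1) with hc
  have hc0 : 0 < c := by positivity
  have hKt' : ENNReal.ofReal c * (2 * K) ≠ ⊤ := by finiteness
  refine ⟨ENNReal.ofReal c * (2 * K) * (A : ℝ≥0∞) ^ (1 / r),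
    ENNReal.mul_ne_top hKt' (ENNReal.rpow_ne_top_of_nonneg (by positivity) ENNReal.coe_ne_top),
    fun f g hf hg hfg hgN => ?_⟩
  set P : Rn n → ℝ≥0∞ := fun x => maximal (fun y => ‖g y‖ₑ ^ r) x ^ (1 / r) with hP
  have hPm : Measurable P := (measurable_maximal _).pow_const _
  have hPN : N P ≤ (A : ℝ≥0∞) ^ (1 / r) * N fun x => ‖g x‖ₑ := by
    have hroot : (fun x => (‖g x‖ₑ ^ r) ^ (1 / r)) = fun x => ‖g x‖ₑ := by
      ext x
      rw [← ENNReal.rpow_mul, mul_one_div_cancel hr0.ne', ENNReal.rpow_one]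
    have h1 := hA (fun y => ‖g y‖ₑ ^ r) (hg.enorm.pow_const _).aemeasurable (by
      rw [convexification, hroot, one_div_one_div]
      exact ENNReal.rpow_lt_top_of_nonneg hr0.le hgN.ne)
    rw [convexification, convexification, hroot, one_div_one_div] at h1
    have h2 := ENNReal.rpow_le_rpow h1 (by positivity : 0 ≤ 1 / r)
    rwa [ENNReal.mul_rpow_of_nonneg _ _ (by positivity), ← ENNReal.rpow_mul, ← ENNReal.rpow_mul,
      mul_one_div_cancel hr0.ne', ENNReal.rpow_one, ENNReal.rpow_one] at h2
  refine ⟨fun x => ENNReal.ofReal c * (2 * K * P x), (hPm.const_mul _).const_mul _, ?_, ?_⟩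
  · have he : (fun x => ENNReal.ofReal c * (2 * K * P x)) =
        fun x => ENNReal.ofReal c * (2 * K) * P x := funext fun x => (mul_assoc _ _ _).symm
    rw [he, hN.const_mul hKt' hPm.aemeasurable, mul_assoc (ENNReal.ofReal c * (2 * K))]
    gcongr
  · filter_upwards [hfg.ae_mem_majorantSet hg hf b] with x hx
    filter_upwards [hx] with y hy lam hlam hE
    refine truncSet_div_subset hc0 ?_
    obtain ⟨hxy, h⟩ := hy lam hlam hE
    dsimp only at hxy h
    have hρ : 0 < ‖x - y‖ := by rwa [norm_pos_iff, sub_ne_zero]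
    refine lt_of_lt_of_le h ?_
    have h1 := hK _ hg.enorm x x _ hρ (by rw [dist_self]; exact hρ.le)
    have h2 := hK _ hg.enorm x y _ hρ (by rw [dist_comm, dist_eq_norm])
    calc _ ≤ K * P x + K * P x := add_le_add h1 h2
      _ = 2 * K * P x := by ring

end PowerMaximal

/-! ### Boundedness of the maximal operator and exponents at most one -/

section MaximalBounded

variable {n : ℕ} {N : FunctionNorm n}

/-- The set of pairs `(x, y)` with `lam * |x - y|^b < D y`, the reflection of `truncSet`. -/
def dualSet (D : Rn n → ℝ≥0∞) (lam b : ℝ) : Set (Rn n × Rn n) :=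
  {z | ENNReal.ofReal (lam * ‖z.1 - z.2‖ ^ b) < D z.2}

theorem measurableSet_dualSet {D : Rn n → ℝ≥0∞} (hD : Measurable D) (lam b : ℝ) :
    MeasurableSet (dualSet D lam b) :=
  measurableSet_lt (by fun_prop) (hD.comp measurable_snd)

/-- The weighted `L¹` estimate for reflected truncated sets: after exchanging the integrals, the kernel is
integrated in `x` around the fixed point `y`, where the `A₁` condition applies. -/
theorem exists_lintegral_dualSet_le (hn : 1 ≤ n) {b : ℝ} (hb : b ≠ 0) :
    ∃ C : ℝ≥0∞, C ≠ ⊤ ∧ ∀ (D w : Rn n → ℝ≥0∞), Measurable D → Measurable w →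
      (∀ᵐ y ∂(volume : Measure (Rn n)), D y < ⊤) → ∀ A : ℝ≥0∞, (∀ x, maximal w x ≤ A * w x) →
      ∀ lam : ℝ, 0 < lam →
      ∫⁻ x, w x * (ENNReal.ofReal lam * kernelInt b (dualSet D lam b) x) ≤
        C * A * ∫⁻ x, w x * D x := by
  obtain ⟨C, hC⟩ := exists_kernel_le hn hb
  set V : ℝ≥0∞ := volume (Metric.ball (0 : Rn n) 1) with hV
  have hVt : V ≠ ⊤ := volume_unitBall_ne_top
  refine ⟨C * V, by finiteness, fun D w hD hw hDt A hA lam hlam => ?_⟩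
  have hEm := measurableSet_dualSet hD lam b
  set Φ : Rn n × Rn n → ℝ≥0∞ := fun z => w z.1 * (dualSet D lam b).indicator
    (fun z => ENNReal.ofReal (‖z.1 - z.2‖ ^ (b - (n : ℝ)))) z with hΦ
  have hΦm : Measurable Φ := (hw.comp measurable_fst).mul (measurable_indicator_kernel hEm)
  have h1 : ∫⁻ x, w x * (ENNReal.ofReal lam * kernelInt b (dualSet D lam b) x) =
      ENNReal.ofReal lam * ∫⁻ x, ∫⁻ y, Φ (x, y) := by
    have hm : Measurable fun x => ∫⁻ y, Φ (x, y) := hΦm.lintegral_prod_right'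
    rw [← lintegral_const_mul _ hm]
    refine lintegral_congr fun x => ?_
    have hm' : Measurable fun y => (dualSet D lam b).indicator
        (fun z => ENNReal.ofReal (‖z.1 - z.2‖ ^ (b - (n : ℝ)))) (x, y) :=
      (measurable_indicator_kernel hEm).comp measurable_prodMk_left
    rw [mul_left_comm, kernelInt, hΦ]
    dsimp only
    rw [lintegral_const_mul _ hm']
  have h2 : ∀ᵐ y ∂(volume : Measure (Rn n)), ENNReal.ofReal lam * ∫⁻ x, Φ (x, y) ≤
      C * V * A * (w y * D y) := by
    filter_upwards [hDt] with y hy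
    set a : ℝ := (D y).toReal / lam with ha
    have ha0 : 0 ≤ a := by positivity
    set T : Set (Rn n) := {x | ‖x - y‖ ^ b < a} with hT
    have hTm : MeasurableSet T := measurableSet_lt (by fun_prop) measurable_const
    have h3 : ∫⁻ x, Φ (x, y) ≤ ∫⁻ x in T, ENNReal.ofReal (‖x - y‖ ^ (b - n)) * w x := by
      rw [← lintegral_indicator hTm]
      refine lintegral_mono fun x => ?_
      simp only [hΦ]
      by_cases hx : (x, y) ∈ dualSet D lam b
      · have hxT : x ∈ T := by
          have h4 : ENNReal.ofReal (lam * ‖x - y‖ ^ b) < D y := hx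
          rw [ENNReal.ofReal_lt_iff_lt_toReal (by positivity) hy.ne] at h4
          exact (lt_div_iff₀' hlam).2 h4
        rw [indicator_of_mem hx, indicator_of_mem hxT, mul_comm]
      · rw [indicator_of_notMem hx, mul_zero]
        exact zero_le
    have h4 := hC w hw y a ha0 (V * maximal w y) (fun r hr _ => by
      rw [setLIntegral_ball_eq w y hr, volume_ball_eq y hr, mul_assoc]
      gcongr
      exact ballAverage_le_maximal w y hr)
    have h5 : ENNReal.ofReal lam * ENNReal.ofReal a = D y := by
      rw [← ENNReal.ofReal_mul hlam.le, ha, mul_div_cancel₀ _ hlam.ne', ENNReal.ofReal_toReal hy.ne]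
    calc _ ≤ ENNReal.ofReal lam * (C * ENNReal.ofReal a * (V * maximal w y)) := by
          gcongr
          exact h3.trans h4
      _ = C * V * (ENNReal.ofReal lam * ENNReal.ofReal a) * maximal w y := by ring
      _ ≤ C * V * D y * (A * w y) := by
          rw [h5]
          gcongr
          exact hA y
      _ = _ := by ring
  have hm : Measurable fun y => ∫⁻ x, Φ (x, y) := hΦm.lintegral_prod_left'
  have hwD : Measurable fun y => w y * D y := hw.mul hD
  rw [h1, lintegral_lintegral_swap hΦm.aemeasurable, ← lintegral_const_mul _ hm,
    ← lintegral_const_mul _ hwD]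
  exact lintegral_mono_ae h2

/-- Norm bound for reflected truncated sets, extrapolated from the weighted `L¹` estimate at exponent
one and passed to exponents below one. -/
theorem IsBallBanach.exists_dualSet_le (hN : IsBallBanach N) (hn : 1 ≤ n) {L : ℝ≥0} (hL1 : 1 ≤ L)
    (hL : ∀ h : Rn n → ℝ≥0∞, Measurable h → associate N (maximal h) ≤ L * associate N h)
    {b q : ℝ} (hb : b ≠ 0) (hq : 0 < q) (hq1 : q ≤ 1) :
    ∃ C : ℝ≥0∞, C ≠ ⊤ ∧ ∀ D : Rn n → ℝ≥0∞, Measurable D → N D < ⊤ → ∀ lam : ℝ, 0 < lam →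
      N (fun x => ENNReal.ofReal lam * kernelInt (b * q) (dualSet D lam b) x ^ (1 / q)) ≤
        C * N D := by
  obtain ⟨C₁, hC₁t, hC₁⟩ := exists_kernelInt_rpow_le hn hb hq hq1
  obtain ⟨C₂, hC₂t, hC₂⟩ := exists_lintegral_dualSet_le hn hb
  refine ⟨C₁ * (2 * (C₂ * ((2 * L : ℝ≥0) : ℝ≥0∞))), by finiteness, fun D hD hDN lam hlam => ?_⟩
  have hEm := measurableSet_dualSet hD lam b
  have hm : Measurable fun x => ENNReal.ofReal lam * kernelInt b (dualSet D lam b) x :=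
    (measurable_kernelInt hEm).const_mul _
  have h1 := hN.extrapolation hL1 hL hm.aemeasurable hD.aemeasurable hDN
    (fun w hw hwA => hC₂ D w hD hw (hN.ae_lt_top hD.aemeasurable hDN) _ hwA lam hlam)
  calc _ ≤ N (fun x => C₁ * (ENNReal.ofReal lam * kernelInt b (dualSet D lam b) x)) := by
        refine hN.mono _ _ (hm.const_mul _).aemeasurable
          (((measurable_kernelInt hEm).pow_const _).const_mul _).aemeasurable
          (ae_of_all _ fun x => ?_)
        have h2 := hC₁ _ hEm x
        rw [mul_one, div_one, ENNReal.rpow_one] at h2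
        exact (mul_le_mul_right h2 _).trans_eq (mul_left_comm _ _ _)
    _ ≤ _ := by
        rw [hN.const_mul hC₁t hm.aemeasurable, mul_assoc]
        gcongr

theorem dyadicAverage_le_maximal (g : Rn n → ℝ≥0∞) (x : Rn n) {ρ : ℝ} (hρ : 0 < ρ) :
    dyadicAverage g x ρ ≤ 2 * maximal g x :=
  dyadicAverage_le_of_forall fun _ => ballAverage_le_maximal g x (by positivity)

theorem majorantSet_subset_union {g : Rn n → ℝ≥0∞} {lam c b : ℝ} (hc : 0 < c) :
    majorantSet g (lam / c) b ⊆
      truncSet (fun x => ENNReal.ofReal c * (4 * maximal g x)) lam b ∪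
        dualSet (fun x => ENNReal.ofReal c * (4 * maximal g x)) lam b := by
  rintro ⟨x, y⟩ ⟨hxy, h⟩
  dsimp only at hxy h
  have hρ : 0 < 2 * ‖x - y‖ := by
    have : 0 < ‖x - y‖ := by rwa [norm_pos_iff, sub_ne_zero]
    positivity
  have h1 : ENNReal.ofReal (lam / c * ‖x - y‖ ^ b) < 4 * max (maximal g x) (maximal g y) := by
    refine lt_of_lt_of_le h ?_
    calc _ ≤ 2 * maximal g x + 2 * maximal g y := add_le_add (dyadicAverage_le_maximal g x hρ)
          (dyadicAverage_le_maximal g y hρ)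
      _ ≤ 2 * max (maximal g x) (maximal g y) + 2 * max (maximal g x) (maximal g y) := by
          gcongr
          exacts [le_max_left _ _, le_max_right _ _]
      _ = _ := by ring
  have h2 : lam * ‖x - y‖ ^ b = c * (lam / c * ‖x - y‖ ^ b) := by field_simp
  have h3 : ENNReal.ofReal (lam * ‖x - y‖ ^ b) <
      ENNReal.ofReal c * (4 * max (maximal g x) (maximal g y)) := by
    rw [h2, ENNReal.ofReal_mul hc.le]
    exact (ENNReal.mul_lt_mul_iff_right (by simpa using hc) ENNReal.ofReal_ne_top).2 h1
  rcases le_total (maximal g x) (maximal g y) with h4 | h4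
  · rw [max_eq_right h4] at h3
    exact Or.inr h3
  · rw [max_eq_left h4] at h3
    exact Or.inl h3

/-- When the maximal operator is bounded on `X`, the majorant set of the gradient is covered by a
truncated set and its reflection, both of height a multiple of the maximal function. -/
theorem hasUpperBound_of_maximal (hN : IsBallBanach N) (hn : 1 ≤ n) {L : ℝ≥0} (hL1 : 1 ≤ L)
    (hL : ∀ h : Rn n → ℝ≥0∞, Measurable h → associate N (maximal h) ≤ L * associate N h)
    (hM : IsBoundedOn maximal N) {γ q : ℝ} (hγ : γ ≠ 0) (hq : 0 < q) (hq1 : q ≤ 1) :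
    HasUpperBound N γ q := by
  obtain ⟨C, hCt, hC⟩ := hN.exists_dualSet_le hn hL1 hL (div_ne_zero hγ hq.ne') hq hq1
  obtain ⟨A, hA⟩ := hM
  set c : ℝ := 2 ^ (2 * n + 1) with hc
  have hc0 : 0 < c := by positivity
  set K : ℝ≥0∞ := ENNReal.ofReal c * 4 with hK
  have hKt : K ≠ ⊤ := by finiteness
  have hRt := radialConst_ne_top (n := n) γ hq
  refine ⟨2 ^ (1 / q) * ((radialConst n γ q + C) * (K * A)), ENNReal.mul_ne_top
    (ENNReal.rpow_ne_top_of_nonneg (by positivity) (by simp)) (by finiteness),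
    fun f g hf hg hfg hgN lam hlam => ?_⟩
  set P : Rn n → ℝ≥0∞ := fun x => ENNReal.ofReal c * (4 * maximal (fun y => ‖g y‖ₑ) x) with hP
  have hMm := measurable_maximal fun y => ‖g y‖ₑ
  have hPm : Measurable P := (hMm.const_mul _).const_mul _
  have hPN : N P ≤ K * A * N fun x => ‖g x‖ₑ := by
    have he : P = fun x => K * maximal (fun y => ‖g y‖ₑ) x :=
      funext fun x => (mul_assoc _ _ _).symm
    rw [he, hN.const_mul hKt hMm.aemeasurable, mul_assoc K]
    exact mul_le_mul_right (hA _ hg.enorm.aemeasurable hgN) _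
  have hPt : N P < ⊤ := hPN.trans_lt (by finiteness)
  have hE₁ := measurableSet_truncSet hPm lam (γ / q)
  have hE₂ := measurableSet_dualSet hPm lam (γ / q)
  have hT₁ : Measurable fun x => radialConst n γ q * P x := hPm.const_mul _
  have hT₂ : Measurable fun x =>
      ENNReal.ofReal lam * kernelInt γ (dualSet P lam (γ / q)) x ^ (1 / q) :=
    ((measurable_kernelInt hE₂).pow_const _).const_mul _
  have hd := hC P hPm hPt lam hlam
  rw [div_mul_cancel₀ γ hq.ne'] at hd
  refine (functional_le_of_ae hN hq hf (hE₁.union hE₂) ?_).trans ?_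
  · filter_upwards [hfg.ae_mem_majorantSet hg hf (γ / q)] with x hx
    filter_upwards [hx] with y hy hE using majorantSet_subset_union hc0 (hy lam hlam hE)
  have hT₁₂ : Measurable fun x => radialConst n γ q * P x +
      ENNReal.ofReal lam * kernelInt γ (dualSet P lam (γ / q)) x ^ (1 / q) := hT₁.add hT₂
  have h2t : (2 : ℝ≥0∞) ^ (1 / q) ≠ ⊤ := ENNReal.rpow_ne_top_of_nonneg (by positivity) (by simp)
  calc _ ≤ N (fun x => (2 : ℝ≥0∞) ^ (1 / q) * (radialConst n γ q * P x +
          ENNReal.ofReal lam * kernelInt γ (dualSet P lam (γ / q)) x ^ (1 / q))) := by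
        refine hN.mono _ _ (hT₁₂.const_mul _).aemeasurable
          (((measurable_kernelInt (hE₁.union hE₂)).pow_const _).const_mul _).aemeasurable ?_
        filter_upwards [hN.ae_lt_top hPm.aemeasurable hPt] with x hx
        calc _ ≤ ENNReal.ofReal lam * (2 ^ (1 / q) *
              (kernelInt γ (truncSet P lam (γ / q)) x ^ (1 / q) +
                kernelInt γ (dualSet P lam (γ / q)) x ^ (1 / q))) := by
              gcongr
              exact (ENNReal.rpow_le_rpow (kernelInt_union_le hE₁ x) (by positivity)).trans
                (add_rpow_le_two _ _ (by positivity))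
          _ = 2 ^ (1 / q) * (ENNReal.ofReal lam *
              kernelInt γ (truncSet P lam (γ / q)) x ^ (1 / q) +
                ENNReal.ofReal lam * kernelInt γ (dualSet P lam (γ / q)) x ^ (1 / q)) := by ring
          _ ≤ _ := by
              refine mul_le_mul_right (add_le_add_left ?_ _) _
              exact functional_truncSet_le hn hγ hq hlam hx.ne
    _ ≤ 2 ^ (1 / q) * (radialConst n γ q * N P + C * N P) := by
        rw [hN.const_mul h2t hT₁₂.aemeasurable]
        gcongr
        refine (hN.add_le _ _ hT₁.aemeasurable hT₂.aemeasurable).trans ?_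
        rw [hN.const_mul hRt hPm.aemeasurable]
        gcongr
    _ ≤ 2 ^ (1 / q) * ((radialConst n γ q + C) * (K * A * N fun x => ‖g x‖ₑ)) := by
        rw [← add_mul]
        gcongr
    _ = _ := by ring

theorem norm_le_of_mem_dualSet {P : Rn n → ℝ≥0∞} {k : ℕ} (hPk : ∀ x, P x ≤ k)
    (hP0 : ∀ x, (k : ℝ) < ‖x‖ → P x = 0) {lam b : ℝ} {x y : Rn n} (h : (x, y) ∈ dualSet P lam b) :
    ENNReal.ofReal (lam * ‖x - y‖ ^ b) < k ∧ ‖y‖ ≤ k := by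
  have h1 : ENNReal.ofReal (lam * ‖x - y‖ ^ b) < P y := h
  refine ⟨h1.trans_le (hPk y), ?_⟩
  by_contra! hy
  rw [hP0 y hy] at h1
  exact not_lt_zero h1

/-- Far from the support of a bounded compactly supported function, the kernel integrals of its
dual sets decay uniformly. -/
theorem exists_dualSet_decay {γ q : ℝ} (hq : 0 < q) (hq1 : q ≤ 1) {l : Filter ℝ}
    (hl : (0 < γ ∧ l ≤ atTop) ∨ (γ < 0 ∧ l ≤ 𝓝[>] 0)) :
    ∃ a : ℝ, a < -n ∧ ∀ (k : ℕ) (P : Rn n → ℝ≥0∞), (∀ x, P x ≤ k) →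
      (∀ x, (k : ℝ) < ‖x‖ → P x = 0) → ∃ c : ℝ → ℝ≥0∞, Tendsto c l (𝓝 0) ∧
        ∀ᶠ lam in l, ∀ x : Rn n, 2 * ((k : ℝ) + 1) ≤ ‖x‖ →
          ENNReal.ofReal lam * kernelInt γ (dualSet P lam (γ / q)) x ^ (1 / q) ≤
            c lam * ENNReal.ofReal (‖x‖ ^ a) := by
  have hfar : ∀ {k : ℕ} {x y : Rn n}, ‖y‖ ≤ k → 2 * ((k : ℝ) + 1) ≤ ‖x‖ →
      ‖x‖ / 2 ≤ ‖x - y‖ := by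
    intro k x y hy hx
    have := norm_sub_norm_le x y
    linarith
  rcases hl with ⟨hγ, hl⟩ | ⟨hγ, hl⟩
  · refine ⟨-n - 1, by linarith, fun k P hPk hP0 => ⟨fun _ => 0, tendsto_const_nhds, ?_⟩⟩
    filter_upwards [hl (eventually_ge_atTop (k : ℝ)), hl (eventually_gt_atTop 0)]
      with lam hlam hlam0 x hx
    have hempty : ∀ y, (x, y) ∉ dualSet P lam (γ / q) := by
      intro y hy
      obtain ⟨h1, h2⟩ := norm_le_of_mem_dualSet hPk hP0 hy
      have h3 := hfar h2 hx
      have hk0 : (0 : ℝ) ≤ k := by positivity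
      have h4 : (1 : ℝ) ≤ ‖x - y‖ ^ (γ / q) := Real.one_le_rpow (by linarith) (by positivity)
      refine h1.not_ge ?_
      rw [← ENNReal.ofReal_natCast]
      exact ENNReal.ofReal_le_ofReal (hlam.trans (le_mul_of_one_le_right hlam0.le h4))
    have h0 : kernelInt γ (dualSet P lam (γ / q)) x = 0 := by
      rw [kernelInt]
      simp [indicator_of_notMem (hempty _)]
    rw [h0, ENNReal.zero_rpow_of_pos (by positivity), mul_zero]
    exact zero_le
  · have hγn : γ - n < 0 := by
      have : (0 : ℝ) ≤ n := by positivity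
      linarith
    refine ⟨(γ - n) / q, ?_, fun k P hPk hP0 => ?_⟩
    · rw [div_lt_iff₀ hq]
      have : (n : ℝ) * q ≤ n := mul_le_of_le_one_right (by positivity) hq1
      linarith
    set B : Set (Rn n) := Metric.closedBall 0 k with hB
    set K : ℝ≥0∞ := (ENNReal.ofReal ((1 / 2) ^ (γ - n)) * volume B) ^ (1 / q) with hK
    have hKt : K ≠ ⊤ := ENNReal.rpow_ne_top_of_nonneg (by positivity)
      (ENNReal.mul_ne_top ENNReal.ofReal_ne_top measure_closedBall_lt_top.ne)
    refine ⟨fun lam => ENNReal.ofReal lam * K, ?_, Eventually.of_forall fun lam x hx => ?_⟩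
    · have h1 : Tendsto (fun lam : ℝ => ENNReal.ofReal lam) l (𝓝 0) := by
        have := (ENNReal.continuous_ofReal.tendsto (0 : ℝ)).mono_left
          (hl.trans nhdsWithin_le_nhds)
        rwa [ENNReal.ofReal_zero] at this
      have h2 := ENNReal.Tendsto.mul_const h1 (Or.inr hKt)
      rwa [zero_mul] at h2
    · have hk0 : (0 : ℝ) ≤ k := by positivity
      have hx0 : 0 < ‖x‖ := by linarith
      rw [mul_assoc]
      gcongr
      have h1 : kernelInt γ (dualSet P lam (γ / q)) x ≤
          ENNReal.ofReal ((‖x‖ / 2) ^ (γ - n)) * volume B := by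
        rw [← setLIntegral_const, ← lintegral_indicator Metric.isClosed_closedBall.measurableSet,
          kernelInt]
        refine lintegral_mono fun y => ?_
        by_cases hy : (x, y) ∈ dualSet P lam (γ / q)
        · have h2 := (norm_le_of_mem_dualSet hPk hP0 hy).2
          have hyB : y ∈ B := mem_closedBall_zero_iff.2 h2
          rw [indicator_of_mem hy, indicator_of_mem hyB]
          exact ENNReal.ofReal_le_ofReal
            (Real.rpow_le_rpow_of_nonpos (by positivity) (hfar h2 hx) hγn.le)
        · rw [indicator_of_notMem hy]
          exact zero_le
      refine (ENNReal.rpow_le_rpow h1 (by positivity)).trans (le_of_eq ?_)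
      have h3 : ENNReal.ofReal (‖x‖ ^ ((γ - n) / q)) =
          ENNReal.ofReal (‖x‖ ^ (γ - n)) ^ (1 / q) := by
        rw [ENNReal.ofReal_rpow_of_pos (by positivity), ← Real.rpow_mul hx0.le, mul_one_div]
      rw [h3, hK, ← ENNReal.mul_rpow_of_nonneg _ _ (by positivity), mul_right_comm,
        ← ENNReal.ofReal_mul (by positivity), div_eq_mul_one_div ‖x‖,
        Real.mul_rpow hx0.le (by norm_num), mul_comm (‖x‖ ^ (γ - n))]

/-- Tail control when the maximal operator is bounded on `X`. The maximal function itself is split into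
a bounded, compactly supported part and a part of small norm. -/
theorem tailControl_of_maximal (hN : IsBallBanach N) (hac : HasAbsContNorm N) (hn : 1 ≤ n)
    (havg : ∃ C : ℝ≥0, ∀ r : ℝ, 0 < r → BoundedBy (ballAverage r) N C) {L : ℝ≥0} (hL1 : 1 ≤ L)
    (hL : ∀ h : Rn n → ℝ≥0∞, Measurable h → associate N (maximal h) ≤ L * associate N h)
    (hM : IsBoundedOn maximal N) {γ q : ℝ} (hγ : γ ≠ 0) (hq : 0 < q) (hq1 : q ≤ 1)
    {l : Filter ℝ} (hl : (0 < γ ∧ l ≤ atTop) ∨ (γ < 0 ∧ l ≤ 𝓝[>] 0))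
    {f : Rn n → ℝ} (hf : Measurable f) {g : Rn n → Rn n} (hg : Measurable g)
    (hfg : HasWeakGradient f g) (hgN : N (fun x => ‖g x‖ₑ) < ⊤) : TailControl N γ q f l := by
  obtain ⟨C, hCt, hC⟩ := hN.exists_dualSet_le hn hL1 hL (div_ne_zero hγ hq.ne') hq hq1
  obtain ⟨A, hA⟩ := hM
  set c₀ : ℝ := 2 ^ (2 * n + 1) with hc₀
  have hc₀0 : 0 < c₀ := by positivity
  obtain ⟨a, ha, hdecay⟩ := exists_dualSet_decay (n := n) hq hq1 hl
  set P : Rn n → ℝ≥0∞ := fun x => ENNReal.ofReal c₀ * (4 * maximal (fun y => ‖g y‖ₑ) x) with hP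
  have hMm := measurable_maximal fun y => ‖g y‖ₑ
  have hPm : Measurable P := (hMm.const_mul _).const_mul _
  have hPt : N P < ⊤ := by
    have he : P = fun x => ENNReal.ofReal c₀ * 4 * maximal (fun y => ‖g y‖ₑ) x :=
      funext fun x => (mul_assoc _ _ _).symm
    rw [he, hN.const_mul (by finiteness) hMm.aemeasurable]
    have h1 := (hA _ hg.enorm.aemeasurable hgN).trans_lt
      (ENNReal.mul_lt_top ENNReal.coe_lt_top hgN)
    finiteness
  refine tailControl_of_cover hN havg hq hf ha fun ε hε => ?_
  obtain ⟨k, P₁, P₂, hP₁, hP₂, hsum, hP₁k, hP₁0, hdisj, hP₂N⟩ := exists_split hac hN hPm hPt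
    (ENNReal.div_pos hε.ne' (by finiteness : C + 1 ≠ ⊤))
  obtain ⟨c, hc, hfar⟩ := hdecay k P₁ hP₁k hP₁0
  set R : ℝ := 2 * ((k : ℝ) + 1) with hR
  have hk0 : (0 : ℝ) ≤ k := by positivity
  set B : Rn n → ℝ≥0∞ := (Metric.ball (0 : Rn n) R).indicator 1 with hB
  have hBm : Measurable B := measurable_one.indicator measurableSet_ball
  have hkB : Measurable fun x => (k : ℝ≥0∞) * B x := hBm.const_mul _
  refine ⟨fun x => P x + k * B x, hPm.add hkB, ?_, fun lam => dualSet P₁ lam (γ / q),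
    fun lam => dualSet P₂ lam (γ / q), R, c, by linarith, hc,
    fun lam => measurableSet_dualSet hP₁ _ _, fun lam => measurableSet_dualSet hP₂ _ _, ?_⟩
  · refine (hN.add_le _ _ hPm.aemeasurable hkB.aemeasurable).trans_lt ?_
    rw [hN.const_mul (ENNReal.natCast_ne_top k) hBm.aemeasurable]
    have h1 := hN.ball_mem 0 R (by linarith)
    exact ENNReal.add_lt_top.2 ⟨hPt, ENNReal.mul_lt_top (ENNReal.natCast_lt_top k) h1⟩
  filter_upwards [hfar, eventually_pos_of_le hl] with lam hfar hlam
  refine ⟨?_, ?_, hfar, ?_⟩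
  · filter_upwards [hfg.ae_mem_majorantSet hg hf (γ / q)] with x hx
    filter_upwards [hx] with y hy hE
    rcases majorantSet_subset_union hc₀0 (hy lam hlam hE) with h1 | h1
    · refine Or.inl ?_
      have h2 : ENNReal.ofReal (lam * ‖x - y‖ ^ (γ / q)) < P x := h1
      exact h2.trans_le le_self_add
    · refine Or.inr ?_
      have h2 : ENNReal.ofReal (lam * ‖x - y‖ ^ (γ / q)) < P₁ y + P₂ y := (hsum y) ▸ h1
      rcases hdisj y with h3 | h3
      · rw [h3, zero_add] at h2
        exact Or.inr h2
      · rw [h3, add_zero] at h2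
        exact Or.inl h2
  · intro x y hx hxy
    have h1 := (norm_le_of_mem_dualSet hP₁k hP₁0 hxy).1
    have hxB : x ∈ Metric.ball (0 : Rn n) R := by rwa [mem_ball_zero_iff]
    have h2 : B x = 1 := by rw [hB, indicator_of_mem hxB, Pi.one_apply]
    rw [truncSet, mem_ofPred_eq]
    dsimp only
    rw [h2, mul_one]
    exact h1.trans_le le_add_self
  · have hP₂t : N P₂ < ⊤ := (hN.mono _ _ hPm.aemeasurable hP₂.aemeasurable
      (ae_of_all _ fun x => le_add_self.trans_eq (hsum x).symm)).trans_lt hPt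
    have h1 := hC P₂ hP₂ hP₂t lam hlam
    rw [div_mul_cancel₀ γ hq.ne'] at h1
    calc _ ≤ C * N P₂ := h1
      _ ≤ C * (ε / (C + 1)) := by gcongr
      _ ≤ ε := mul_div_add_one_le

end MaximalBounded

/-! ### Conclusion -/

section Conclusion

variable {n : ℕ} {N : FunctionNorm n}

theorem HasWeakGradient.congr_ae {f f' : Rn n → ℝ} {g g' : Rn n → Rn n}
    (hfg : HasWeakGradient f g) (hf : f =ᵐ[volume] f') (hg : g =ᵐ[volume] g') :
    HasWeakGradient f' g' where
  locallyIntegrable := hfg.locallyIntegrable.congr hf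
  locallyIntegrable_grad := hfg.locallyIntegrable_grad.congr hg
  integral_eq φ hφ hφc i := by
    have h1 : ∫ x, f x * fderiv ℝ φ x (EuclideanSpace.single i 1) =
        ∫ x, f' x * fderiv ℝ φ x (EuclideanSpace.single i 1) :=
      integral_congr_ae (by filter_upwards [hf] with x hx; rw [hx])
    have h2 : ∫ x, φ x * g x i = ∫ x, φ x * g' x i :=
      integral_congr_ae (by filter_upwards [hg] with x hx; rw [hx])
    rw [← h1, ← h2]
    exact hfg.integral_eq φ hφ hφc i

theorem functional_congr_ae (hN : IsBallBanach N) {γ q : ℝ} {f f' : Rn n → ℝ}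
    (hf' : Measurable f') (hf : f =ᵐ[volume] f') (lam : ℝ) :
    functional N γ q f lam = functional N γ q f' lam := by
  have hm : Measurable fun x => kernelInt γ (levelSet f' lam (γ / q)) x ^ (1 / q) :=
    (measurable_kernelInt (measurableSet_levelSet hf' _ _)).pow_const _
  have h : (fun x => kernelInt γ (levelSet f' lam (γ / q)) x ^ (1 / q)) =ᵐ[volume]
      fun x => kernelInt γ (levelSet f lam (γ / q)) x ^ (1 / q) := by
    filter_upwards [hf] with x hx
    congr 1
    refine le_antisymm (kernelInt_le_of_ae ?_) (kernelInt_le_of_ae ?_) <;>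
    · filter_upwards [hf] with y hy
      simp [levelSet, hx, hy]
  have h1 := hN.congr_ae hm.aemeasurable h
  exact congrArg (fun t => ENNReal.ofReal lam * t) h1.symm

/-- Every element of the homogeneous Sobolev space has an everywhere measurable representative. -/
theorem MemHomSobolev.exists_measurable (hN : IsBallBanach N) {γ q : ℝ} {f : Rn n → ℝ}
    {g : Rn n → Rn n} (h : MemHomSobolev N f g) :
    ∃ (f' : Rn n → ℝ) (g' : Rn n → Rn n), Measurable f' ∧ Measurable g' ∧ HasWeakGradient f' g' ∧
      N (fun x => ‖g' x‖ₑ) < ⊤ ∧ N (fun x => ‖g x‖ₑ) = N (fun x => ‖g' x‖ₑ) ∧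
      functional N γ q f = functional N γ q f' := by
  obtain ⟨hfg, hgN⟩ := h
  have hf := hfg.locallyIntegrable.aestronglyMeasurable
  have hg := hfg.locallyIntegrable_grad.aestronglyMeasurable
  have hf' := hf.stronglyMeasurable_mk.measurable
  have hg' := hg.stronglyMeasurable_mk.measurable
  have hNg : N (fun x => ‖g x‖ₑ) = N fun x => ‖hg.mk g x‖ₑ :=
    hN.congr_ae hg.enorm (by filter_upwards [hg.ae_eq_mk] with x hx; rw [← hx])
  exact ⟨hf.mk f, hg.mk g, hf', hg', hfg.congr_ae hf.ae_eq_mk hg.ae_eq_mk, hNg ▸ hgN, hNg,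
    funext (functional_congr_ae hN hf' hf.ae_eq_mk)⟩

/-- `TailControl` for all functions with gradient in `X`, in the limit relevant to the sign of
`γ`. -/
def HasTailControl (N : FunctionNorm n) (γ q : ℝ) : Prop :=
  ∀ (l : Filter ℝ), (0 < γ ∧ l ≤ atTop) ∨ (γ < 0 ∧ l ≤ 𝓝[>] 0) →
    ∀ (f : Rn n → ℝ) (g : Rn n → Rn n), Measurable f → Measurable g → HasWeakGradient f g →
      N (fun x => ‖g x‖ₑ) < ⊤ → TailControl N γ q f l

theorem hasUpperBound_of_powerMaximal (hN : IsBallBanach N) (hn : 1 ≤ n) {γ q : ℝ} (hγ : γ ≠ 0)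
    (hq : 0 < q) {r : ℝ} (hnr : (n : ℝ) < r)
    (hM : IsBoundedOn maximal (convexification N (1 / r))) : HasUpperBound N γ q := by
  obtain ⟨C, hCt, hC⟩ := exists_ae_mem_truncSet hn hnr hM (γ / q) hN
  have hRt := radialConst_ne_top (n := n) γ hq
  refine ⟨radialConst n γ q * C, by finiteness, fun f g hf hg hfg hgN lam hlam => ?_⟩
  obtain ⟨D, hD, hDN, h⟩ := hC f g hf hg hfg hgN
  refine (functional_le_of_ae_mem_truncSet hN hn hγ hq hf hD (hDN.trans_lt (by finiteness)) hlam
    ?_).trans ?_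
  · filter_upwards [h] with x hx
    filter_upwards [hx] with y hy using hy lam hlam
  · rw [mul_assoc]
    gcongr

theorem hasTailControl_of_powerMaximal (hN : IsBallBanach N) (hn : 1 ≤ n) {γ q : ℝ}
    (hq : 0 < q) {r : ℝ} (hnr : (n : ℝ) < r)
    (hM : IsBoundedOn maximal (convexification N (1 / r))) : HasTailControl N γ q := by
  obtain ⟨C, hCt, hC⟩ := exists_ae_mem_truncSet hn hnr hM (γ / q) hN
  intro l hl f g hf hg hfg hgN
  obtain ⟨D, hD, hDN, h⟩ := hC f g hf hg hfg hgN
  refine tailControl_of_ae_mem_truncSet hN hq hD (hDN.trans_lt (by finiteness)) ?_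
  filter_upwards [eventually_pos_of_le hl] with lam hlam
  filter_upwards [h] with x hx
  filter_upwards [hx] with y hy using hy lam hlam

/-- In each of the four regimes the functionals are bounded and their tails are controlled. -/
theorem upperBound_and_tailControl (hn : 1 ≤ n) (hN : IsBallBanach N) (hac : HasAbsContNorm N)
    (havg : ∃ C : ℝ≥0, ∀ r : ℝ, 0 < r → BoundedBy (ballAverage r) N C) {L : ℝ≥0} (hL1 : 1 ≤ L)
    (hL : ∀ h : Rn n → ℝ≥0∞, Measurable h → associate N (maximal h) ≤ L * associate N h)
    {γ q : ℝ}
    (hcases : (γ ≠ 0 ∧ 0 < q ∧ q ≤ 1 ∧ IsBoundedOn maximal N) ∨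
      (γ ≠ 0 ∧ 0 < q ∧
        ∃ r : ℝ, (n : ℝ) < r ∧ IsBoundedOn maximal (convexification N (1 / r))) ∨
      (0 < γ ∧ 0 < q ∧ (n : ℝ) * (1 - 1 / q) < 1) ∨
      (γ < -1 ∧ n = 1 ∧ q = 1)) :
    γ ≠ 0 ∧ 0 < q ∧ HasUpperBound N γ q ∧ HasTailControl N γ q := by
  have hdy : ∀ {γ q : ℝ}, 0 < q → (n : ℝ) * (1 - 1 / q) < 1 → (0 < γ / q ∨ γ / q < -n) →
      HasUpperBound N γ q ∧ HasTailControl N γ q := fun hq hnq hb =>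
    ⟨hasUpperBound_of_dyadic hN hn hL1 hL hq hnq hb, fun l hl f g hf hg hfg hgN =>
      tailControl_of_dyadic hN hac hn havg hL1 hL hq hnq hb hl hf hg hfg hgN⟩
  rcases hcases with ⟨hγ, hq, hq1, hM⟩ | ⟨hγ, hq, r, hnr, hM⟩ | ⟨hγ, hq, hnq⟩ | ⟨hγ, hn1, rfl⟩
  · exact ⟨hγ, hq, hasUpperBound_of_maximal hN hn hL1 hL hM hγ hq hq1,
      fun l hl f g hf hg hfg hgN =>
        tailControl_of_maximal hN hac hn havg hL1 hL hM hγ hq hq1 hl hf hg hfg hgN⟩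
  · exact ⟨hγ, hq, hasUpperBound_of_powerMaximal hN hn hγ hq hnr hM,
      hasTailControl_of_powerMaximal hN hn hq hnr hM⟩
  · exact ⟨hγ.ne', hq, hdy hq hnq (Or.inl (by positivity))⟩
  · refine ⟨by linarith, one_pos, hdy one_pos (by norm_num) (Or.inr ?_)⟩
    rw [div_one, hn1, Nat.cast_one]
    exact hγ

end Conclusion

end BVY

theorem theorem4p8 {n : ℕ} (hn : 1 ≤ n) (N : BVY.FunctionNorm n) (hN : BVY.IsBallBanach N)
    (hac : BVY.HasAbsContNorm N)
    (havg : ∃ C : ℝ≥0, ∀ r : ℝ, 0 < r → BVY.BoundedBy (BVY.ballAverage r) N C)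
    (θ : ℕ → ℝ) (hθ : ∀ m, θ m ∈ Set.Ioo (0 : ℝ) 1) (hθlim : Tendsto θ atTop (𝓝 1))
    (hconv : ∀ m, BVY.IsBallBanach (BVY.convexification N (1 / θ m)))
    (hM : ∀ m, BVY.IsBoundedOn BVY.maximal (BVY.associate (BVY.convexification N (1 / θ m))))
    (hMlim : ∃ L : ℝ≥0, Tendsto
      (fun m => BVY.opNorm BVY.maximal (BVY.associate (BVY.convexification N (1 / θ m))))
      atTop (𝓝 (L : ℝ≥0∞)))
    (γ q : ℝ)
    (hcases :
      -- (a)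
      (γ ≠ 0 ∧ 0 < q ∧ q ≤ 1 ∧ BVY.IsBoundedOn BVY.maximal N) ∨
      -- (b)
      (γ ≠ 0 ∧ 0 < q ∧
        ∃ r : ℝ, (n : ℝ) < r ∧ BVY.IsBoundedOn BVY.maximal (BVY.convexification N (1 / r))) ∨
      -- (c)
      (0 < γ ∧ 0 < q ∧ (n : ℝ) * (1 - 1 / q) < 1) ∨
      -- (d)
      (γ < -1 ∧ n = 1 ∧ q = 1))
    (e : BVY.Rn n) (he : ‖e‖ = 1) :
    -- (i)
    (∃ C : ℝ, 0 < C ∧ ∀ (f : BVY.Rn n → ℝ) (g : BVY.Rn n → BVY.Rn n), BVY.MemHomSobolev N f g →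
      ENNReal.ofReal ((BVY.kappa q e / |γ|) ^ (1 / q)) * N (fun x => ‖g x‖ₑ)
          ≤ (⨆ (lam : ℝ) (_ : 0 < lam), BVY.functional N γ q f lam) ∧
        (⨆ (lam : ℝ) (_ : 0 < lam), BVY.functional N γ q f lam)
          ≤ ENNReal.ofReal C * N (fun x => ‖g x‖ₑ)) ∧
    -- (ii)
    (0 < γ → ∀ (f : BVY.Rn n → ℝ) (g : BVY.Rn n → BVY.Rn n), BVY.MemHomSobolev N f g →
      Tendsto (fun lam : ℝ => BVY.functional N γ q f lam) atTop
        (𝓝 (ENNReal.ofReal ((BVY.kappa q e / γ) ^ (1 / q)) * N (fun x => ‖g x‖ₑ)))) ∧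
    -- (iii)
    (γ < 0 → ((2 ≤ n ∧ q < ((n : ℝ) - γ) / n) ∨ (n = 1 ∧ q < -γ ∧ γ < -1)) →
      ∀ (f : BVY.Rn n → ℝ) (g : BVY.Rn n → BVY.Rn n), BVY.MemHomSobolev N f g →
      Tendsto (fun lam : ℝ => BVY.functional N γ q f lam) (𝓝[>] 0)
        (𝓝 (ENNReal.ofReal ((-(BVY.kappa q e) / γ) ^ (1 / q)) * N (fun x => ‖g x‖ₑ)))) := by
  obtain ⟨L, hL1, hL⟩ := BVY.exists_associate_maximal_le hN hθ hθlim hMlim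
  obtain ⟨hγ, hq, ⟨C, hCt, hC⟩, hT⟩ :=
    BVY.upperBound_and_tailControl hn hN hac havg hL1 hL hcases
  refine ⟨⟨C.toReal + 1, by positivity, fun f g hfg => ?_⟩, fun hγ0 f g hfg => ?_,
    fun hγ0 _ f g hfg => ?_⟩
  all_goals
    obtain ⟨f', g', hf', hg', hfg', hgN', hNg, hfun⟩ := hfg.exists_measurable (γ := γ) (q := q) hN
    rw [hNg, hfun]
  · refine ⟨BVY.le_iSup_functional hN hn hγ hq hf' hg' hfg' he, iSup₂_le fun lam hlam => ?_⟩
    refine (hC f' g' hf' hg' hfg' hgN' lam hlam).trans (mul_le_mul_left ?_ _)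
    rw [← ENNReal.ofReal_toReal hCt]
    exact ENNReal.ofReal_le_ofReal (by rw [ENNReal.toReal_ofReal (by positivity)]; linarith)
  · have h := BVY.tendsto_functional hN hac hn hγ hq hf' hg' hfg' hgN' he
      (hT atTop (Or.inl ⟨hγ0, le_rfl⟩) f' g' hf' hg' hfg' hgN') (eventually_gt_atTop 0) (by
        rw [neg_div]
        exact tendsto_rpow_neg_atTop (by positivity))
    rwa [abs_of_pos hγ0] at h
  · have hexp : 0 < -1 / (γ / q) :=
      div_pos_of_neg_of_neg (by norm_num) (div_neg_of_neg_of_pos hγ0 hq)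
    have h := BVY.tendsto_functional hN hac hn hγ hq hf' hg' hfg' hgN' he
      (hT (𝓝[>] 0) (Or.inr ⟨hγ0, le_rfl⟩) f' g' hf' hg' hfg' hgN') self_mem_nhdsWithin (by
        have h0 := (Real.continuousAt_rpow_const 0 _ (Or.inr hexp.le)).tendsto
        rw [Real.zero_rpow hexp.ne'] at h0
        exact h0.mono_left nhdsWithin_le_nhds)
    rwa [abs_of_neg hγ0, div_neg, ← neg_div] at h
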